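/- Let $k,c,\nu$ be real constants with $c\neq 0$ and $c=-(1+\nu)$, let $M\subset\mathbb{R}^4$ be a connected open set with coordinates $(\tau,\phi,x_1,x_2)$, let $G(x_1,x_2),H(x_1,x_2),X_1(x_1),X_2(x_2)$ be smooth functions, and put $F=x_2^2X_1-x_1^2X_2$. Suppose that $$g=\frac{(F\,d\tau+G\,d\phi)^2}{(x_1-x_2)HF}+\frac{kH}{(x_1-x_2)^3}\left(\frac{dx_1^2}{X_1}-\frac{dx_2^2}{X_2}-\frac{X_1X_2}{kF}\,d\phi^2\right)$$ is a smooth Riemannian (positive definite) metric on $M$ (this forces $k>0$). Define $$W=\frac{k}{c^2}\frac{(x_1-x_2)H}{F},\quad \psi=\frac{\sqrt k}{c}\tau,\quad y=\frac{c}{\sqrt k}\phi,\quad A=\frac{k}{c^2}\frac{G}{F}\,dy,\quad e^u=\frac{-X_1X_2}{(x_1-x_2)^4},$$ $$dx=c\left(\frac{x_1}{X_1}dx_1-\frac{x_2}{X_2}dx_2\right),\quad z=\frac{c\,x_2}{x_2-x_1}+\nu=\frac{\nu x_1+x_2}{x_1-x_2},\quad dz=c\,\frac{x_2\,dx_1-x_1\,dx_2}{(x_1-x_2)^2},$$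 the two-form $\kappa=(d\psi+A)\wedge dz+We^u\,dx\wedge dy$ and the almost-complex structure $J^a{}_b=\kappa_{bc}g^{ca}$, for which $dx+i\,dy$ and $d\psi+A+iW\,dz$ are of type $(1,0)$. Assume that $g$ is conformally Kähler with respect to $J$ with conformal factor $\Omega=z^{-1}$, that is, $z\neq0$ on $M$, $J$ is integrable and $d(z^{-2}\kappa)=0$. The Einstein–Maxwell equations with $\lambda=0$ for $g$ and a smooth two-form $\mathcal F$ are $$R_{ab}-\tfrac{R}{2}g_{ab}=2\mathcal F_{ac}\mathcal F_b{}^c-\tfrac12 g_{ab}\mathcal F_{cd}\mathcal F^{cd},\qquad \nabla^a\mathcal F_{ab}=0=\nabla_{[a}\mathcal F_{bc]}.$$ Then the following are equivalent: 1. there are constants $a_0,\dots,a_4\in\mathbb{R}$ such that, on $M$, $$X_1=a_0+a_1x_1+a_2x_1^2+a_3x_1^3+a_4x_1^4,\qquad X_2=a_0+a_1x_2+a_2x_2^2+a_3x_2^3+a_4x_2^4;$$ 2. $g$ satisfies the Einstein–Maxwell equations with $\lambda=0$ for some smooth two-form $\mathcal F$ on $M$; 3. $g$ satisfies the Einstein–Maxwell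 equations with $\lambda=0$ for the two-form $\mathcal F=z^{-2}\kappa+\tfrac14z^2\left(\rho-\tfrac R4\kappa\right)$, where $\rho_{ab}=R_{bc}J^c{}_a$. In particular, for arbitrary $a_0,\dots,a_4$, every choice of $G,H$ for which the above assumptions hold gives an Einstein–Maxwell geometry. -/

import Mathlib

open scoped Matrix ContDiff

noncomputable section

/-! Local Riemannian geometry in a coordinate domain of `ℝ⁴`: tensors are given by their
components in the coordinate frame. -/

/-- Points of the coordinate space. -/
abbrev Pt : Type := Fin 4 → ℝ

/-- The partial derivative `∂ᵢ f`. -/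
def pd (i : Fin 4) (f : Pt → ℝ) (p : Pt) : ℝ := fderiv ℝ f p (Pi.single i 1)

/-- A field of `4 × 4` matrices (the components of a tensor of rank two). -/
abbrev Field2 : Type := Pt → Matrix (Fin 4) (Fin 4) ℝ

/-- Smoothness of all components on `M`. -/
def SmoothField2 (M : Set Pt) (T : Field2) : Prop :=
  ∀ a b, ContDiffOn ℝ ∞ (fun p => T p a b) M

/-- `g` is a smooth Riemannian metric on `M`. -/
def IsRiemannian (M : Set Pt) (g : Field2) : Prop :=
  SmoothField2 M g ∧ ∀ p ∈ M, (g p).PosDef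

/-- Christoffel symbols `Γⁱⱼₖ` of the Levi-Civita connection. -/
def christoffel (g : Field2) (i j k : Fin 4) (p : Pt) : ℝ :=
  (1 / 2) * ∑ l, (g p)⁻¹ i l *
    (pd j (fun q => g q l k) p + pd k (fun q => g q l j) p - pd l (fun q => g q j k) p)

/-- The Ricci tensor `Rⱼₖ = ∂ᵢ Γⁱⱼₖ - ∂ₖ Γⁱᵢⱼ + Γⁱᵢₗ Γˡⱼₖ - Γⁱₖₗ Γˡᵢⱼ` (positive on spheres). -/
def ricci (g : Field2) : Field2 := fun p j k =>
  ∑ i, (pd i (christoffel g i j k) p - pd k (christoffel g i i j) p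
    + ∑ l, (christoffel g i i l p * christoffel g l j k p
      - christoffel g i k l p * christoffel g l i j p))

/-- The scalar curvature `R = gᵃᵇ Rₐᵦ`. -/
def scalarCurv (g : Field2) (p : Pt) : ℝ := ∑ a, ∑ b, (g p)⁻¹ a b * ricci g p a b

/-- The covariant derivative `∇_c T_{ab}` of a tensor with two lower indices. -/
def covDeriv (g T : Field2) (c a b : Fin 4) (p : Pt) : ℝ :=
  pd c (fun q => T q a b) p
    - ∑ d, (christoffel g d c a p * T p d b + christoffel g d c b p * T p a d)

/-- The component `(dφ)_{abc} = ∂ₐ φ_{bc} + ∂ᵦ φ_{ca} + ∂_c φ_{ab}` of the exterior derivative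
of a two-form. -/
def extDeriv2 (φ : Field2) (a b c : Fin 4) (p : Pt) : ℝ :=
  pd a (fun q => φ q b c) p + pd b (fun q => φ q c a) p + pd c (fun q => φ q a b) p

/-- `φ` is a smooth two-form on `M`. -/
def IsTwoForm (M : Set Pt) (φ : Field2) : Prop :=
  SmoothField2 M φ ∧ ∀ p ∈ M, ∀ a b, φ p a b = -φ p b a

/-- The contraction `F_{ac} F_b{}^c`. -/
def formSq (g F : Field2) (p : Pt) (a b : Fin 4) : ℝ :=
  ∑ c, ∑ d, F p a c * (g p)⁻¹ c d * F p b d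

/-- The Einstein–Maxwell equations with cosmological constant `Λ`, for the metric `g` and the
two-form `F`. -/
structure IsEinsteinMaxwell (M : Set Pt) (g F : Field2) (Λ : ℝ) : Prop where
  twoForm : IsTwoForm M F
  einstein : ∀ p ∈ M, ∀ a b,
    ricci g p a b - scalarCurv g p / 2 * g p a b + Λ * g p a b =
      2 * formSq g F p a b - (1 / 2) * g p a b * ∑ c, ∑ d, (g p)⁻¹ c d * formSq g F p c d
  divFree : ∀ p ∈ M, ∀ b, ∑ a, ∑ c, (g p)⁻¹ a c * covDeriv g F c a b p = 0
  closed : ∀ p ∈ M, ∀ a b c, extDeriv2 F a b c p = 0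

/-- The Nijenhuis tensor of `J`, where `J p a b` is the component `Jᵃᵦ`. -/
def nijenhuis (J : Field2) (k i j : Fin 4) (p : Pt) : ℝ :=
  ∑ l, (J p l i * pd l (fun q => J q k j) p - J p l j * pd l (fun q => J q k i) p
    - J p k l * (pd i (fun q => J q l j) p - pd j (fun q => J q l i) p))

/-- The fundamental two-form `κ_{ab} = g_{bc} Jᶜₐ`. -/
def fundForm (g J : Field2) : Field2 := fun p a b => ∑ c, g p b c * J p c a

/-- The tensor `ρ_{ab} = R_{bc} Jᶜₐ` (the Ricci form when the Ricci tensor is `J`-invariant). -/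
def ricciForm (g J : Field2) : Field2 := fun p a b => ∑ c, ricci g p b c * J p c a

/-- `(Ω² g, J)` is Kähler on `M`: `J` is an integrable almost-complex structure, `g` is
`J`-Hermitian and the two-form `Ω² κ` is closed. -/
structure IsConformallyKahler (M : Set Pt) (g J : Field2) (Ω : Pt → ℝ) : Prop where
  factor_smooth : ContDiffOn ℝ ∞ Ω M
  factor_ne_zero : ∀ p ∈ M, Ω p ≠ 0
  smooth : SmoothField2 M J
  sq : ∀ p ∈ M, J p * J p = -1
  hermitian : ∀ p ∈ M, (J p)ᵀ * g p * J p = g p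
  integrable : ∀ p ∈ M, ∀ k i j, nijenhuis J k i j p = 0
  closed : ∀ p ∈ M, ∀ a b c, extDeriv2 (fun q => Ω q ^ 2 • fundForm g J q) a b c p = 0

/-- The Maxwell field `F = F⁻ + F⁺` of a conformally Kähler metric, where `F⁻ = Ω² κ` and
`F⁺ = ¼ Ω⁻² (ρ - ¼ R κ)`. -/
def maxwellField (g J : Field2) (Ω : Pt → ℝ) : Field2 := fun p =>
  Ω p ^ 2 • fundForm g J p +
    (1 / 4 * (Ω p ^ 2)⁻¹) • (ricciForm g J p - (scalarCurv g p / 4) • fundForm g J p)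

/-- The wedge product of two covectors, `(α ∧ β)_{ab} = αₐ βᵦ - αᵦ βₐ`. -/
def wedge (α β : Fin 4 → ℝ) : Matrix (Fin 4) (Fin 4) ℝ :=
  Matrix.vecMulVec α β - Matrix.vecMulVec β α

/-- The constants and free functions of the Chen–Teo-type ansatz in the coordinates
`(τ, φ, x₁, x₂) = (p 0, p 1, p 2, p 3)`, with the constants `c`, `ν` that enter the change of
variables to LeBrun normal form. -/
structure ChenTeo where
  k : ℝ
  c : ℝ
  ν : ℝ
  G : ℝ → ℝ → ℝ
  H : ℝ → ℝ → ℝ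
  X₁ : ℝ → ℝ
  X₂ : ℝ → ℝ

namespace ChenTeo

variable (D : ChenTeo)

/-- The free functions are smooth on the sets of values that their arguments take on `M`. -/
def SmoothOn (M : Set Pt) : Prop :=
  ContDiffOn ℝ ∞ (fun q : ℝ × ℝ => D.G q.1 q.2) ((fun p : Pt => (p 2, p 3)) '' M) ∧
  ContDiffOn ℝ ∞ (fun q : ℝ × ℝ => D.H q.1 q.2) ((fun p : Pt => (p 2, p 3)) '' M) ∧
  ContDiffOn ℝ ∞ D.X₁ ((fun p : Pt => p 2) '' M) ∧
  ContDiffOn ℝ ∞ D.X₂ ((fun p : Pt => p 3) '' M)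

/-- `F = x₂² X₁ - x₁² X₂`. -/
def F (p : Pt) : ℝ := p 3 ^ 2 * D.X₁ (p 2) - p 2 ^ 2 * D.X₂ (p 3)

/-- The one-form `F dτ + G dφ`. -/
def θ (p : Pt) : Fin 4 → ℝ := ![D.F p, D.G (p 2) (p 3), 0, 0]

/-- The metric
`(F dτ + G dφ)² / ((x₁ - x₂) H F)
  + k H / (x₁ - x₂)³ (dx₁² / X₁ - dx₂² / X₂ - X₁ X₂ / (k F) dφ²)`. -/
def metric : Field2 := fun p =>
  (1 / ((p 2 - p 3) * D.H (p 2) (p 3) * D.F p)) • Matrix.vecMulVec (D.θ p) (D.θ p) +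
    (D.k * D.H (p 2) (p 3) / (p 2 - p 3) ^ 3) •
      Matrix.diagonal ![0, -(D.X₁ (p 2) * D.X₂ (p 3) / (D.k * D.F p)),
        1 / D.X₁ (p 2), -(1 / D.X₂ (p 3))]

/-- `W = (k / c²) (x₁ - x₂) H / F`. -/
def W (p : Pt) : ℝ := D.k / D.c ^ 2 * ((p 2 - p 3) * D.H (p 2) (p 3) / D.F p)

/-- `e^u = -X₁ X₂ / (x₁ - x₂)⁴`. -/
def expU (p : Pt) : ℝ := -(D.X₁ (p 2) * D.X₂ (p 3)) / (p 2 - p 3) ^ 4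

/-- The function `z = c x₂ / (x₂ - x₁) + ν`. -/
def z (p : Pt) : ℝ := D.c * p 3 / (p 3 - p 2) + D.ν

/-- `dψ`, where `ψ = (√k / c) τ`. -/
def dψ : Fin 4 → ℝ := ![√D.k / D.c, 0, 0, 0]

/-- `dy`, where `y = (c / √k) φ`. -/
def dy : Fin 4 → ℝ := ![0, D.c / √D.k, 0, 0]

/-- `dx = c (x₁ / X₁ dx₁ - x₂ / X₂ dx₂)`. -/
def dx (p : Pt) : Fin 4 → ℝ :=
  ![0, 0, D.c * (p 2 / D.X₁ (p 2)), -(D.c * (p 3 / D.X₂ (p 3)))]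

/-- `dz = c (x₂ dx₁ - x₁ dx₂) / (x₁ - x₂)²`. -/
def dz (p : Pt) : Fin 4 → ℝ :=
  ![0, 0, D.c * p 3 / (p 2 - p 3) ^ 2, -(D.c * p 2 / (p 2 - p 3) ^ 2)]

/-- `A = G̃ dy`, where `G̃ = (k / c²) G / F`. -/
def A (p : Pt) : Fin 4 → ℝ := (D.k / D.c ^ 2 * (D.G (p 2) (p 3) / D.F p)) • D.dy

/-- The two-form `κ = (dψ + A) ∧ dz + W e^u dx ∧ dy`. -/
def κ : Field2 := fun p =>
  wedge (D.dψ + D.A p) (D.dz p) + (D.W p * D.expU p) • wedge (D.dx p) D.dy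

/-- The almost-complex structure `Jᵃᵦ = κ_{bc} g^{ca}`; the forms `dψ + A + i W dz` and
`dx + i dy` are of type `(1,0)` for it. -/
def J : Field2 := fun p a b => ∑ c, D.κ p b c * (D.metric p)⁻¹ c a

/-- The conformal factor `Ω = z⁻¹`. -/
def Ω (p : Pt) : ℝ := (D.z p)⁻¹

end ChenTeo

end

noncomputable section

/-! ### Partial derivatives of smooth functions on an open set -/

section Calculus

variable {M : Set Pt} {f g : Pt → ℝ} {p : Pt}

/-! In the coordinates ψ, y, x, z the metric has LeBrun form W⁻¹(dψ + A dy)² + W(e^u(dx² + dy²) +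
dz²), with all coefficients independent of ψ and y. The hypotheses on `J` yield two first-order
equations for A: integrability gives A_z = W_x, and closedness of z⁻²κ gives A_x = -z² ∂_z(z⁻² W
e^u) (`dZ_A_of_nijenhuis`, `dX_A_of_closed`). Once they are substituted, A drops out of the
Levi-Civita connection in the frame dual to dψ + A dy, dy, dx, dz, and their compatibility A_xz =
A_zx determines W_xx. The Ricci tensor is then J-invariant, and R = -(u_xx + (e^u)_zz) / (W e^u)
(`frameRicci_eq`, `scalarCurv_eq`). So R = 0 is exactly the Toda equation for u.

In dimension four the Maxwell stress tensor is trace-free, so every Einstein–Maxwell solution with λ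
= 0 has R = 0 (`IsEinsteinMaxwell.scalarCurv_eq_zero`), whatever the two-form is. Conversely, assume
the Toda equation and put F⁻ = z⁻²κ, F⁺ = ¼z²ρ. The squares of F⁻ and F⁺ contribute only multiples
of g to the stress tensor, and the cross terms add up to Ric (`frameRicci_eq_stress`). F⁻ is closed
by hypothesis. Closedness of F⁺ reduces to two scalar equations, the second of which uses the
z-derivative of the Toda equation (`maxwell_eq_one`, `maxwell_eq_two`). F⁺ and F⁻ have opposite
duality, which is why coclosedness holds as well; `frameCov_maxwellFrame` checks both properties
directly.

For the ansatz, e^u involves only X₁ and X₂. By `toda_eq` the Toda equation is the linear relation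
s²(X₁'' - X₂'') - 6s(X₁' + X₂') + 12(X₁ - X₂) = 0, where s = x₁ - x₂. Differentiating three times in
x₁ leaves s² X₁⁽⁵⁾ = 0, so X₁ is a quartic. The relation and its first two derivatives then give
X₂(x₂) as the Taylor expansion of that same quartic about x₁ (`isQuartic_of_todaExpr`). Conversely,
a common quartic satisfies the relation identically.

Curvature is defined through coordinate Christoffel symbols, so `IsFrameConnection` carries the
transfer to a moving frame: connection, Ricci tensor, covariant derivative, divergence and exterior
derivative. After that transfer each geometric claim is an algebraic identity in the derivatives of
u and v = log W. -/

theorem differentiableAt_of_mem (hM : IsOpen M) (hp : p ∈ M) (hf : ContDiffOn ℝ ∞ f M) :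
    DifferentiableAt ℝ f p :=
  (hf.contDiffAt (hM.mem_nhds hp)).differentiableAt (by simp)

theorem pd_congr (hM : IsOpen M) (hp : p ∈ M) (h : ∀ q ∈ M, f q = g q) (i : Fin 4) :
    pd i f p = pd i g p := by
  have : f =ᶠ[nhds p] g := Filter.eventuallyEq_of_mem (hM.mem_nhds hp) h
  simp only [pd, this.fderiv_eq]

@[simp] theorem pd_const (i : Fin 4) (r : ℝ) : pd i (fun _ => r) p = 0 := by
  simp [pd]

theorem pd_add (hM : IsOpen M) (hp : p ∈ M) (hf : ContDiffOn ℝ ∞ f M) (hg : ContDiffOn ℝ ∞ g M)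
    (i : Fin 4) : pd i (fun q => f q + g q) p = pd i f p + pd i g p := by
  simp only [pd]
  rw [fderiv_fun_add (differentiableAt_of_mem hM hp hf) (differentiableAt_of_mem hM hp hg)]
  rfl

theorem pd_neg (i : Fin 4) : pd i (fun q => -f q) p = -pd i f p := by
  simp only [pd]
  rw [fderiv_fun_neg]
  rfl

theorem pd_sub (hM : IsOpen M) (hp : p ∈ M) (hf : ContDiffOn ℝ ∞ f M) (hg : ContDiffOn ℝ ∞ g M)
    (i : Fin 4) : pd i (fun q => f q - g q) p = pd i f p - pd i g p := by
  simp only [pd]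
  rw [fderiv_fun_sub (differentiableAt_of_mem hM hp hf) (differentiableAt_of_mem hM hp hg)]
  rfl

theorem pd_mul (hM : IsOpen M) (hp : p ∈ M) (hf : ContDiffOn ℝ ∞ f M) (hg : ContDiffOn ℝ ∞ g M)
    (i : Fin 4) : pd i (fun q => f q * g q) p = pd i f p * g p + f p * pd i g p := by
  simp only [pd]
  rw [fderiv_fun_mul (differentiableAt_of_mem hM hp hf) (differentiableAt_of_mem hM hp hg)]
  simp
  ring

theorem pd_sum (hM : IsOpen M) (hp : p ∈ M) {ι : Type*} (s : Finset ι) {F : ι → Pt → ℝ}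
    (hF : ∀ j, ContDiffOn ℝ ∞ (F j) M) (i : Fin 4) :
    pd i (fun q => ∑ j ∈ s, F j q) p = ∑ j ∈ s, pd i (F j) p := by
  simp only [pd]
  rw [fderiv_fun_sum fun j _ => differentiableAt_of_mem hM hp (hF j)]
  simp

theorem ContDiffOn.pd (hM : IsOpen M) (hf : ContDiffOn ℝ ∞ f M) (i : Fin 4) :
    ContDiffOn ℝ ∞ (pd i f) M := by
  have h := hf.fderiv_of_isOpen hM (m := ∞) (by simp)
  exact h.clm_apply contDiffOn_const

theorem pd_comm (hM : IsOpen M) (hp : p ∈ M) (hf : ContDiffOn ℝ ∞ f M) (i j : Fin 4) :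
    pd i (pd j f) p = pd j (pd i f) p := by
  have hc : ContDiffAt ℝ ∞ f p := hf.contDiffAt (hM.mem_nhds hp)
  have hs := hc.isSymmSndFDerivAt (by
    rw [minSmoothness_of_isRCLikeNormedField]
    exact WithTop.coe_le_coe.2 (le_top : (2 : ℕ∞) ≤ ⊤))
  have hd : DifferentiableAt ℝ (fderiv ℝ f) p :=
    (hc.fderiv_right (m := ∞) (by simp)).differentiableAt (by simp)
  have key : ∀ v w : Pt, fderiv ℝ (fun q => fderiv ℝ f q v) p w = fderiv ℝ (fderiv ℝ f) p w v := by
    intro v w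
    rw [fderiv_clm_apply hd (differentiableAt_const v)]
    simp
  change fderiv ℝ (fun q => fderiv ℝ f q _) p _ = fderiv ℝ (fun q => fderiv ℝ f q _) p _
  rw [key, key]
  exact hs _ _

end Calculus

/-! ### Fields of matrices -/

/-- The entrywise partial derivative of a field of matrices. -/
def pdM (i : Fin 4) (T : Field2) : Field2 := fun p => Matrix.of fun a b => pd i (fun q => T q a b) p

section MatrixCalculus

variable {M : Set Pt} {S T : Field2} {p : Pt}

theorem pdM_apply (i : Fin 4) (T : Field2) (p : Pt) (a b : Fin 4) :
    pdM i T p a b = pd i (fun q => T q a b) p := rfl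

theorem SmoothField2.mul (hS : SmoothField2 M S) (hT : SmoothField2 M T) :
    SmoothField2 M (fun q => S q * T q) := fun a b => by
  simp only [Matrix.mul_apply]
  exact ContDiffOn.sum fun c _ => (hS a c).mul (hT c b)

theorem SmoothField2.transpose (hS : SmoothField2 M S) : SmoothField2 M (fun q => (S q)ᵀ) :=
  fun a b => hS b a

theorem SmoothField2.pdM (hM : IsOpen M) (hS : SmoothField2 M S) (i : Fin 4) :
    SmoothField2 M (pdM i S) := fun a b => (hS a b).pd hM i

theorem SmoothField2.congr (hS : SmoothField2 M S) (h : ∀ p ∈ M, T p = S p) :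
    SmoothField2 M T := fun a b => (hS a b).congr fun p hp => by rw [h p hp]

theorem pdM_congr (hM : IsOpen M) (hp : p ∈ M) (h : ∀ q ∈ M, S q = T q) (i : Fin 4) :
    pdM i S p = pdM i T p := by
  ext a b
  exact pd_congr hM hp (fun q hq => by rw [h q hq]) i

theorem pdM_mul (hM : IsOpen M) (hp : p ∈ M) (hS : SmoothField2 M S) (hT : SmoothField2 M T)
    (i : Fin 4) : pdM i (fun q => S q * T q) p = pdM i S p * T p + S p * pdM i T p := by
  ext a b
  simp only [pdM_apply, Matrix.mul_apply, Matrix.add_apply]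
  rw [pd_sum hM hp _ fun c => (hS a c).mul (hT c b), ← Finset.sum_add_distrib]
  exact Finset.sum_congr rfl fun c _ => pd_mul hM hp (hS a c) (hT c b) i

theorem pdM_add (hM : IsOpen M) (hp : p ∈ M) (hS : SmoothField2 M S) (hT : SmoothField2 M T)
    (i : Fin 4) : pdM i (fun q => S q + T q) p = pdM i S p + pdM i T p := by
  ext a b
  exact pd_add hM hp (hS a b) (hT a b) i

theorem pdM_transpose (i : Fin 4) : pdM i (fun q => (S q)ᵀ) p = (pdM i S p)ᵀ := rfl

theorem pdM_comm (hM : IsOpen M) (hp : p ∈ M) (hS : SmoothField2 M S) (i j : Fin 4) :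
    pdM i (pdM j S) p = pdM j (pdM i S) p := by
  ext a b
  exact pd_comm hM hp (hS a b) i j

end MatrixCalculus

/-! ### Levi-Civita connection and Ricci tensor in a moving frame -/

/-- A symmetric metric-compatible connection is the Levi-Civita connection. -/
theorem christoffel_eq_of_compatible {g : Field2} {p : Pt} (K : Fin 4 → Matrix (Fin 4) (Fin 4) ℝ)
    (hg : (g p)⁻¹ * g p = 1) (hgs : (g p)ᵀ = g p)
    (hK : ∀ a c b, K a c b = K b c a) (hc : ∀ a, pdM a g p = (K a)ᵀ * g p + g p * K a)
    (i j k : Fin 4) : christoffel g i j k p = K j i k := by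
  have hs : ∀ a b, g p a b = g p b a := fun a b => by
    conv_lhs => rw [← hgs]
    rfl
  have hd : ∀ a b c, pd a (fun q => g q b c) p = ∑ d, (K a d b * g p d c + g p b d * K a d c) := by
    intro a b c
    have := congrFun (congrFun (hc a) b) c
    simpa [pdM_apply, Matrix.mul_apply, Finset.sum_add_distrib] using this
  have h2 : ∀ l, pd j (fun q => g q l k) p + pd k (fun q => g q l j) p - pd l (fun q => g q j k) p
      = 2 * ∑ d, g p l d * K j d k := by
    intro l
    rw [hd, hd, hd, ← Finset.sum_add_distrib, ← Finset.sum_sub_distrib, Finset.mul_sum]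
    refine Finset.sum_congr rfl fun d _ => ?_
    -- Koszul's argument: after expanding the three derivatives of g, symmetry of the connection
    -- makes four of the six terms cancel and the other two coincide.
    rw [hK k d l, hK k d j, hK l d j, hs d k, hs d j, hs l d]
    ring
  have h3 : ∑ l, (g p)⁻¹ i l * ∑ d, g p l d * K j d k = K j i k := by
    have : ((g p)⁻¹ * (g p * K j)) i k = K j i k := by rw [← mul_assoc, hg, one_mul]
    simpa [Matrix.mul_apply] using this
  simp only [christoffel]
  simp_rw [h2]
  rw [← h3, Finset.mul_sum]
  refine Finset.sum_congr rfl fun l _ => ?_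
  ring

/-- The derivative of `f` along the `α`-th vector (column) of the frame `B`. -/
def frameD (B : Field2) (α : Fin 4) (f : Pt → ℝ) (p : Pt) : ℝ := ∑ a, B p a α * pd a f p

/-- The entrywise derivative of a field of matrices along a frame vector. -/
def frameDM (B : Field2) (α : Fin 4) (T : Field2) : Field2 :=
  fun p => Matrix.of fun a b => frameD B α (fun q => T q a b) p

/-- On `M`, the metric `g` has components `h` in the moving frame `B` with coframe `C`, and the
matrices `N α` (with `∇_{e_α} e_β = ∑ γ, N α γ β e_γ`) form its Levi-Civita connection. -/
structure IsFrameConnection (M : Set Pt) (g B C h : Field2) (N : Fin 4 → Field2) : Prop where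
  smooth_B : SmoothField2 M B
  smooth_C : SmoothField2 M C
  smooth_h : SmoothField2 M h
  smooth_N : ∀ α, SmoothField2 M (N α)
  coframe_mul_frame : ∀ p ∈ M, C p * B p = 1
  metric_eq : ∀ p ∈ M, g p = (C p)ᵀ * h p * C p
  inv_mul : ∀ p ∈ M, (h p)⁻¹ * h p = 1
  symm : ∀ p ∈ M, (h p)ᵀ = h p
  compatible : ∀ p ∈ M, ∀ α, frameDM B α h p = (N α p)ᵀ * h p + h p * N α p
  torsion_free : ∀ p ∈ M, ∀ γ a b, pd a (fun q => C q γ b) p - pd b (fun q => C q γ a) p =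
    -∑ α, ∑ β, C p α a * C p β b * (N α p γ β - N β p γ α)

/-- The curvature `R(e_α, e_β)` computed from the connection matrices `N` of the frame `B`. -/
def frameCurv (B : Field2) (N : Fin 4 → Field2) (α β : Fin 4) : Field2 := fun p =>
  frameDM B α (N β) p - frameDM B β (N α) p + N α p * N β p - N β p * N α p
    - ∑ γ, (N α p γ β - N β p γ α) • N γ p

/-- The Ricci tensor in the frame `B`. -/
def frameRicci (B : Field2) (N : Fin 4 → Field2) : Field2 := fun p =>
  Matrix.of fun δ β => ∑ α, frameCurv B N α β p α δ

namespace IsFrameConnection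

variable {M : Set Pt} {g B C h : Field2} {N : Fin 4 → Field2}

/-- The connection matrix `∑ α, C α a • N α`. -/
def conn (C : Field2) (N : Fin 4 → Field2) (a : Fin 4) : Field2 := fun p => ∑ α, C p α a • N α p

theorem frame_mul_coframe (H : IsFrameConnection M g B C h N) {p : Pt} (hp : p ∈ M) :
    B p * C p = 1 := mul_eq_one_comm.1 (H.coframe_mul_frame p hp)

theorem sum_coframe_frameD (H : IsFrameConnection M g B C h N) {p : Pt} (hp : p ∈ M)
    (f : Pt → ℝ) (a : Fin 4) : ∑ α, C p α a * frameD B α f p = pd a f p := by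
  have hBC := H.frame_mul_coframe hp
  simp only [frameD, Finset.mul_sum]
  rw [Finset.sum_comm]
  have : ∀ b, ∑ α, C p α a * (B p b α * pd b f p) = (if b = a then 1 else 0) * pd b f p := by
    intro b
    have e := congrFun (congrFun hBC b) a
    rw [Matrix.mul_apply, Matrix.one_apply] at e
    rw [← e, Finset.sum_mul]
    exact Finset.sum_congr rfl fun α _ => by ring
  simp [this]

theorem sum_coframe_frameDM (H : IsFrameConnection M g B C h N) {p : Pt} (hp : p ∈ M)
    (T : Field2) (a : Fin 4) : ∑ α, C p α a • frameDM B α T p = pdM a T p := by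
  ext i j
  rw [Matrix.sum_apply]
  simpa [frameDM, pdM_apply] using H.sum_coframe_frameD hp (fun q => T q i j) a

theorem smooth_conn (H : IsFrameConnection M g B C h N) (a : Fin 4) :
    SmoothField2 M (conn C N a) := fun i j => by
  have : (fun p => conn C N a p i j) = fun p => ∑ α, C p α a * N α p i j := by
    ext p
    simp [conn, Matrix.sum_apply]
  rw [this]
  exact ContDiffOn.sum fun α _ => (H.smooth_C α a).mul (H.smooth_N α i j)

/-- The matrices of the Christoffel symbols. -/
def coordConn (B C : Field2) (N : Fin 4 → Field2) (a : Fin 4) : Field2 := fun p =>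
  B p * pdM a C p + B p * conn C N a p * C p

theorem metric_symm (H : IsFrameConnection M g B C h N) {p : Pt} (hp : p ∈ M) :
    (g p)ᵀ = g p := by
  rw [H.metric_eq p hp]
  simp [Matrix.transpose_mul, H.symm p hp, mul_assoc]

theorem metric_inv (H : IsFrameConnection M g B C h N) {p : Pt} (hp : p ∈ M) :
    (g p)⁻¹ = B p * (h p)⁻¹ * (B p)ᵀ := by
  have hCB := H.coframe_mul_frame p hp
  have hCB' : (B p)ᵀ * (C p)ᵀ = 1 := by rw [← Matrix.transpose_mul, hCB, Matrix.transpose_one]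
  apply Matrix.inv_eq_left_inv
  calc B p * (h p)⁻¹ * (B p)ᵀ * g p
      = B p * (h p)⁻¹ * ((B p)ᵀ * (C p)ᵀ) * h p * C p := by
        rw [H.metric_eq p hp]; simp only [mul_assoc]
    _ = B p * ((h p)⁻¹ * h p) * C p := by rw [hCB']; simp only [mul_assoc, one_mul]
    _ = 1 := by rw [H.inv_mul p hp, mul_one, H.frame_mul_coframe hp]

theorem metric_inv_mul (H : IsFrameConnection M g B C h N) {p : Pt} (hp : p ∈ M) :
    (g p)⁻¹ * g p = 1 := by
  have hCB := H.coframe_mul_frame p hp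
  have hCB' : (B p)ᵀ * (C p)ᵀ = 1 := by rw [← Matrix.transpose_mul, hCB, Matrix.transpose_one]
  rw [H.metric_inv hp]
  calc B p * (h p)⁻¹ * (B p)ᵀ * g p
      = B p * (h p)⁻¹ * ((B p)ᵀ * (C p)ᵀ) * h p * C p := by
        rw [H.metric_eq p hp]; simp only [mul_assoc]
    _ = B p * ((h p)⁻¹ * h p) * C p := by rw [hCB']; simp only [mul_assoc, one_mul]
    _ = 1 := by rw [H.inv_mul p hp, mul_one, H.frame_mul_coframe hp]

/-- Conjugation of the coordinate connection to the frame, for bilinear forms. -/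
theorem pdM_sub_coordConn (H : IsFrameConnection M g B C h N) (hM : IsOpen M) {p : Pt}
    (hp : p ∈ M) {T t : Field2} (ht : SmoothField2 M t)
    (hT : ∀ q ∈ M, T q = (C q)ᵀ * t q * C q) (a : Fin 4) :
    pdM a T p - (coordConn B C N a p)ᵀ * T p - T p * coordConn B C N a p =
      (C p)ᵀ * (pdM a t p - (conn C N a p)ᵀ * t p - t p * conn C N a p) * C p := by
  have hCB := H.coframe_mul_frame p hp
  have hCB' : (B p)ᵀ * (C p)ᵀ = 1 := by rw [← Matrix.transpose_mul, hCB, Matrix.transpose_one]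
  have e1 : T p * coordConn B C N a p =
      (C p)ᵀ * t p * pdM a C p + (C p)ᵀ * t p * conn C N a p * C p := by
    rw [hT p hp, coordConn]
    calc _ = (C p)ᵀ * t p * (C p * B p) * pdM a C p
          + (C p)ᵀ * t p * (C p * B p) * conn C N a p * C p := by noncomm_ring
      _ = _ := by rw [hCB]; simp only [mul_one]
  have e2 : (coordConn B C N a p)ᵀ * T p =
      (pdM a C p)ᵀ * t p * C p + (C p)ᵀ * (conn C N a p)ᵀ * t p * C p := by
    rw [hT p hp, coordConn]
    simp only [Matrix.transpose_add, Matrix.transpose_mul]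
    calc _ = (pdM a C p)ᵀ * ((B p)ᵀ * (C p)ᵀ) * t p * C p
          + (C p)ᵀ * (conn C N a p)ᵀ * ((B p)ᵀ * (C p)ᵀ) * t p * C p := by noncomm_ring
      _ = _ := by rw [hCB']; simp only [mul_one]
  have e3 : pdM a T p = (pdM a C p)ᵀ * t p * C p + (C p)ᵀ * pdM a t p * C p
      + (C p)ᵀ * t p * pdM a C p := by
    rw [pdM_congr hM hp hT, pdM_mul hM hp (H.smooth_C.transpose.mul ht) H.smooth_C,
      pdM_mul hM hp H.smooth_C.transpose ht, pdM_transpose]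
    noncomm_ring
  rw [e1, e2, e3]
  noncomm_ring

/-- The first structure equation dC = -ω ∧ C, read in coordinates: the antisymmetric part of ∂_a C
plus that of the connection term vanishes. -/
theorem coordConn_symm (H : IsFrameConnection M g B C h N) {p : Pt} (hp : p ∈ M) (a c b : Fin 4) :
    coordConn B C N a p c b = coordConn B C N b p c a := by
  have key : ∀ γ, pdM a C p γ b + (conn C N a p * C p) γ b
      = pdM b C p γ a + (conn C N b p * C p) γ a := by
    intro γ
    have ht := H.torsion_free p hp γ a b
    have hx : ∀ a b, (conn C N a p * C p) γ b = ∑ α, ∑ β, C p α a * C p β b * N α p γ β := by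
      intro a b
      simp only [Matrix.mul_apply, conn, Matrix.sum_apply, Matrix.smul_apply, smul_eq_mul,
        Finset.sum_mul]
      rw [Finset.sum_comm]
      exact Finset.sum_congr rfl fun _ _ => Finset.sum_congr rfl fun _ _ => by ring
    have hy : (conn C N b p * C p) γ a = ∑ α, ∑ β, C p α a * C p β b * N β p γ α := by
      rw [hx, Finset.sum_comm]
      exact Finset.sum_congr rfl fun _ _ => Finset.sum_congr rfl fun _ _ => by ring
    rw [hx, hy, pdM_apply, pdM_apply]
    simp only [mul_sub, Finset.sum_sub_distrib] at ht
    linarith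
  have e : ∀ a b, coordConn B C N a p c b
      = ∑ γ, B p c γ * (pdM a C p γ b + (conn C N a p * C p) γ b) := by
    intro a b
    simp only [coordConn, mul_assoc, ← mul_add]
    rw [Matrix.mul_apply]
    rfl
  rw [e, e]
  exact Finset.sum_congr rfl fun γ _ => by rw [key]

theorem pdM_h (H : IsFrameConnection M g B C h N) {p : Pt} (hp : p ∈ M) (a : Fin 4) :
    pdM a h p = (conn C N a p)ᵀ * h p + h p * conn C N a p := by
  rw [← H.sum_coframe_frameDM hp]
  simp only [H.compatible p hp, conn, Matrix.transpose_sum, Finset.sum_mul, Finset.mul_sum,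
    ← Finset.sum_add_distrib]
  exact Finset.sum_congr rfl fun α _ => by
    simp [Matrix.transpose_smul, smul_add]

/-- Uniqueness of the Levi-Civita connection: the gauge transform `coordConn` is symmetric by
vanishing torsion, and it preserves g because the frame connection preserves h. -/
theorem christoffel_eq (H : IsFrameConnection M g B C h N) (hM : IsOpen M) {p : Pt} (hp : p ∈ M)
    (i j k : Fin 4) : christoffel g i j k p = coordConn B C N j p i k := by
  refine christoffel_eq_of_compatible (fun a => coordConn B C N a p) (H.metric_inv_mul hp)
    (H.metric_symm hp) (fun a c b => H.coordConn_symm hp a c b) (fun a => ?_) i j k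
  have e := H.pdM_sub_coordConn hM hp H.smooth_h H.metric_eq a
  rw [H.pdM_h hp a] at e
  rw [show (conn C N a p)ᵀ * h p + h p * conn C N a p - (conn C N a p)ᵀ * h p
    - h p * conn C N a p = 0 by abel, mul_zero, zero_mul, sub_sub, sub_eq_zero] at e
  exact e

/-- The covariant derivative of a bilinear form in terms of its frame components. -/
theorem covDeriv_eq (H : IsFrameConnection M g B C h N) (hM : IsOpen M) {p : Pt} (hp : p ∈ M)
    {T t : Field2} (ht : SmoothField2 M t) (hT : ∀ q ∈ M, T q = (C q)ᵀ * t q * C q)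
    (c a b : Fin 4) : covDeriv g T c a b p = ∑ γ, C p γ c *
      ((C p)ᵀ * (frameDM B γ t p - (N γ p)ᵀ * t p - t p * N γ p) * C p) a b := by
  have e : covDeriv g T c a b p =
      (pdM c T p - (coordConn B C N c p)ᵀ * T p - T p * coordConn B C N c p) a b := by
    simp only [covDeriv, H.christoffel_eq hM hp, Matrix.sub_apply, pdM_apply, Matrix.mul_apply,
      Matrix.transpose_apply, Finset.sum_add_distrib]
    rw [sub_sub]
    congr 2
    exact Finset.sum_congr rfl fun d _ => mul_comm _ _
  rw [e, H.pdM_sub_coordConn hM hp ht hT, ← H.sum_coframe_frameDM hp]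
  have : ∑ α, C p α c • frameDM B α t p - (conn C N c p)ᵀ * t p - t p * conn C N c p
      = ∑ γ, C p γ c • (frameDM B γ t p - (N γ p)ᵀ * t p - t p * N γ p) := by
    simp only [conn, Matrix.transpose_sum, Finset.sum_mul, Finset.mul_sum,
      ← Finset.sum_sub_distrib, smul_sub, Matrix.transpose_smul, Matrix.smul_mul, Matrix.mul_smul]
  rw [this, Finset.mul_sum, Finset.sum_mul, Matrix.sum_apply]
  simp only [Matrix.mul_smul, Matrix.smul_mul, Matrix.smul_apply, smul_eq_mul]

/-- The curvature matrices of the coordinate connection. -/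
theorem curvature_eq (H : IsFrameConnection M g B C h N) (hM : IsOpen M) {p : Pt} (hp : p ∈ M)
    (i k : Fin 4) :
    pdM i (coordConn B C N k) p - pdM k (coordConn B C N i) p
      + coordConn B C N i p * coordConn B C N k p - coordConn B C N k p * coordConn B C N i p =
    B p * (pdM i (conn C N k) p - pdM k (conn C N i) p + conn C N i p * conn C N k p
      - conn C N k p * conn C N i p) * C p := by
  have hCB := H.coframe_mul_frame p hp
  have hder : ∀ i k, pdM i (coordConn B C N k) p = pdM i B p * pdM k C p
      + B p * pdM i (pdM k C) p + pdM i B p * conn C N k p * C p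
      + B p * pdM i (conn C N k) p * C p + B p * conn C N k p * pdM i C p := by
    intro i k
    unfold coordConn
    rw [pdM_add hM hp (H.smooth_B.mul (H.smooth_C.pdM hM k))
        ((H.smooth_B.mul (H.smooth_conn k)).mul H.smooth_C),
      pdM_mul hM hp H.smooth_B (H.smooth_C.pdM hM k),
      pdM_mul hM hp (H.smooth_B.mul (H.smooth_conn k)) H.smooth_C,
      pdM_mul hM hp H.smooth_B (H.smooth_conn k)]
    noncomm_ring
  -- Differentiating C B = 1 trades derivatives of the coframe for derivatives of the frame. This
  -- cancels the inhomogeneous terms of the gauge transformation.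
  have hBC : ∀ i, pdM i C p * B p = -(C p * pdM i B p) := by
    intro i
    have e := pdM_mul hM hp H.smooth_C H.smooth_B i
    rw [pdM_congr hM hp H.coframe_mul_frame i] at e
    have e0 : pdM i (fun _ => (1 : Matrix (Fin 4) (Fin 4) ℝ)) p = 0 := by
      ext a b
      exact pd_const i _
    rw [e0] at e
    exact eq_neg_of_add_eq_zero_left e.symm
  have hBCB : ∀ i, B p * (pdM i C p * B p) = -pdM i B p := by
    intro i
    rw [hBC, mul_neg, ← mul_assoc, H.frame_mul_coframe hp, one_mul]
  have hprod : ∀ i k, coordConn B C N i p * coordConn B C N k p =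
      -(pdM i B p * pdM k C p) - pdM i B p * conn C N k p * C p
        + B p * conn C N i p * pdM k C p + B p * conn C N i p * conn C N k p * C p := by
    intro i k
    unfold coordConn
    calc _ = B p * (pdM i C p * B p) * pdM k C p
          + B p * (pdM i C p * B p) * conn C N k p * C p
          + B p * conn C N i p * (C p * B p) * pdM k C p
          + B p * conn C N i p * (C p * B p) * conn C N k p * C p := by noncomm_ring
      _ = _ := by rw [hBCB, hCB]; noncomm_ring
  -- The second derivatives of C cancel by symmetry of mixed partials, so curvature transforms by
  -- pure conjugation.
  rw [hder, hder, hprod, hprod, pdM_comm hM hp H.smooth_C i k]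
  noncomm_ring

/-- The derivative hits either the coframe coefficients or the matrices `N`. The former produce dC,
which vanishing torsion converts into the bracket term of `frameCurv`. -/
theorem conn_curvature_eq (H : IsFrameConnection M g B C h N) (hM : IsOpen M) {p : Pt}
    (hp : p ∈ M) (i k : Fin 4) :
    pdM i (conn C N k) p - pdM k (conn C N i) p + conn C N i p * conn C N k p
      - conn C N k p * conn C N i p = ∑ α, ∑ β, (C p α i * C p β k) • frameCurv B N α β p := by
  have hder : ∀ i k, pdM i (conn C N k) p = (∑ γ, pd i (fun q => C q γ k) p • N γ p)
      + ∑ α, ∑ β, (C p α i * C p β k) • frameDM B α (N β) p := by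
    intro i k
    have h1 : pdM i (conn C N k) p
        = (∑ γ, pd i (fun q => C q γ k) p • N γ p) + ∑ γ, C p γ k • pdM i (N γ) p := by
      ext a b
      have : (fun p => conn C N k p a b) = fun p => ∑ α, C p α k * N α p a b := by
        ext p
        simp [conn, Matrix.sum_apply]
      rw [pdM_apply, this, pd_sum hM hp _ fun α => (H.smooth_C α k).mul (H.smooth_N α a b),
        ← Finset.sum_add_distrib, Matrix.sum_apply]
      exact Finset.sum_congr rfl fun α _ => pd_mul hM hp (H.smooth_C α k) (H.smooth_N α a b) i
    rw [h1, Finset.sum_comm]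
    congr 1
    refine Finset.sum_congr rfl fun β _ => ?_
    rw [← H.sum_coframe_frameDM hp, Finset.smul_sum]
    exact Finset.sum_congr rfl fun α _ => by rw [smul_smul, mul_comm]
  have hsw : ∑ α, ∑ β, (C p α k * C p β i) • frameDM B α (N β) p
      = ∑ α, ∑ β, (C p α i * C p β k) • frameDM B β (N α) p := by
    rw [Finset.sum_comm]
    exact Finset.sum_congr rfl fun _ _ => Finset.sum_congr rfl fun _ _ => by rw [mul_comm]
  have hprod : ∀ i k, conn C N i p * conn C N k p
      = ∑ α, ∑ β, (C p α i * C p β k) • (N α p * N β p) := by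
    intro i k
    simp only [conn, Finset.sum_mul, Finset.mul_sum, Matrix.smul_mul, Matrix.mul_smul, smul_smul]
    rw [Finset.sum_comm]
    exact Finset.sum_congr rfl fun _ _ => Finset.sum_congr rfl fun _ _ => by rw [mul_comm]
  have hprod2 : conn C N k p * conn C N i p
      = ∑ α, ∑ β, (C p α i * C p β k) • (N β p * N α p) := by
    rw [hprod, Finset.sum_comm]
    exact Finset.sum_congr rfl fun _ _ => Finset.sum_congr rfl fun _ _ => by rw [mul_comm]
  have htor : ∑ γ, pd i (fun q => C q γ k) p • N γ p - ∑ γ, pd k (fun q => C q γ i) p • N γ p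
      = -∑ α, ∑ β, (C p α i * C p β k) • ∑ γ, (N α p γ β - N β p γ α) • N γ p := by
    rw [← Finset.sum_sub_distrib]
    simp only [← sub_smul, H.torsion_free p hp, neg_smul, Finset.sum_neg_distrib, Finset.sum_smul,
      Finset.smul_sum, smul_smul]
    congr 1
    rw [Finset.sum_comm]
    refine Finset.sum_congr rfl fun α _ => ?_
    rw [Finset.sum_comm]
  rw [hder, hder, hsw, hprod i k, hprod2]
  simp only [frameCurv, smul_sub, smul_add, Finset.sum_sub_distrib, Finset.sum_add_distrib]
  rw [← neg_eq_iff_eq_neg] at htor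
  rw [← htor]
  abel

/-- The Ricci tensor in terms of its frame components. -/
theorem ricci_eq (H : IsFrameConnection M g B C h N) (hM : IsOpen M) {p : Pt} (hp : p ∈ M) :
    ricci g p = (C p)ᵀ * frameRicci B N p * C p := by
  have hCB := H.coframe_mul_frame p hp
  ext j k
  have h1 : ricci g p j k = ∑ i, (pdM i (coordConn B C N k) p - pdM k (coordConn B C N i) p
      + coordConn B C N i p * coordConn B C N k p
      - coordConn B C N k p * coordConn B C N i p) i j := by
    simp only [ricci]
    refine Finset.sum_congr rfl fun i _ => ?_
    rw [pd_congr hM hp (fun q hq => H.christoffel_eq hM hq i j k),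
      pd_congr hM hp (fun q hq => H.christoffel_eq hM hq i i j)]
    simp only [H.christoffel_eq hM hp, Matrix.sub_apply, Matrix.add_apply, pdM_apply,
      Matrix.mul_apply, Finset.sum_sub_distrib]
    have e1 : (fun q => coordConn B C N j q i k) =ᶠ[nhds p] fun q => coordConn B C N k q i j :=
      Filter.eventuallyEq_of_mem (hM.mem_nhds hp) fun q hq => H.coordConn_symm hq j i k
    have e2 : pd i (fun q => coordConn B C N j q i k) p
        = pd i (fun q => coordConn B C N k q i j) p := by
      simp only [pd, e1.fderiv_eq]
    rw [e2]
    simp only [H.coordConn_symm hp j _ k]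
    ring
  rw [h1]
  simp only [H.curvature_eq hM hp, H.conn_curvature_eq hM hp]
  have h2 : ∀ i, (B p * (∑ α, ∑ β, (C p α i * C p β k) • frameCurv B N α β p) * C p) i j
      = ∑ α, ∑ δ, B p i δ * C p α i * ∑ β, C p β k * (frameCurv B N α β p * C p) δ j := by
    intro i
    rw [mul_assoc, Matrix.mul_apply]
    conv_rhs => rw [Finset.sum_comm]
    refine Finset.sum_congr rfl fun δ _ => ?_
    simp only [Finset.sum_mul, Matrix.sum_apply, Matrix.smul_mul, Matrix.smul_apply, smul_eq_mul,
      Finset.mul_sum]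
    exact Finset.sum_congr rfl fun _ _ => Finset.sum_congr rfl fun _ _ => by ring
  -- Summing over the coordinate index i contracts frame with coframe; this turns the coordinate
  -- trace into the frame trace that defines `frameRicci`.
  have h3 : ∀ α δ, ∑ i, B p i δ * C p α i = if α = δ then 1 else 0 := by
    intro α δ
    have e := congrFun (congrFun hCB α) δ
    rw [Matrix.mul_apply, Matrix.one_apply] at e
    rw [← e]
    exact Finset.sum_congr rfl fun _ _ => mul_comm _ _
  simp only [h2]
  rw [Finset.sum_comm]
  have h4 : ∀ α, ∑ i, ∑ δ, B p i δ * C p α i * ∑ β, C p β k * (frameCurv B N α β p * C p) δ j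
      = ∑ β, C p β k * (frameCurv B N α β p * C p) α j := by
    intro α
    rw [Finset.sum_comm]
    simp only [← Finset.sum_mul, h3]
    simp
  simp only [h4]
  simp only [Matrix.mul_apply, frameRicci, Matrix.transpose_apply, Matrix.of_apply]
  simp only [Finset.mul_sum, Finset.sum_mul]
  rw [Finset.sum_comm]
  refine Finset.sum_congr rfl fun β _ => ?_
  rw [Finset.sum_comm]
  exact Finset.sum_congr rfl fun _ _ => Finset.sum_congr rfl fun _ _ => by ring

end IsFrameConnection

/-! ### Basic functions: smooth functions of the last two coordinates -/

/-- `f` is smooth on `M` and does not depend on the first two coordinates. -/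
structure IsBasic (M : Set Pt) (f : Pt → ℝ) : Prop where
  smooth : ContDiffOn ℝ ∞ f M
  pd_zero : ∀ p ∈ M, pd 0 f p = 0
  pd_one : ∀ p ∈ M, pd 1 f p = 0

namespace IsBasic

variable {M : Set Pt} {f g : Pt → ℝ} {p : Pt}

theorem const (r : ℝ) : IsBasic M fun _ => r :=
  ⟨contDiffOn_const, fun _ _ => pd_const _ _, fun _ _ => pd_const _ _⟩

theorem add (hM : IsOpen M) (hf : IsBasic M f) (hg : IsBasic M g) :
    IsBasic M fun q => f q + g q where
  smooth := hf.smooth.add hg.smooth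
  pd_zero p hp := by rw [pd_add hM hp hf.smooth hg.smooth, hf.pd_zero p hp, hg.pd_zero p hp, add_zero]
  pd_one p hp := by rw [pd_add hM hp hf.smooth hg.smooth, hf.pd_one p hp, hg.pd_one p hp, add_zero]

theorem neg (hf : IsBasic M f) : IsBasic M fun q => -f q where
  smooth := hf.smooth.neg
  pd_zero p hp := by rw [pd_neg, hf.pd_zero p hp, neg_zero]
  pd_one p hp := by rw [pd_neg, hf.pd_one p hp, neg_zero]

theorem sub (hM : IsOpen M) (hf : IsBasic M f) (hg : IsBasic M g) :
    IsBasic M fun q => f q - g q := by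
  simpa only [sub_eq_add_neg] using hf.add hM hg.neg

theorem mul (hM : IsOpen M) (hf : IsBasic M f) (hg : IsBasic M g) :
    IsBasic M fun q => f q * g q where
  smooth := hf.smooth.mul hg.smooth
  pd_zero p hp := by
    rw [pd_mul hM hp hf.smooth hg.smooth, hf.pd_zero p hp, hg.pd_zero p hp, zero_mul, mul_zero,
      add_zero]
  pd_one p hp := by
    rw [pd_mul hM hp hf.smooth hg.smooth, hf.pd_one p hp, hg.pd_one p hp, zero_mul, mul_zero,
      add_zero]

theorem pow (hM : IsOpen M) (hf : IsBasic M f) (n : ℕ) : IsBasic M fun q => f q ^ n := by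
  induction n with
  | zero => simpa using const 1
  | succ n ih => simpa only [pow_succ] using ih.mul hM hf

theorem congr (hM : IsOpen M) (hf : IsBasic M f) (h : ∀ q ∈ M, g q = f q) : IsBasic M g where
  smooth := hf.smooth.congr h
  pd_zero p hp := by rw [pd_congr hM hp h, hf.pd_zero p hp]
  pd_one p hp := by rw [pd_congr hM hp h, hf.pd_one p hp]

/-- Composition with a function that is smooth at the values that are taken. -/
theorem comp (hM : IsOpen M) (hf : IsBasic M f) {φ : ℝ → ℝ} (hφ : ∀ q ∈ M, ContDiffAt ℝ ∞ φ (f q)) :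
    IsBasic M (fun q => φ (f q)) ∧
      ∀ p ∈ M, ∀ i, pd i (fun q => φ (f q)) p = deriv φ (f p) * pd i f p := by
  have hpd : ∀ p ∈ M, ∀ i, pd i (fun q => φ (f q)) p = deriv φ (f p) * pd i f p := by
    intro p hp i
    have h1 : HasDerivAt φ (deriv φ (f p)) (f p) :=
      ((hφ p hp).differentiableAt (by simp)).hasDerivAt
    have h2 := h1.comp_hasFDerivAt p (differentiableAt_of_mem hM hp hf.smooth).hasFDerivAt
    have h3 : fderiv ℝ (fun q => φ (f q)) p = deriv φ (f p) • fderiv ℝ f p := h2.fderiv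
    simp only [pd, h3]
    rfl
  refine ⟨⟨fun p hp => ?_, fun p hp => ?_, fun p hp => ?_⟩, hpd⟩
  · exact ((hφ p hp).comp p (hf.smooth.contDiffAt (hM.mem_nhds hp))).contDiffWithinAt
  · rw [hpd p hp, hf.pd_zero p hp, mul_zero]
  · rw [hpd p hp, hf.pd_one p hp, mul_zero]

theorem exp (hM : IsOpen M) (hf : IsBasic M f) : IsBasic M fun q => Real.exp (f q) :=
  (hf.comp hM fun _ _ => Real.contDiff_exp.contDiffAt).1

theorem inv (hM : IsOpen M) (hf : IsBasic M f) (h : ∀ q ∈ M, f q ≠ 0) :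
    IsBasic M fun q => (f q)⁻¹ :=
  (hf.comp hM (φ := fun x => x⁻¹) fun q hq => contDiffAt_inv ℝ (h q hq)).1

theorem log (hM : IsOpen M) (hf : IsBasic M f) (h : ∀ q ∈ M, f q ≠ 0) :
    IsBasic M fun q => Real.log (f q) :=
  (hf.comp hM (φ := Real.log) fun q hq => Real.contDiffAt_log.2 (h q hq)).1

theorem pd_exp (hM : IsOpen M) (hf : IsBasic M f) (hp : p ∈ M) (i : Fin 4) :
    pd i (fun q => Real.exp (f q)) p = Real.exp (f p) * pd i f p := by
  rw [(hf.comp hM fun _ _ => Real.contDiff_exp.contDiffAt).2 p hp, Real.deriv_exp]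

theorem pd_inv (hM : IsOpen M) (hf : IsBasic M f) (h : ∀ q ∈ M, f q ≠ 0) (hp : p ∈ M)
    (i : Fin 4) : pd i (fun q => (f q)⁻¹) p = -((f p)⁻¹ ^ 2 * pd i f p) := by
  rw [(hf.comp hM (φ := fun x => x⁻¹) fun q hq => contDiffAt_inv ℝ (h q hq)).2 p hp]
  simp

theorem pd_log (hM : IsOpen M) (hf : IsBasic M f) (h : ∀ q ∈ M, f q ≠ 0) (hp : p ∈ M)
    (i : Fin 4) : pd i (fun q => Real.log (f q)) p = (f p)⁻¹ * pd i f p := by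
  rw [(hf.comp hM (φ := Real.log) fun q hq => Real.contDiffAt_log.2 (h q hq)).2 p hp]
  simp

protected theorem pd (hM : IsOpen M) (hf : IsBasic M f) (i : Fin 4) : IsBasic M (pd i f) where
  smooth := hf.smooth.pd hM i
  pd_zero p hp := by
    rw [pd_comm hM hp hf.smooth, pd_congr hM hp hf.pd_zero, pd_const]
  pd_one p hp := by
    rw [pd_comm hM hp hf.smooth, pd_congr hM hp hf.pd_one, pd_const]

end IsBasic

/-! ### Derivatives of basic functions along a frame -/

section FrameD

variable {M : Set Pt} {f g : Pt → ℝ} {p : Pt} {B : Field2} {α : Fin 4}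

theorem frameD_congr (hM : IsOpen M) (hp : p ∈ M) (h : ∀ q ∈ M, f q = g q) :
    frameD B α f p = frameD B α g p := by
  simp only [frameD, pd_congr hM hp h]

theorem frameD_const (r : ℝ) : frameD B α (fun _ => r) p = 0 := by
  simp [frameD]

theorem frameD_add (hM : IsOpen M) (hp : p ∈ M) (hf : IsBasic M f) (hg : IsBasic M g) :
    frameD B α (fun q => f q + g q) p = frameD B α f p + frameD B α g p := by
  simp only [frameD, pd_add hM hp hf.smooth hg.smooth, mul_add, Finset.sum_add_distrib]

theorem frameD_neg : frameD B α (fun q => -f q) p = -frameD B α f p := by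
  simp only [frameD, pd_neg, mul_neg, Finset.sum_neg_distrib]

theorem frameD_sub (hM : IsOpen M) (hp : p ∈ M) (hf : IsBasic M f) (hg : IsBasic M g) :
    frameD B α (fun q => f q - g q) p = frameD B α f p - frameD B α g p := by
  simp only [frameD, pd_sub hM hp hf.smooth hg.smooth, mul_sub, Finset.sum_sub_distrib]

theorem frameD_mul (hM : IsOpen M) (hp : p ∈ M) (hf : IsBasic M f) (hg : IsBasic M g) :
    frameD B α (fun q => f q * g q) p = frameD B α f p * g p + f p * frameD B α g p := by
  simp only [frameD, pd_mul hM hp hf.smooth hg.smooth, Finset.sum_mul, Finset.mul_sum,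
    ← Finset.sum_add_distrib]
  exact Finset.sum_congr rfl fun _ _ => by ring

theorem frameD_sq (hM : IsOpen M) (hp : p ∈ M) (hf : IsBasic M f) :
    frameD B α (fun q => f q ^ 2) p = 2 * f p * frameD B α f p := by
  simp only [sq, frameD_mul hM hp hf hf]
  ring

theorem frameD_exp (hM : IsOpen M) (hp : p ∈ M) (hf : IsBasic M f) :
    frameD B α (fun q => Real.exp (f q)) p = Real.exp (f p) * frameD B α f p := by
  simp only [frameD, hf.pd_exp hM hp, Finset.mul_sum]
  exact Finset.sum_congr rfl fun _ _ => by ring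

theorem frameD_inv (hM : IsOpen M) (hp : p ∈ M) (hf : IsBasic M f) (h : ∀ q ∈ M, f q ≠ 0) :
    frameD B α (fun q => (f q)⁻¹) p = -((f p)⁻¹ ^ 2 * frameD B α f p) := by
  simp only [frameD, hf.pd_inv hM h hp, Finset.mul_sum, ← Finset.sum_neg_distrib]
  exact Finset.sum_congr rfl fun _ _ => by ring

end FrameD

/-! ### Metrics in LeBrun form -/

/-- Data for a metric `W⁻¹ (dψ + A dy)² + W (eᵘ (dx² + dy²) + dz²)` with `W = eᵛ` and two ignorable
coordinates: `dψ = t dτ`, `dy = r dφ`, `dx = ξ₂ dx₁ + ξ₃ dx₂`, `dz = ζ₂ dx₁ + ζ₃ dx₂`. -/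
structure LeBrunData where
  t : ℝ
  r : ℝ
  ξ₂ : Pt → ℝ
  ξ₃ : Pt → ℝ
  ζ₂ : Pt → ℝ
  ζ₃ : Pt → ℝ
  A : Pt → ℝ
  v : Pt → ℝ
  u : Pt → ℝ
  z : Pt → ℝ

namespace LeBrunData

variable (L : LeBrunData)

/-- The function `W = eᵛ`. -/
def W (p : Pt) : ℝ := Real.exp (L.v p)

/-- The function `eᵘ`. -/
def U (p : Pt) : ℝ := Real.exp (L.u p)

/-- The Jacobian of `(x, z)`. -/
def jac (p : Pt) : ℝ := L.ξ₂ p * L.ζ₃ p - L.ξ₃ p * L.ζ₂ p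

/-- The coframe `dψ + A dy, dy, dx, dz`. -/
def coframe : Field2 := fun p =>
  !![L.t, L.r * L.A p, 0, 0; 0, L.r, 0, 0; 0, 0, L.ξ₂ p, L.ξ₃ p; 0, 0, L.ζ₂ p, L.ζ₃ p]

/-- The frame dual to `coframe`. -/
def frame : Field2 := fun p =>
  !![L.t⁻¹, -(L.t⁻¹ * L.A p), 0, 0; 0, L.r⁻¹, 0, 0;
    0, 0, (L.jac p)⁻¹ * L.ζ₃ p, -((L.jac p)⁻¹ * L.ξ₃ p);
    0, 0, -((L.jac p)⁻¹ * L.ζ₂ p), (L.jac p)⁻¹ * L.ξ₂ p]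

/-- The derivative `∂ₓ`. -/
notation "𝒟ₓ[" L "]" => frameD (LeBrunData.frame L) 2

/-- The derivative `∂_z`. -/
notation "𝒟z[" L "]" => frameD (LeBrunData.frame L) 3

/-- The components of the metric in the frame. -/
def frameMetric : Field2 := fun p =>
  !![(L.W p)⁻¹, 0, 0, 0; 0, L.W p * L.U p, 0, 0; 0, 0, L.W p * L.U p, 0; 0, 0, 0, L.W p]

/-- The metric in LeBrun form. -/
def metric : Field2 := fun p => (L.coframe p)ᵀ * L.frameMetric p * L.coframe p

/-- The abbreviation `(u_z + v_z) / 2 - 1 / z`. -/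
def m (p : Pt) : ℝ := 1 / 2 * (𝒟z[L] L.u p + 𝒟z[L] L.v p) - (L.z p)⁻¹

/-- The connection matrices of the frame. -/
def conn : Fin 4 → Field2 := ![
  fun p => !![0, 0, -(1 / 2 * 𝒟ₓ[L] L.v p), -(1 / 2 * 𝒟z[L] L.v p);
    0, 0, -((L.W p)⁻¹ * L.m p), 1 / 2 * ((L.U p)⁻¹ * (L.W p)⁻¹) * 𝒟ₓ[L] L.v p;
    1 / 2 * ((L.U p)⁻¹ * (L.W p)⁻¹ ^ 2) * 𝒟ₓ[L] L.v p, (L.W p)⁻¹ * L.m p, 0, 0;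
    1 / 2 * (L.W p)⁻¹ ^ 2 * 𝒟z[L] L.v p, -(1 / 2 * (L.W p)⁻¹ * 𝒟ₓ[L] L.v p), 0, 0],
  fun p => !![0, 0, -(L.U p * L.W p * L.m p), 1 / 2 * L.W p * 𝒟ₓ[L] L.v p;
    0, 0, 1 / 2 * (𝒟ₓ[L] L.u p + 𝒟ₓ[L] L.v p), 1 / 2 * (𝒟z[L] L.u p + 𝒟z[L] L.v p);
    (L.W p)⁻¹ * L.m p, -(1 / 2 * (𝒟ₓ[L] L.u p + 𝒟ₓ[L] L.v p)), 0, 0;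
    -(1 / 2 * (L.W p)⁻¹ * 𝒟ₓ[L] L.v p), -(1 / 2 * L.U p * (𝒟z[L] L.u p + 𝒟z[L] L.v p)), 0, 0],
  fun p => !![-(1 / 2 * 𝒟ₓ[L] L.v p), L.U p * L.W p * L.m p, 0, 0;
    -((L.W p)⁻¹ * L.m p), 1 / 2 * (𝒟ₓ[L] L.u p + 𝒟ₓ[L] L.v p), 0, 0;
    0, 0, 1 / 2 * (𝒟ₓ[L] L.u p + 𝒟ₓ[L] L.v p), 1 / 2 * (𝒟z[L] L.u p + 𝒟z[L] L.v p);
    0, 0, -(1 / 2 * L.U p * (𝒟z[L] L.u p + 𝒟z[L] L.v p)), 1 / 2 * 𝒟ₓ[L] L.v p],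
  fun p => !![-(1 / 2 * 𝒟z[L] L.v p), -(1 / 2 * L.W p * 𝒟ₓ[L] L.v p), 0, 0;
    1 / 2 * ((L.U p)⁻¹ * (L.W p)⁻¹) * 𝒟ₓ[L] L.v p, 1 / 2 * (𝒟z[L] L.u p + 𝒟z[L] L.v p), 0, 0;
    0, 0, 1 / 2 * (𝒟z[L] L.u p + 𝒟z[L] L.v p), -(1 / 2 * (L.U p)⁻¹ * 𝒟ₓ[L] L.v p);
    0, 0, 1 / 2 * 𝒟ₓ[L] L.v p, 1 / 2 * 𝒟z[L] L.v p]]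

/-- The rows of the connection matrices. -/
theorem conn_apply (p : Pt) :
    L.conn 0 p 0 = ![0, 0, -(1 / 2 * 𝒟ₓ[L] L.v p), -(1 / 2 * 𝒟z[L] L.v p)] ∧
    L.conn 0 p 1 = ![0, 0, -((L.W p)⁻¹ * L.m p), 1 / 2 * ((L.U p)⁻¹ * (L.W p)⁻¹) * 𝒟ₓ[L] L.v p] ∧
    L.conn 0 p 2 = ![1 / 2 * ((L.U p)⁻¹ * (L.W p)⁻¹ ^ 2) * 𝒟ₓ[L] L.v p, (L.W p)⁻¹ * L.m p, 0, 0] ∧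
    L.conn 0 p 3 = ![1 / 2 * (L.W p)⁻¹ ^ 2 * 𝒟z[L] L.v p, -(1 / 2 * (L.W p)⁻¹ * 𝒟ₓ[L] L.v p), 0, 0] ∧
    L.conn 1 p 0 = ![0, 0, -(L.U p * L.W p * L.m p), 1 / 2 * L.W p * 𝒟ₓ[L] L.v p] ∧
    L.conn 1 p 1 = ![0, 0, 1 / 2 * (𝒟ₓ[L] L.u p + 𝒟ₓ[L] L.v p), 1 / 2 * (𝒟z[L] L.u p + 𝒟z[L] L.v p)] ∧
    L.conn 1 p 2 = ![(L.W p)⁻¹ * L.m p, -(1 / 2 * (𝒟ₓ[L] L.u p + 𝒟ₓ[L] L.v p)), 0, 0] ∧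
    L.conn 1 p 3 = ![-(1 / 2 * (L.W p)⁻¹ * 𝒟ₓ[L] L.v p), -(1 / 2 * L.U p * (𝒟z[L] L.u p + 𝒟z[L] L.v p)), 0, 0] ∧
    L.conn 2 p 0 = ![-(1 / 2 * 𝒟ₓ[L] L.v p), L.U p * L.W p * L.m p, 0, 0] ∧
    L.conn 2 p 1 = ![-((L.W p)⁻¹ * L.m p), 1 / 2 * (𝒟ₓ[L] L.u p + 𝒟ₓ[L] L.v p), 0, 0] ∧
    L.conn 2 p 2 = ![0, 0, 1 / 2 * (𝒟ₓ[L] L.u p + 𝒟ₓ[L] L.v p), 1 / 2 * (𝒟z[L] L.u p + 𝒟z[L] L.v p)] ∧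
    L.conn 2 p 3 = ![0, 0, -(1 / 2 * L.U p * (𝒟z[L] L.u p + 𝒟z[L] L.v p)), 1 / 2 * 𝒟ₓ[L] L.v p] ∧
    L.conn 3 p 0 = ![-(1 / 2 * 𝒟z[L] L.v p), -(1 / 2 * L.W p * 𝒟ₓ[L] L.v p), 0, 0] ∧
    L.conn 3 p 1 = ![1 / 2 * ((L.U p)⁻¹ * (L.W p)⁻¹) * 𝒟ₓ[L] L.v p, 1 / 2 * (𝒟z[L] L.u p + 𝒟z[L] L.v p), 0, 0] ∧
    L.conn 3 p 2 = ![0, 0, 1 / 2 * (𝒟z[L] L.u p + 𝒟z[L] L.v p), -(1 / 2 * (L.U p)⁻¹ * 𝒟ₓ[L] L.v p)] ∧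
    L.conn 3 p 3 = ![0, 0, 1 / 2 * 𝒟ₓ[L] L.v p, 1 / 2 * 𝒟z[L] L.v p] :=
  ⟨rfl, rfl, rfl, rfl, rfl, rfl, rfl, rfl, rfl, rfl, rfl, rfl, rfl, rfl, rfl, rfl⟩

/-- The data are smooth and basic, and `dx`, `dz` is a closed coframe with `dz` the differential of
the nowhere vanishing function `z`. -/
structure IsRegular (L : LeBrunData) (M : Set Pt) : Prop where
  t_ne_zero : L.t ≠ 0
  r_ne_zero : L.r ≠ 0
  basic_ξ₂ : IsBasic M L.ξ₂
  basic_ξ₃ : IsBasic M L.ξ₃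
  basic_ζ₂ : IsBasic M L.ζ₂
  basic_ζ₃ : IsBasic M L.ζ₃
  basic_A : IsBasic M L.A
  basic_v : IsBasic M L.v
  basic_u : IsBasic M L.u
  basic_z : IsBasic M L.z
  jac_ne_zero : ∀ p ∈ M, L.jac p ≠ 0
  z_ne_zero : ∀ p ∈ M, L.z p ≠ 0
  closed_dx : ∀ p ∈ M, pd 2 L.ξ₃ p = pd 3 L.ξ₂ p
  pd_two_z : ∀ p ∈ M, pd 2 L.z p = L.ζ₂ p
  pd_three_z : ∀ p ∈ M, pd 3 L.z p = L.ζ₃ p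

/-- The functions `W` and `A` satisfy the equations that make the metric conformally Kähler with
conformal factor `z⁻¹`. -/
structure IsConformallyKahler (L : LeBrunData) (M : Set Pt) : Prop extends L.IsRegular M where
  dZ_A : ∀ p ∈ M, 𝒟z[L] L.A p = L.W p * 𝒟ₓ[L] L.v p
  dX_A : ∀ p ∈ M, 𝒟ₓ[L] L.A p = -(2 * L.U p * L.W p * L.m p)

variable {L}

theorem W_pos (p : Pt) : 0 < L.W p := Real.exp_pos _

theorem U_pos (p : Pt) : 0 < L.U p := Real.exp_pos _

theorem dX_eq (f : Pt → ℝ) (p : Pt) :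
    𝒟ₓ[L] f p = (L.jac p)⁻¹ * (L.ζ₃ p * pd 2 f p - L.ζ₂ p * pd 3 f p) := by
  simp [frameD, frame, Fin.sum_univ_four]
  ring

theorem dZ_eq (f : Pt → ℝ) (p : Pt) :
    𝒟z[L] f p = (L.jac p)⁻¹ * (L.ξ₂ p * pd 3 f p - L.ξ₃ p * pd 2 f p) := by
  simp [frameD, frame, Fin.sum_univ_four]
  ring

variable {M : Set Pt} {f g : Pt → ℝ} {p : Pt}

theorem frameD_zero (hf : IsBasic M f) (hp : p ∈ M) : frameD L.frame 0 f p = 0 := by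
  simp [frameD, frame, Fin.sum_univ_four, hf.pd_zero p hp]

theorem frameD_one (hf : IsBasic M f) (hp : p ∈ M) : frameD L.frame 1 f p = 0 := by
  simp [frameD, frame, Fin.sum_univ_four, hf.pd_zero p hp, hf.pd_one p hp]

namespace IsRegular

theorem basic_jac (H : L.IsRegular M) (hM : IsOpen M) : IsBasic M L.jac :=
  (H.basic_ξ₂.mul hM H.basic_ζ₃).sub hM (H.basic_ξ₃.mul hM H.basic_ζ₂)

theorem basic_dX (H : L.IsRegular M) (hM : IsOpen M) (hf : IsBasic M f) :
    IsBasic M (𝒟ₓ[L] f) :=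
  (((H.basic_jac hM).inv hM H.jac_ne_zero).mul hM
    ((H.basic_ζ₃.mul hM (hf.pd hM 2)).sub hM (H.basic_ζ₂.mul hM (hf.pd hM 3)))).congr hM
    fun q _ => dX_eq f q

theorem basic_dZ (H : L.IsRegular M) (hM : IsOpen M) (hf : IsBasic M f) :
    IsBasic M (𝒟z[L] f) :=
  (((H.basic_jac hM).inv hM H.jac_ne_zero).mul hM
    ((H.basic_ξ₂.mul hM (hf.pd hM 3)).sub hM (H.basic_ξ₃.mul hM (hf.pd hM 2)))).congr hM
    fun q _ => dZ_eq f q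

theorem pd_two (H : L.IsRegular M) (hp : p ∈ M) (f : Pt → ℝ) :
    pd 2 f p = L.ξ₂ p * 𝒟ₓ[L] f p + L.ζ₂ p * 𝒟z[L] f p := by
  have := H.jac_ne_zero p hp
  rw [dX_eq, dZ_eq]
  field_simp
  rw [jac]
  ring

theorem pd_three (H : L.IsRegular M) (hp : p ∈ M) (f : Pt → ℝ) :
    pd 3 f p = L.ξ₃ p * 𝒟ₓ[L] f p + L.ζ₃ p * 𝒟z[L] f p := by
  have := H.jac_ne_zero p hp
  rw [dX_eq, dZ_eq]
  field_simp
  rw [jac]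
  ring

theorem closed_dz (H : L.IsRegular M) (hM : IsOpen M) (hp : p ∈ M) :
    pd 2 L.ζ₃ p = pd 3 L.ζ₂ p := by
  rw [← pd_congr hM hp H.pd_three_z, ← pd_congr hM hp H.pd_two_z]
  exact pd_comm hM hp H.basic_z.smooth 2 3

/-- The vector fields `∂ₓ` and `∂_z` commute. -/
theorem dZ_dX (H : L.IsRegular M) (hM : IsOpen M) (hf : IsBasic M f) (hp : p ∈ M) :
    𝒟z[L] (𝒟ₓ[L] f) p = 𝒟ₓ[L] (𝒟z[L] f) p := by
  have h := pd_comm hM hp hf.smooth 3 2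
  rw [pd_congr hM hp (fun q hq => H.pd_two hq f), pd_congr hM hp (fun q hq => H.pd_three hq f),
    pd_add hM hp (H.basic_ξ₂.mul hM (H.basic_dX hM hf)).smooth
      (H.basic_ζ₂.mul hM (H.basic_dZ hM hf)).smooth,
    pd_add hM hp (H.basic_ξ₃.mul hM (H.basic_dX hM hf)).smooth
      (H.basic_ζ₃.mul hM (H.basic_dZ hM hf)).smooth,
    pd_mul hM hp H.basic_ξ₂.smooth (H.basic_dX hM hf).smooth,
    pd_mul hM hp H.basic_ζ₂.smooth (H.basic_dZ hM hf).smooth,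
    pd_mul hM hp H.basic_ξ₃.smooth (H.basic_dX hM hf).smooth,
    pd_mul hM hp H.basic_ζ₃.smooth (H.basic_dZ hM hf).smooth,
    H.closed_dz hM hp, H.closed_dx p hp, H.pd_two hp (𝒟ₓ[L] f), H.pd_two hp (𝒟z[L] f),
    H.pd_three hp (𝒟ₓ[L] f), H.pd_three hp (𝒟z[L] f)] at h
  have h' : L.jac p * (𝒟z[L] (𝒟ₓ[L] f) p - 𝒟ₓ[L] (𝒟z[L] f) p) = 0 := by
    rw [jac]
    linear_combination h
  exact sub_eq_zero.1 ((mul_eq_zero.1 h').resolve_left (H.jac_ne_zero p hp))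

theorem dX_z (H : L.IsRegular M) (hp : p ∈ M) : 𝒟ₓ[L] L.z p = 0 := by
  rw [dX_eq, H.pd_two_z p hp, H.pd_three_z p hp]
  ring

theorem dZ_z (H : L.IsRegular M) (hp : p ∈ M) : 𝒟z[L] L.z p = 1 := by
  have := H.jac_ne_zero p hp
  rw [dZ_eq, H.pd_two_z p hp, H.pd_three_z p hp, ← jac, inv_mul_cancel₀ this]

theorem basic_W (H : L.IsRegular M) (hM : IsOpen M) : IsBasic M L.W := H.basic_v.exp hM

theorem basic_U (H : L.IsRegular M) (hM : IsOpen M) : IsBasic M L.U := H.basic_u.exp hM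

theorem basic_W_inv (H : L.IsRegular M) (hM : IsOpen M) :
    IsBasic M fun q => (L.W q)⁻¹ := (H.basic_W hM).inv hM fun q _ => (W_pos q).ne'

theorem basic_U_inv (H : L.IsRegular M) (hM : IsOpen M) :
    IsBasic M fun q => (L.U q)⁻¹ := (H.basic_U hM).inv hM fun q _ => (U_pos q).ne'

theorem basic_z_inv (H : L.IsRegular M) (hM : IsOpen M) :
    IsBasic M fun q => (L.z q)⁻¹ := H.basic_z.inv hM H.z_ne_zero

theorem basic_m (H : L.IsRegular M) (hM : IsOpen M) : IsBasic M L.m :=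
  (((IsBasic.const (1 / 2)).mul hM
    ((H.basic_dZ hM H.basic_u).add hM (H.basic_dZ hM H.basic_v)))).sub hM (H.basic_z_inv hM)

theorem frameD_W (H : L.IsRegular M) (hM : IsOpen M) (hp : p ∈ M) (α : Fin 4) :
    frameD L.frame α L.W p = L.W p * frameD L.frame α L.v p := frameD_exp hM hp H.basic_v

theorem frameD_U (H : L.IsRegular M) (hM : IsOpen M) (hp : p ∈ M) (α : Fin 4) :
    frameD L.frame α L.U p = L.U p * frameD L.frame α L.u p := frameD_exp hM hp H.basic_u

theorem frameD_W_inv (H : L.IsRegular M) (hM : IsOpen M) (hp : p ∈ M) (α : Fin 4) :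
    frameD L.frame α (fun q => (L.W q)⁻¹) p = -((L.W p)⁻¹ * frameD L.frame α L.v p) := by
  have := (W_pos (L := L) p).ne'
  rw [frameD_inv hM hp (H.basic_W hM) fun q _ => (W_pos q).ne', H.frameD_W hM hp]
  field_simp

theorem frameD_U_inv (H : L.IsRegular M) (hM : IsOpen M) (hp : p ∈ M) (α : Fin 4) :
    frameD L.frame α (fun q => (L.U q)⁻¹) p = -((L.U p)⁻¹ * frameD L.frame α L.u p) := by
  have := (U_pos (L := L) p).ne'
  rw [frameD_inv hM hp (H.basic_U hM) fun q _ => (U_pos q).ne', H.frameD_U hM hp]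
  field_simp

theorem dX_z_inv (H : L.IsRegular M) (hM : IsOpen M) (hp : p ∈ M) :
    𝒟ₓ[L] (fun q => (L.z q)⁻¹) p = 0 := by
  rw [frameD_inv hM hp H.basic_z H.z_ne_zero, H.dX_z hp]
  ring

theorem dZ_z_inv (H : L.IsRegular M) (hM : IsOpen M) (hp : p ∈ M) :
    𝒟z[L] (fun q => (L.z q)⁻¹) p = -(L.z p)⁻¹ ^ 2 := by
  rw [frameD_inv hM hp H.basic_z H.z_ne_zero, H.dZ_z hp]
  ring

theorem dX_m (H : L.IsRegular M) (hM : IsOpen M) (hp : p ∈ M) :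
    𝒟ₓ[L] L.m p = 1 / 2 * (𝒟ₓ[L] (𝒟z[L] L.u) p + 𝒟ₓ[L] (𝒟z[L] L.v) p) := by
  have hu := H.basic_dZ hM H.basic_u
  have hv := H.basic_dZ hM H.basic_v
  unfold m
  rw [frameD_sub hM hp ((IsBasic.const _).mul hM (hu.add hM hv)) (H.basic_z_inv hM),
    frameD_mul hM hp (IsBasic.const _) (hu.add hM hv), frameD_add hM hp hu hv, H.dX_z_inv hM hp,
    frameD_const]
  ring

theorem dZ_m (H : L.IsRegular M) (hM : IsOpen M) (hp : p ∈ M) :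
    𝒟z[L] L.m p = 1 / 2 * (𝒟z[L] (𝒟z[L] L.u) p + 𝒟z[L] (𝒟z[L] L.v) p) + (L.z p)⁻¹ ^ 2 := by
  have hu := H.basic_dZ hM H.basic_u
  have hv := H.basic_dZ hM H.basic_v
  unfold m
  rw [frameD_sub hM hp ((IsBasic.const _).mul hM (hu.add hM hv)) (H.basic_z_inv hM),
    frameD_mul hM hp (IsBasic.const _) (hu.add hM hv), frameD_add hM hp hu hv, H.dZ_z_inv hM hp,
    frameD_const]
  ring

theorem coframe_mul_frame (H : L.IsRegular M) (hp : p ∈ M) :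
    L.coframe p * L.frame p = 1 := by
  have h1 := H.t_ne_zero
  have h2 := H.r_ne_zero
  have h3 := H.jac_ne_zero p hp
  ext i j
  fin_cases i <;> fin_cases j <;> simp [coframe, frame, Matrix.mul_apply, Fin.sum_univ_four] <;>
    field_simp <;> (try rw [jac]) <;> ring

end IsRegular

namespace IsConformallyKahler

/-- The integrability condition of the equations for `A`. -/
theorem integrability (H : L.IsConformallyKahler M) (hM : IsOpen M) (hp : p ∈ M) :
    𝒟ₓ[L] (𝒟ₓ[L] L.v) p + 𝒟ₓ[L] L.v p ^ 2 + L.U p * (𝒟z[L] (𝒟z[L] L.u) p + 𝒟z[L] (𝒟z[L] L.v) p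
      + 2 * (L.z p)⁻¹ ^ 2 + 2 * (𝒟z[L] L.u p + 𝒟z[L] L.v p) * L.m p) = 0 := by
  have h := H.dZ_dX hM H.basic_A hp
  have hW := H.basic_W hM
  have hU := H.basic_U hM
  have hUW : IsBasic M fun q => 2 * L.U q * L.W q := ((IsBasic.const 2).mul hM hU).mul hM hW
  have hm := H.basic_m hM
  rw [frameD_congr hM hp H.dX_A, frameD_congr hM hp H.dZ_A, frameD_neg,
    frameD_mul hM hp hUW hm, frameD_mul hM hp ((IsBasic.const 2).mul hM hU) hW,
    frameD_mul hM hp (IsBasic.const 2) hU, frameD_const,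
    frameD_mul hM hp hW (H.basic_dX hM H.basic_v), H.frameD_W hM hp, H.frameD_W hM hp,
    H.frameD_U hM hp, H.dZ_m hM hp] at h
  have hW0 := (W_pos (L := L) p).ne'
  apply mul_left_cancel₀ hW0
  linear_combination -h

end IsConformallyKahler

end LeBrunData

/-! ### The Levi-Civita connection of a metric in LeBrun form -/

namespace LeBrunData

variable {L : LeBrunData}

namespace IsRegular

variable {M : Set Pt} {p : Pt}

theorem basic_frame (H : L.IsRegular M) (hM : IsOpen M) (a b : Fin 4) :
    IsBasic M fun q => L.frame q a b := by
  have h0 := (H.basic_jac hM).inv hM H.jac_ne_zero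
  have h1 := H.basic_ξ₂
  have h2 := H.basic_ξ₃
  have h3 := H.basic_ζ₂
  have h4 := H.basic_ζ₃
  have h5 := H.basic_A
  fin_cases a <;> fin_cases b <;> simp [frame] <;>
    repeat' first
      | assumption
      | exact IsBasic.const _
      | apply IsBasic.mul hM
      | apply IsBasic.neg

theorem basic_coframe (H : L.IsRegular M) (hM : IsOpen M) (a b : Fin 4) :
    IsBasic M fun q => L.coframe q a b := by
  have h1 := H.basic_ξ₂
  have h2 := H.basic_ξ₃
  have h3 := H.basic_ζ₂
  have h4 := H.basic_ζ₃
  have h5 := H.basic_A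
  fin_cases a <;> fin_cases b <;> simp [coframe] <;>
    repeat' first
      | assumption
      | exact IsBasic.const _
      | apply IsBasic.mul hM

theorem basic_frameMetric (H : L.IsRegular M) (hM : IsOpen M) (a b : Fin 4) :
    IsBasic M fun q => L.frameMetric q a b := by
  have hW := H.basic_W hM
  have hU := H.basic_U hM
  have hWi := H.basic_W_inv hM
  fin_cases a <;> fin_cases b <;> simp [frameMetric] <;>
    repeat' first
      | assumption
      | exact IsBasic.const _
      | apply IsBasic.mul hM

end IsRegular

theorem frameMetric_inv (p : Pt) : (L.frameMetric p)⁻¹ =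
    !![L.W p, 0, 0, 0; 0, (L.W p)⁻¹ * (L.U p)⁻¹, 0, 0; 0, 0, (L.W p)⁻¹ * (L.U p)⁻¹, 0;
      0, 0, 0, (L.W p)⁻¹] := by
  have hW := (W_pos (L := L) p).ne'
  have hU := (U_pos (L := L) p).ne'
  apply Matrix.inv_eq_left_inv
  ext i j
  fin_cases i <;> fin_cases j <;>
    simp [frameMetric, Matrix.mul_apply, Fin.sum_univ_four, hW] <;> field_simp

namespace IsConformallyKahler

variable {M : Set Pt} {p : Pt}

theorem basic_conn (H : L.IsConformallyKahler M) (hM : IsOpen M) (α a b : Fin 4) :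
    IsBasic M fun q => L.conn α q a b := by
  have hW := H.basic_W hM
  have hU := H.basic_U hM
  have hWi := H.basic_W_inv hM
  have hUi := H.basic_U_inv hM
  have hm := H.basic_m hM
  have h1 := H.basic_dX hM H.basic_u
  have h2 := H.basic_dZ hM H.basic_u
  have h3 := H.basic_dX hM H.basic_v
  have h4 := H.basic_dZ hM H.basic_v
  fin_cases α <;> fin_cases a <;> fin_cases b <;> simp [conn_apply, -inv_pow] <;>
    repeat' first
      | assumption
      | exact IsBasic.const _
      | apply IsBasic.mul hM
      | apply IsBasic.neg
      | apply IsBasic.add hM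

theorem compatible (H : L.IsConformallyKahler M) (hM : IsOpen M) (hp : p ∈ M) (α : Fin 4) :
    frameDM L.frame α L.frameMetric p =
      (L.conn α p)ᵀ * L.frameMetric p + L.frameMetric p * L.conn α p := by
  have hW := (W_pos (L := L) p).ne'
  have hU := (U_pos (L := L) p).ne'
  have h0 := fun a b => frameD_zero (L := L) (H.basic_frameMetric hM a b) hp
  have h1 := fun a b => frameD_one (L := L) (H.basic_frameMetric hM a b) hp
  ext i j
  rw [frameDM, Matrix.of_apply]
  simp only [Matrix.add_apply, Matrix.mul_apply, Matrix.transpose_apply, Fin.sum_univ_four]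
  fin_cases α
  · refine (h0 i j).trans ?_
    fin_cases i <;> fin_cases j <;>
      simp [conn_apply, frameMetric] <;> (try field_simp) <;> ring
  · refine (h1 i j).trans ?_
    fin_cases i <;> fin_cases j <;>
      simp [conn_apply, frameMetric] <;> (try field_simp) <;> ring
  all_goals
    fin_cases i <;> fin_cases j <;>
      simp [conn_apply, frameMetric, frameD_const,
        H.frameD_W_inv hM hp, H.frameD_W hM hp, H.frameD_U hM hp,
        frameD_mul hM hp (H.basic_W hM) (H.basic_U hM)] <;>
      (try field_simp) <;> ring

/-- The torsion-free part of the connection: the only nontrivial brackets are those with `∂_y`. -/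
theorem conn_sub_conn (p : Pt) (γ α β : Fin 4) : L.conn α p γ β - L.conn β p γ α =
    if γ = 0 then !![0, 0, 0, 0; 0, 0, -(2 * L.U p * L.W p * L.m p), L.W p * 𝒟ₓ[L] L.v p;
      0, 2 * L.U p * L.W p * L.m p, 0, 0; 0, -(L.W p * 𝒟ₓ[L] L.v p), 0, 0] α β else 0 := by
  fin_cases γ <;> fin_cases α <;> fin_cases β <;> simp [conn_apply] <;> ring

/-- The equations for A enter here. Of the coframe only dψ + A dy fails to be closed, and its
differential dA ∧ dy has the components A_x and A_z that `dX_A` and `dZ_A` prescribe. -/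
theorem torsion_free (H : L.IsConformallyKahler M) (hM : IsOpen M) (hp : p ∈ M) (γ a b : Fin 4) :
    pd a (fun q => L.coframe q γ b) p - pd b (fun q => L.coframe q γ a) p =
      -∑ α, ∑ β, L.coframe p α a * L.coframe p β b * (L.conn α p γ β - L.conn β p γ α) := by
  have hA : ∀ i, pd i (fun q => L.r * L.A q) p = L.r * pd i L.A p := fun i => by
    rw [pd_mul hM hp contDiffOn_const H.basic_A.smooth, pd_const, zero_mul, zero_add]
  simp only [conn_sub_conn]
  fin_cases γ
  · fin_cases a <;> fin_cases b <;>
      simp [coframe, Fin.sum_univ_four, frameD_const, hA, H.basic_A.pd_zero p hp, H.basic_A.pd_one p hp,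
        H.pd_two hp, H.pd_three hp, H.dZ_A p hp, H.dX_A p hp] <;>
      ring
  · fin_cases a <;> fin_cases b <;> simp [coframe]
  · fin_cases a <;> fin_cases b <;>
      simp [coframe, H.basic_ξ₂.pd_zero p hp, H.basic_ξ₂.pd_one p hp,
        H.basic_ξ₃.pd_zero p hp, H.basic_ξ₃.pd_one p hp, H.closed_dx p hp]
  · fin_cases a <;> fin_cases b <;>
      simp [coframe, H.basic_ζ₂.pd_zero p hp, H.basic_ζ₂.pd_one p hp,
        H.basic_ζ₃.pd_zero p hp, H.basic_ζ₃.pd_one p hp, H.closed_dz hM hp]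

theorem isFrameConnection (H : L.IsConformallyKahler M) (hM : IsOpen M) {g : Field2}
    (hg : ∀ p ∈ M, g p = L.metric p) :
    IsFrameConnection M g L.frame L.coframe L.frameMetric L.conn where
  smooth_B a b := (H.basic_frame hM a b).smooth
  smooth_C a b := (H.basic_coframe hM a b).smooth
  smooth_h a b := (H.basic_frameMetric hM a b).smooth
  smooth_N α a b := (H.basic_conn hM α a b).smooth
  coframe_mul_frame p hp := H.coframe_mul_frame hp
  metric_eq := hg
  inv_mul p _ := by
    have hW := (W_pos (L := L) p).ne'
    have hU := (U_pos (L := L) p).ne'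
    rw [frameMetric_inv]
    ext i j
    fin_cases i <;> fin_cases j <;>
      simp [frameMetric, Matrix.mul_apply, Fin.sum_univ_four, hW] <;> field_simp
  symm p _ := by
    ext i j
    fin_cases i <;> fin_cases j <;> simp [frameMetric]
  compatible p hp α := H.compatible hM hp α
  torsion_free p hp γ a b := H.torsion_free hM hp γ a b

end IsConformallyKahler

end LeBrunData

/-! ### The Ricci tensor of a metric in LeBrun form -/

theorem frameRicci_apply (B : Field2) (N : Fin 4 → Field2) (p : Pt) (δ β : Fin 4) :
    frameRicci B N p δ β = ∑ α, (frameD B α (fun q => N β q α δ) p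
      - frameD B β (fun q => N α q α δ) p + ∑ ε, N α p α ε * N β p ε δ
      - ∑ ε, N β p α ε * N α p ε δ - ∑ ε, (N α p ε β - N β p ε α) * N ε p α δ) := by
  simp only [frameRicci, frameCurv, Matrix.of_apply, Matrix.sub_apply, Matrix.add_apply,
    Matrix.mul_apply, Matrix.sum_apply, Matrix.smul_apply, smul_eq_mul, frameDM]

namespace LeBrunData

variable (L : LeBrunData)

/-- The component `Ric(∂_z, ∂_z)`. -/
def ricZZ (p : Pt) : ℝ :=
  1 / 2 * (𝒟z[L] L.u p * 𝒟z[L] L.v p - 2 * (L.z p)⁻¹ * (𝒟z[L] L.u p + 𝒟z[L] L.v p)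
    - 𝒟z[L] (𝒟z[L] L.u) p + 2 * (L.z p)⁻¹ ^ 2)

/-- The component `Ric(∂ₓ, ∂_z)`. -/
def ricXZ (p : Pt) : ℝ :=
  1 / 2 * (𝒟z[L] L.u p * 𝒟ₓ[L] L.v p - 2 * (L.z p)⁻¹ * 𝒟ₓ[L] L.v p - 𝒟ₓ[L] (𝒟z[L] L.u) p)

/-- The Toda operator `u_xx + (eᵘ)_zz`. -/
def toda (p : Pt) : ℝ :=
  𝒟ₓ[L] (𝒟ₓ[L] L.u) p + L.U p * (𝒟z[L] (𝒟z[L] L.u) p + 𝒟z[L] L.u p ^ 2)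

/-- The component `Ric(∂ₓ, ∂ₓ)`. -/
def ricXX (p : Pt) : ℝ := -(1 / 2 * L.toda p) - L.U p * L.ricZZ p

variable {L}

namespace IsConformallyKahler

variable {M : Set Pt} {p : Pt}

/-- Three functions suffice because the Ricci tensor is J-invariant: the ψ,y block is the image of
the x,z block under the complex structure. A does not occur, since its derivatives have already been
replaced in the connection. -/
theorem frameRicci_eq (H : L.IsConformallyKahler M) (hM : IsOpen M) (hp : p ∈ M) :
    frameRicci L.frame L.conn p =
      !![(L.W p)⁻¹ ^ 2 * L.ricZZ p, -((L.W p)⁻¹ * L.ricXZ p), 0, 0;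
        -((L.W p)⁻¹ * L.ricXZ p), L.ricXX p, 0, 0;
        0, 0, L.ricXX p, L.ricXZ p; 0, 0, L.ricXZ p, L.ricZZ p] := by
  have hW := H.basic_W hM
  have hU := H.basic_U hM
  have hWi := H.basic_W_inv hM
  have hUi := H.basic_U_inv hM
  have hWi2 := hWi.pow hM 2
  have d2 : ∀ α, frameD L.frame α (fun q => (L.W q)⁻¹ ^ 2) p
      = -(2 * (L.W p)⁻¹ ^ 2 * frameD L.frame α L.v p) := fun α => by
    rw [frameD_sq hM hp hWi, H.frameD_W_inv hM hp]
    ring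
  have hUW := hUi.mul hM hWi2
  have hm := H.basic_m hM
  have h1 := H.basic_dX hM H.basic_u
  have h2 := H.basic_dZ hM H.basic_u
  have h3 := H.basic_dX hM H.basic_v
  have h4 := H.basic_dZ hM H.basic_v
  have k0 := fun α a b => frameD_zero (L := L) (H.basic_conn hM α a b) hp
  have k1 := fun α a b => frameD_one (L := L) (H.basic_conn hM α a b) hp
  have hc1 := H.dZ_dX hM H.basic_u hp
  have hc2 := H.dZ_dX hM H.basic_v hp
  -- Compatibility of the two equations for A determines v_xx; together with commuting ∂ₓ and ∂_z,
  -- this is the only differential relation needed.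
  have hvxx : 𝒟ₓ[L] (𝒟ₓ[L] L.v) p = -𝒟ₓ[L] L.v p ^ 2 - L.U p * (𝒟z[L] (𝒟z[L] L.u) p
      + 𝒟z[L] (𝒟z[L] L.v) p + 2 * (L.z p)⁻¹ ^ 2 + 2 * (𝒟z[L] L.u p + 𝒟z[L] L.v p) * L.m p) := by
    linear_combination H.integrability hM hp
  -- The quantities m and z⁻¹ are linearly dependent modulo u_z + v_z; eliminating z⁻¹ leaves
  -- independent variables for the algebra.
  have hmz : (L.z p)⁻¹ = 1 / 2 * (𝒟z[L] L.u p + 𝒟z[L] L.v p) - L.m p := by rw [m]; ring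
  have hW0 : L.W p * (L.W p)⁻¹ = 1 := mul_inv_cancel₀ (W_pos p).ne'
  have hU0 : L.U p * (L.U p)⁻¹ = 1 := mul_inv_cancel₀ (U_pos p).ne'
  have hW1 := (W_pos (L := L) p).ne'
  have hU1 := (U_pos (L := L) p).ne'
  have e0 := H.dX_m hM hp
  have e1 := H.dZ_m hM hp
  ext δ β
  rw [frameRicci_apply]
  simp only [conn_sub_conn]
  simp only [Fin.sum_univ_four]
  fin_cases δ <;> fin_cases β <;>
    simp only [Fin.zero_eta, Fin.mk_one, Fin.reduceFinMk, k0, k1] <;>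
    simp [conn_apply, frameD_const, frameD_neg, frameD_mul hM hp, frameD_add hM hp,
      IsBasic.const, IsBasic.mul hM, IsBasic.add hM, hU, hWi, hWi2, hUW, d2,
      hUi, hm, h1, h2, h3, h4, H.frameD_U hM hp, H.frameD_W_inv hM hp,
      H.frameD_U_inv hM hp, hc1, hc2, hvxx, e0, ricZZ, ricXZ, ricXX, toda, hmz, -inv_pow] <;>
    (try field_simp) <;> ring

end IsConformallyKahler

end LeBrunData

/-! ### Divergence and exterior derivative in a moving frame -/

namespace IsFrameConnection

variable {M : Set Pt} {g B C h : Field2} {N : Fin 4 → Field2}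

/-- The covariant derivative along a frame vector of a bilinear form, in frame components. -/
def frameCov (B : Field2) (N : Fin 4 → Field2) (t : Field2) (γ : Fin 4) : Field2 :=
  fun p => frameDM B γ t p - (N γ p)ᵀ * t p - t p * N γ p

theorem covDeriv_eq_sum (H : IsFrameConnection M g B C h N) (hM : IsOpen M) {p : Pt} (hp : p ∈ M)
    {T t : Field2} (ht : SmoothField2 M t) (hT : ∀ q ∈ M, T q = (C q)ᵀ * t q * C q)
    (c a b : Fin 4) : covDeriv g T c a b p =
      ∑ γ, ∑ α, ∑ β, C p γ c * C p α a * C p β b * frameCov B N t γ p α β := by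
  rw [H.covDeriv_eq hM hp ht hT]
  refine Finset.sum_congr rfl fun γ _ => ?_
  change C p γ c * ((C p)ᵀ * frameCov B N t γ p * C p) a b = _
  rw [mul_assoc (C p)ᵀ]
  simp only [Matrix.mul_apply, Matrix.transpose_apply, Finset.mul_sum]
  exact Finset.sum_congr rfl fun _ _ => Finset.sum_congr rfl fun _ _ => by ring

theorem frameCov_apply (B : Field2) (N : Fin 4 → Field2) (t : Field2) (γ α β : Fin 4) (p : Pt) :
    frameCov B N t γ p α β = frameDM B γ t p α β - ∑ δ, N γ p δ α * t p δ β
      - ∑ δ, t p α δ * N γ p δ β := by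
  simp only [frameCov, Matrix.sub_apply, Matrix.mul_apply, Matrix.transpose_apply]

/-- The divergence of a bilinear form in frame components. -/
theorem divergence_eq (H : IsFrameConnection M g B C h N) (hM : IsOpen M) {p : Pt} (hp : p ∈ M)
    {T t : Field2} (ht : SmoothField2 M t) (hT : ∀ q ∈ M, T q = (C q)ᵀ * t q * C q)
    (b : Fin 4) : ∑ a, ∑ c, (g p)⁻¹ a c * covDeriv g T c a b p =
      ∑ β, C p β b * ∑ α, ∑ γ, (h p)⁻¹ α γ * frameCov B N t γ p α β := by
  have hCB := H.coframe_mul_frame p hp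
  have hCB' : (B p)ᵀ * (C p)ᵀ = 1 := by rw [← Matrix.transpose_mul, hCB, Matrix.transpose_one]
  -- The inverse metric, contracted with two coframe rows, is the inverse of the frame metric.
  have e : ∀ α γ, ∑ a, ∑ c, (g p)⁻¹ a c * (C p γ c * C p α a) = (h p)⁻¹ α γ := by
    intro α γ
    have : C p * (g p)⁻¹ * (C p)ᵀ = (h p)⁻¹ := by
      rw [H.metric_inv hp]
      calc _ = (C p * B p) * (h p)⁻¹ * ((B p)ᵀ * (C p)ᵀ) := by simp only [mul_assoc]
        _ = _ := by rw [hCB, hCB', one_mul, mul_one]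
    rw [← this, mul_assoc]
    simp only [Matrix.mul_apply, Matrix.transpose_apply, Finset.mul_sum]
    exact Finset.sum_congr rfl fun _ _ => Finset.sum_congr rfl fun _ _ => by ring
  have e1 : ∀ a c, (g p)⁻¹ a c * covDeriv g T c a b p = ∑ γ, ∑ α, ∑ β,
      (g p)⁻¹ a c * (C p γ c * C p α a) * (C p β b * frameCov B N t γ p α β) := by
    intro a c
    rw [H.covDeriv_eq_sum hM hp ht hT]
    simp only [Finset.mul_sum]
    exact Finset.sum_congr rfl fun _ _ => Finset.sum_congr rfl fun _ _ =>
      Finset.sum_congr rfl fun _ _ => by ring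
  calc ∑ a, ∑ c, (g p)⁻¹ a c * covDeriv g T c a b p
      = ∑ γ, ∑ α, ∑ β, (∑ a, ∑ c, (g p)⁻¹ a c * (C p γ c * C p α a))
          * (C p β b * frameCov B N t γ p α β) := by
        simp only [e1, Finset.sum_mul]
        simp only [Finset.sum_comm (s := (Finset.univ : Finset (Fin 4))) (t := Finset.univ)
          (f := fun c γ => ∑ α, ∑ β, (g p)⁻¹ _ c * (C p γ c * C p α _)
            * (C p β b * frameCov B N t γ p α β))]
        rw [Finset.sum_comm]
        refine Finset.sum_congr rfl fun γ _ => ?_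
        have : ∀ a, ∑ c, ∑ α, ∑ β, (g p)⁻¹ a c * (C p γ c * C p α a)
            * (C p β b * frameCov B N t γ p α β) = ∑ α, ∑ β, ∑ c, (g p)⁻¹ a c
            * (C p γ c * C p α a) * (C p β b * frameCov B N t γ p α β) := by
          intro a
          rw [Finset.sum_comm]
          exact Finset.sum_congr rfl fun α _ => Finset.sum_comm
        simp only [this]
        rw [Finset.sum_comm]
        exact Finset.sum_congr rfl fun α _ => Finset.sum_comm
    _ = _ := by
        simp only [e, Finset.mul_sum]
        rw [Finset.sum_comm]
        have : ∀ α, ∑ γ, ∑ β, (h p)⁻¹ α γ * (C p β b * frameCov B N t γ p α β)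
            = ∑ β, ∑ γ, C p β b * ((h p)⁻¹ α γ * frameCov B N t γ p α β) := by
          intro α
          rw [Finset.sum_comm]
          exact Finset.sum_congr rfl fun _ _ => Finset.sum_congr rfl fun _ _ => by ring
        simp only [this]
        rw [Finset.sum_comm]

/-- The exterior derivative of a two-form in frame components. -/
theorem extDeriv2_eq (H : IsFrameConnection M g B C h N) (hM : IsOpen M) {p : Pt} (hp : p ∈ M)
    {T t : Field2} (ht : SmoothField2 M t) (hT : ∀ q ∈ M, T q = (C q)ᵀ * t q * C q)
    (hs : ∀ a b, T p a b = -T p b a) (a b c : Fin 4) : extDeriv2 T a b c p =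
      ∑ α, ∑ β, ∑ γ, C p α a * C p β b * C p γ c * (frameCov B N t α p β γ
        + frameCov B N t β p γ α + frameCov B N t γ p α β) := by
  have hsymm : ∀ d i j, christoffel g d i j p = christoffel g d j i p := by
    intro d i j
    rw [H.christoffel_eq hM hp, H.christoffel_eq hM hp, H.coordConn_symm hp]
  -- In the cyclic sum the Christoffel terms cancel in pairs, by symmetry of Γ and skewness of T;
  -- hence partial derivatives may be replaced by covariant ones.
  have e : extDeriv2 T a b c p = covDeriv g T a b c p + covDeriv g T b c a p
      + covDeriv g T c a b p := by
    simp only [extDeriv2, covDeriv]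
    have : ∑ d, (christoffel g d a b p * T p d c + christoffel g d a c p * T p b d)
        + ∑ d, (christoffel g d b c p * T p d a + christoffel g d b a p * T p c d)
        + ∑ d, (christoffel g d c a p * T p d b + christoffel g d c b p * T p a d) = 0 := by
      rw [← Finset.sum_add_distrib, ← Finset.sum_add_distrib]
      refine Finset.sum_eq_zero fun d _ => ?_
      rw [hsymm d b a, hsymm d c a, hsymm d c b, hs c d, hs b d, hs a d]
      ring
    linarith
  have e1 := H.covDeriv_eq_sum hM hp ht hT a b c
  have e2 : covDeriv g T b c a p = ∑ α, ∑ β, ∑ γ, C p α a * C p β b * C p γ c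
      * frameCov B N t β p γ α := by
    rw [H.covDeriv_eq_sum hM hp ht hT]
    have : ∀ β, ∑ γ, ∑ α, C p β b * C p γ c * C p α a * frameCov B N t β p γ α
        = ∑ α, ∑ γ, C p α a * C p β b * C p γ c * frameCov B N t β p γ α := by
      intro β
      rw [Finset.sum_comm]
      exact Finset.sum_congr rfl fun _ _ => Finset.sum_congr rfl fun _ _ => by ring
    simp only [this]
    rw [Finset.sum_comm]
  have e3 : covDeriv g T c a b p = ∑ α, ∑ β, ∑ γ, C p α a * C p β b * C p γ c
      * frameCov B N t γ p α β := by
    rw [H.covDeriv_eq_sum hM hp ht hT, Finset.sum_comm]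
    refine Finset.sum_congr rfl fun α _ => ?_
    rw [Finset.sum_comm]
    exact Finset.sum_congr rfl fun _ _ => Finset.sum_congr rfl fun _ _ => by ring
  rw [e, e1, e2, e3]
  simp only [mul_add, Finset.sum_add_distrib]

end IsFrameConnection

/-! ### The Maxwell field in the frame and its field equations -/

namespace LeBrunData

variable (L : LeBrunData)

/-- The frame components of the fundamental form `(dψ + A dy) ∧ dz + W eᵘ dx ∧ dy`. -/
def fundFrame : Field2 := fun p =>
  !![0, 0, 0, 1; 0, 0, -(L.W p * L.U p), 0; 0, L.W p * L.U p, 0, 0; -1, 0, 0, 0]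

/-- A component of the self-dual part of the Maxwell field. -/
def maxA (p : Pt) : ℝ := 1 / 4 * (L.z p ^ 2 * L.ricZZ p)

/-- A component of the self-dual part of the Maxwell field. -/
def maxB (p : Pt) : ℝ := 1 / 4 * (L.z p ^ 2 * L.ricXZ p)

/-- The frame components of the Maxwell field. -/
def maxwellFrame : Field2 := fun p =>
  !![0, 0, (L.W p)⁻¹ * L.maxB p, (L.z p)⁻¹ ^ 2 + (L.W p)⁻¹ * L.maxA p;
    0, 0, L.U p * L.maxA p - (L.z p)⁻¹ ^ 2 * (L.W p * L.U p), -L.maxB p;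
    -((L.W p)⁻¹ * L.maxB p), (L.z p)⁻¹ ^ 2 * (L.W p * L.U p) - L.U p * L.maxA p, 0, 0;
    -((L.z p)⁻¹ ^ 2 + (L.W p)⁻¹ * L.maxA p), L.maxB p, 0, 0]

variable {L}

namespace IsConformallyKahler

variable {M : Set Pt} {p : Pt}

theorem basic_ricZZ (H : L.IsConformallyKahler M) (hM : IsOpen M) : IsBasic M L.ricZZ :=
  have hz := H.basic_z_inv hM
  have h2 := H.basic_dZ hM H.basic_u
  have h4 := H.basic_dZ hM H.basic_v
  (IsBasic.const _).mul hM ((((h2.mul hM h4).sub hM (((IsBasic.const 2).mul hM hz).mul hM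
    (h2.add hM h4))).sub hM (H.basic_dZ hM h2)).add hM ((IsBasic.const 2).mul hM (hz.pow hM 2)))

theorem basic_ricXZ (H : L.IsConformallyKahler M) (hM : IsOpen M) : IsBasic M L.ricXZ :=
  have hz := H.basic_z_inv hM
  have h2 := H.basic_dZ hM H.basic_u
  have h3 := H.basic_dX hM H.basic_v
  (IsBasic.const _).mul hM (((h2.mul hM h3).sub hM (((IsBasic.const 2).mul hM hz).mul hM
    h3)).sub hM (H.basic_dX hM h2))

theorem basic_maxA (H : L.IsConformallyKahler M) (hM : IsOpen M) : IsBasic M L.maxA :=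
  (IsBasic.const _).mul hM ((H.basic_z.pow hM 2).mul hM (H.basic_ricZZ hM))

theorem basic_maxB (H : L.IsConformallyKahler M) (hM : IsOpen M) : IsBasic M L.maxB :=
  (IsBasic.const _).mul hM ((H.basic_z.pow hM 2).mul hM (H.basic_ricXZ hM))

/-- Differentiating the Toda equation along `∂_z`. -/
theorem dX_dX_dZ_u (H : L.IsConformallyKahler M) (hM : IsOpen M) (hT : ∀ q ∈ M, L.toda q = 0)
    (hp : p ∈ M) : 𝒟ₓ[L] (𝒟ₓ[L] (𝒟z[L] L.u)) p =
      -(L.U p * 𝒟z[L] L.u p * (𝒟z[L] (𝒟z[L] L.u) p + 𝒟z[L] L.u p ^ 2)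
        + L.U p * (𝒟z[L] (𝒟z[L] (𝒟z[L] L.u)) p
          + 2 * 𝒟z[L] L.u p * 𝒟z[L] (𝒟z[L] L.u) p)) := by
  have h2 := H.basic_dZ hM H.basic_u
  have h22 := H.basic_dZ hM h2
  have h1 := H.basic_dX hM H.basic_u
  have hs : IsBasic M fun q => 𝒟z[L] (𝒟z[L] L.u) q + 𝒟z[L] L.u q ^ 2 := h22.add hM (h2.pow hM 2)
  have e : ∀ q ∈ M, 𝒟ₓ[L] (𝒟ₓ[L] L.u) q
      = -(L.U q * (𝒟z[L] (𝒟z[L] L.u) q + 𝒟z[L] L.u q ^ 2)) := fun q hq => by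
    have := hT q hq
    rw [toda] at this
    linarith
  -- Both x-derivatives are moved inside ∂_z, so that u_xx can be replaced before differentiating.
  rw [frameD_congr hM hp fun q hq => (H.dZ_dX hM H.basic_u hq).symm,
    ← H.dZ_dX hM h1 hp, frameD_congr hM hp e, frameD_neg,
    frameD_mul hM hp (H.basic_U hM) hs, H.frameD_U hM hp, frameD_add hM hp h22 (h2.pow hM 2),
    frameD_sq hM hp h2]

theorem frameD_ricZZ (H : L.IsConformallyKahler M) (hM : IsOpen M) (hp : p ∈ M) (α : Fin 4) :
    frameD L.frame α L.ricZZ p = 1 / 2 * (frameD L.frame α (𝒟z[L] L.u) p * 𝒟z[L] L.v p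
      + 𝒟z[L] L.u p * frameD L.frame α (𝒟z[L] L.v) p
      - 2 * frameD L.frame α (fun q => (L.z q)⁻¹) p * (𝒟z[L] L.u p + 𝒟z[L] L.v p)
      - 2 * (L.z p)⁻¹ * (frameD L.frame α (𝒟z[L] L.u) p + frameD L.frame α (𝒟z[L] L.v) p)
      - frameD L.frame α (𝒟z[L] (𝒟z[L] L.u)) p
      + 4 * (L.z p)⁻¹ * frameD L.frame α (fun q => (L.z q)⁻¹) p) := by
  have hz := H.basic_z_inv hM
  have h2 := H.basic_dZ hM H.basic_u
  have h4 := H.basic_dZ hM H.basic_v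
  have hz2 := (IsBasic.const (M := M) 2).mul hM hz
  have hzz := (IsBasic.const (M := M) 2).mul hM (hz.pow hM 2)
  have a1 := h2.mul hM h4
  have a2 := hz2.mul hM (h2.add hM h4)
  have a3 := H.basic_dZ hM h2
  unfold ricZZ
  rw [frameD_mul hM hp (IsBasic.const _) (((a1.sub hM a2).sub hM a3).add hM hzz),
    frameD_add hM hp ((a1.sub hM a2).sub hM a3) hzz, frameD_sub hM hp (a1.sub hM a2) a3,
    frameD_sub hM hp a1 a2, frameD_mul hM hp h2 h4, frameD_mul hM hp hz2 (h2.add hM h4),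
    frameD_mul hM hp (IsBasic.const _) hz, frameD_add hM hp h2 h4,
    frameD_mul hM hp (IsBasic.const _) (hz.pow hM 2), frameD_sq hM hp hz]
  simp only [frameD_const]
  ring

theorem frameD_ricXZ (H : L.IsConformallyKahler M) (hM : IsOpen M) (hp : p ∈ M) (α : Fin 4) :
    frameD L.frame α L.ricXZ p = 1 / 2 * (frameD L.frame α (𝒟z[L] L.u) p * 𝒟ₓ[L] L.v p
      + 𝒟z[L] L.u p * frameD L.frame α (𝒟ₓ[L] L.v) p
      - 2 * frameD L.frame α (fun q => (L.z q)⁻¹) p * 𝒟ₓ[L] L.v p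
      - 2 * (L.z p)⁻¹ * frameD L.frame α (𝒟ₓ[L] L.v) p
      - frameD L.frame α (𝒟ₓ[L] (𝒟z[L] L.u)) p) := by
  have hz := H.basic_z_inv hM
  have h2 := H.basic_dZ hM H.basic_u
  have h3 := H.basic_dX hM H.basic_v
  have hz2 := (IsBasic.const (M := M) 2).mul hM hz
  have a1 := h2.mul hM h3
  have a2 := hz2.mul hM h3
  have a3 := H.basic_dX hM h2
  unfold ricXZ
  rw [frameD_mul hM hp (IsBasic.const _) ((a1.sub hM a2).sub hM a3),
    frameD_sub hM hp (a1.sub hM a2) a3, frameD_sub hM hp a1 a2, frameD_mul hM hp h2 h3,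
    frameD_mul hM hp hz2 h3, frameD_mul hM hp (IsBasic.const _) hz]
  simp only [frameD_const]
  ring

theorem frameD_maxA (H : L.IsConformallyKahler M) (hM : IsOpen M) (hp : p ∈ M) (α : Fin 4) :
    frameD L.frame α L.maxA p = 1 / 4 * (2 * L.z p * frameD L.frame α L.z p * L.ricZZ p
      + L.z p ^ 2 * frameD L.frame α L.ricZZ p) := by
  unfold maxA
  rw [frameD_mul hM hp (IsBasic.const _) ((H.basic_z.pow hM 2).mul hM (H.basic_ricZZ hM)),
    frameD_mul hM hp (H.basic_z.pow hM 2) (H.basic_ricZZ hM), frameD_sq hM hp H.basic_z,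
    frameD_const]
  ring

theorem frameD_maxB (H : L.IsConformallyKahler M) (hM : IsOpen M) (hp : p ∈ M) (α : Fin 4) :
    frameD L.frame α L.maxB p = 1 / 4 * (2 * L.z p * frameD L.frame α L.z p * L.ricXZ p
      + L.z p ^ 2 * frameD L.frame α L.ricXZ p) := by
  unfold maxB
  rw [frameD_mul hM hp (IsBasic.const _) ((H.basic_z.pow hM 2).mul hM (H.basic_ricXZ hM)),
    frameD_mul hM hp (H.basic_z.pow hM 2) (H.basic_ricXZ hM), frameD_sq hM hp H.basic_z,
    frameD_const]
  ring

/-- The first of the equations `dF⁺ = 0`. -/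
theorem maxwell_eq_one (H : L.IsConformallyKahler M) (hM : IsOpen M) (hp : p ∈ M) :
    𝒟ₓ[L] L.maxA p - L.maxA p * 𝒟ₓ[L] L.v p = 𝒟z[L] L.maxB p - L.maxB p * 𝒟z[L] L.v p := by
  have hz := H.z_ne_zero p hp
  -- No field equation is used: commuting ∂ₓ and ∂_z already makes both sides agree.
  rw [H.frameD_maxA hM hp, H.frameD_maxB hM hp, H.frameD_ricZZ hM hp, H.frameD_ricXZ hM hp,
    H.dX_z_inv hM hp, H.dZ_z_inv hM hp, H.dX_z hp, H.dZ_z hp, H.dZ_dX hM H.basic_v hp,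
    H.dZ_dX hM (H.basic_dZ hM H.basic_u) hp, maxA, maxB, ricZZ, ricXZ]
  field_simp
  ring

/-- The second of the equations `dF⁺ = 0`. -/
theorem maxwell_eq_two (H : L.IsConformallyKahler M) (hM : IsOpen M)
    (hT : ∀ q ∈ M, L.toda q = 0) (hp : p ∈ M) :
    𝒟ₓ[L] L.maxB p = -(L.maxB p * 𝒟ₓ[L] L.v p + L.U p * 𝒟z[L] L.maxA p
      + L.U p * (𝒟z[L] L.u p + 2 * L.m p) * L.maxA p) := by
  have hz := H.z_ne_zero p hp
  have hv : 𝒟ₓ[L] (𝒟ₓ[L] L.v) p = -𝒟ₓ[L] L.v p ^ 2 - L.U p * (𝒟z[L] (𝒟z[L] L.u) p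
      + 𝒟z[L] (𝒟z[L] L.v) p + 2 * (L.z p)⁻¹ ^ 2 + 2 * (𝒟z[L] L.u p + 𝒟z[L] L.v p) * L.m p) := by
    linear_combination H.integrability hM hp
  -- Here v_xx comes from compatibility of the equations for A, and u_xxz from the differentiated
  -- Toda equation.
  rw [H.frameD_maxA hM hp, H.frameD_maxB hM hp, H.frameD_ricZZ hM hp, H.frameD_ricXZ hM hp,
    H.dX_z_inv hM hp, H.dZ_z_inv hM hp, H.dX_z hp, H.dZ_z hp, H.dX_dX_dZ_u hM hT hp, hv, maxA,
    maxB, ricZZ, ricXZ, m]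
  field_simp
  ring

end IsConformallyKahler

end LeBrunData

namespace LeBrunData

variable {L : LeBrunData}

open IsFrameConnection

/-- The rows of the Maxwell field in the frame. -/
theorem maxwellFrame_apply (p : Pt) :
    L.maxwellFrame p 0 =
      ![0, 0, (L.W p)⁻¹ * L.maxB p, (L.z p)⁻¹ ^ 2 + (L.W p)⁻¹ * L.maxA p] ∧
    L.maxwellFrame p 1 =
      ![0, 0, L.U p * L.maxA p - (L.z p)⁻¹ ^ 2 * (L.W p * L.U p), -L.maxB p] ∧
    L.maxwellFrame p 2 = ![-((L.W p)⁻¹ * L.maxB p),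
      (L.z p)⁻¹ ^ 2 * (L.W p * L.U p) - L.U p * L.maxA p, 0, 0] ∧
    L.maxwellFrame p 3 =
      ![-((L.z p)⁻¹ ^ 2 + (L.W p)⁻¹ * L.maxA p), L.maxB p, 0, 0] :=
  ⟨rfl, rfl, rfl, rfl⟩

namespace IsConformallyKahler

variable {M : Set Pt} {p : Pt}

theorem basic_maxwellFrame (H : L.IsConformallyKahler M) (hM : IsOpen M) (a b : Fin 4) :
    IsBasic M fun q => L.maxwellFrame q a b := by
  have hW := H.basic_W hM
  have hU := H.basic_U hM
  have hWi := H.basic_W_inv hM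
  have hz := (H.basic_z_inv hM).pow hM 2
  have hA := H.basic_maxA hM
  have hB := H.basic_maxB hM
  have k1 := hz.add hM (hWi.mul hM hA)
  have k2 := hWi.mul hM hB
  have k3 := (hU.mul hM hA).sub hM (hz.mul hM (hW.mul hM hU))
  have k4 := (hz.mul hM (hW.mul hM hU)).sub hM (hU.mul hM hA)
  fin_cases a <;> fin_cases b
  exacts [IsBasic.const 0, IsBasic.const 0, k2, k1, IsBasic.const 0, IsBasic.const 0, k3, hB.neg,
    k2.neg, k4, IsBasic.const 0, IsBasic.const 0, k1.neg, hB, IsBasic.const 0, IsBasic.const 0]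

/-- The derivative of a skew matrix whose entries above the diagonal are c₁, c₂, c₃ and that of
-`maxB`. The same formula serves ∂ₓ and ∂_z; the two ignorable directions give zero. -/
theorem frameDM_maxwellFrame (H : L.IsConformallyKahler M) (hM : IsOpen M) (hp : p ∈ M)
    (α : Fin 4) :
    let c₁ := (L.W p)⁻¹ * frameD L.frame α L.maxB p
      - (L.W p)⁻¹ * frameD L.frame α L.v p * L.maxB p
    let c₂ := -(2 * (L.z p)⁻¹ ^ 3 * frameD L.frame α L.z p)
      + ((L.W p)⁻¹ * frameD L.frame α L.maxA p - (L.W p)⁻¹ * frameD L.frame α L.v p * L.maxA p)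
    let c₃ := L.U p * frameD L.frame α L.u p * L.maxA p + L.U p * frameD L.frame α L.maxA p
      + 2 * (L.z p)⁻¹ ^ 3 * frameD L.frame α L.z p * (L.W p * L.U p)
      - (L.z p)⁻¹ ^ 2 * (L.W p * L.U p) * (frameD L.frame α L.u p + frameD L.frame α L.v p)
    frameDM L.frame α L.maxwellFrame p = !![0, 0, c₁, c₂; 0, 0, c₃, -frameD L.frame α L.maxB p;
      -c₁, -c₃, 0, 0; -c₂, frameD L.frame α L.maxB p, 0, 0] := by
  intro c₁ c₂ c₃
  have hW := H.basic_W hM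
  have hU := H.basic_U hM
  have hWi := H.basic_W_inv hM
  have hzi := H.basic_z_inv hM
  have hz := hzi.pow hM 2
  have hA := H.basic_maxA hM
  have hB := H.basic_maxB hM
  have d1 : frameD L.frame α (fun q => (L.W q)⁻¹ * L.maxB q) p = c₁ := by
    rw [frameD_mul hM hp hWi hB, H.frameD_W_inv hM hp]
    ring
  have d2 : frameD L.frame α (fun q => (L.z q)⁻¹ ^ 2 + (L.W q)⁻¹ * L.maxA q) p = c₂ := by
    rw [frameD_add hM hp hz (hWi.mul hM hA), frameD_sq hM hp hzi,
      frameD_inv hM hp H.basic_z H.z_ne_zero, frameD_mul hM hp hWi hA, H.frameD_W_inv hM hp]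
    ring
  have d3 : frameD L.frame α (fun q => L.U q * L.maxA q - (L.z q)⁻¹ ^ 2 * (L.W q * L.U q)) p
      = c₃ := by
    rw [frameD_sub hM hp (hU.mul hM hA) (hz.mul hM (hW.mul hM hU)), frameD_mul hM hp hU hA,
      frameD_mul hM hp hz (hW.mul hM hU), frameD_sq hM hp hzi,
      frameD_inv hM hp H.basic_z H.z_ne_zero, frameD_mul hM hp hW hU, H.frameD_W hM hp,
      H.frameD_U hM hp]
    ring
  have d4 : frameD L.frame α (fun q => (L.z q)⁻¹ ^ 2 * (L.W q * L.U q) - L.U q * L.maxA q) p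
      = -c₃ := by
    rw [← d3, ← frameD_neg]
    simp only [neg_sub]
  have d0 : frameD L.frame α (fun _ => (0 : ℝ)) p = 0 := frameD_const 0
  ext i j
  fin_cases i <;> fin_cases j
  exacts [d0, d0, d1, d2, d0, d0, d3, frameD_neg, frameD_neg.trans (congrArg _ d1), d4, d0, d0,
    frameD_neg.trans (congrArg _ d2), rfl, d0, d0]

set_option maxHeartbeats 4000000 in
/-- The Maxwell equations in the frame. -/
theorem frameCov_maxwellFrame (H : L.IsConformallyKahler M) (hM : IsOpen M)
    (hT : ∀ q ∈ M, L.toda q = 0) (hp : p ∈ M) :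
    (∀ α β γ, frameCov L.frame L.conn L.maxwellFrame α p β γ
      + frameCov L.frame L.conn L.maxwellFrame β p γ α
      + frameCov L.frame L.conn L.maxwellFrame γ p α β = 0) ∧
    ∀ β, ∑ α, ∑ γ, (L.frameMetric p)⁻¹ α γ *
      frameCov L.frame L.conn L.maxwellFrame γ p α β = 0 := by
  have E0 : frameDM L.frame 0 L.maxwellFrame p = 0 := by
    ext i j
    exact frameD_zero (H.basic_maxwellFrame hM i j) hp
  have E1 : frameDM L.frame 1 L.maxwellFrame p = 0 := by
    ext i j
    exact frameD_one (H.basic_maxwellFrame hM i j) hp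
  have E2 := H.frameDM_maxwellFrame hM hp 2
  have E3 := H.frameDM_maxwellFrame hM hp 3
  have hx := H.dX_z hp
  have hz := H.dZ_z hp
  -- The two scalar Maxwell equations eliminate the x-derivatives of `maxA` and `maxB`. What then
  -- remains of dF = 0 and of the divergence equation is algebraic.
  have m1 : 𝒟ₓ[L] L.maxA p
      = L.maxA p * 𝒟ₓ[L] L.v p + 𝒟z[L] L.maxB p - L.maxB p * 𝒟z[L] L.v p := by
    linear_combination H.maxwell_eq_one hM hp
  have m2 := H.maxwell_eq_two hM hT hp
  have hmz : (L.z p)⁻¹ = 1 / 2 * (𝒟z[L] L.u p + 𝒟z[L] L.v p) - L.m p := by rw [m]; ring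
  have hW := (W_pos (L := L) p).ne'
  have hU := (U_pos (L := L) p).ne'
  simp only [hx, hz, m1, m2, hmz] at E2 E3
  constructor
  · intro α β γ
    simp only [frameCov_apply, Fin.sum_univ_four]
    fin_cases α <;> fin_cases β <;> fin_cases γ <;>
      simp [conn_apply, maxwellFrame_apply, E0, E1, E2, E3, hmz] <;>
      (try field_simp) <;> ring
  · intro β
    simp only [frameCov_apply, Fin.sum_univ_four, frameMetric_inv]
    fin_cases β <;>
      simp [conn_apply, maxwellFrame_apply, E0, E1, E2, E3, hmz] <;>
      (try field_simp) <;> ring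

end IsConformallyKahler

end LeBrunData

/-! ### From the Toda equation to the Einstein–Maxwell equations -/

theorem formSq_eq_mul (g F : Field2) (p : Pt) (a b : Fin 4) :
    formSq g F p a b = (F p * (g p)⁻¹ * (F p)ᵀ) a b := by
  simp only [formSq, Matrix.mul_apply, Matrix.transpose_apply, Finset.sum_mul]
  rw [Finset.sum_comm]

theorem fundForm_eq_mul (g J : Field2) (p : Pt) : fundForm g J p = (g p * J p)ᵀ := by
  ext a b
  simp [fundForm, Matrix.mul_apply]

theorem ricciForm_eq_mul (g J : Field2) (p : Pt) : ricciForm g J p = (ricci g p * J p)ᵀ := by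
  ext a b
  simp [ricciForm, Matrix.mul_apply]

namespace IsFrameConnection

variable {M : Set Pt} {g B C h : Field2} {N : Fin 4 → Field2} {p : Pt}

theorem transpose_frame_mul (H : IsFrameConnection M g B C h N) (hp : p ∈ M) :
    (B p)ᵀ * (C p)ᵀ = 1 := by
  rw [← Matrix.transpose_mul, H.coframe_mul_frame p hp, Matrix.transpose_one]

/-- The metric contraction of a bilinear form in frame components. -/
theorem contract_eq (H : IsFrameConnection M g B C h N) (hp : p ∈ M)
    {T t : Matrix (Fin 4) (Fin 4) ℝ} (hT : T = (C p)ᵀ * t * C p) :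
    ∑ a, ∑ b, (g p)⁻¹ a b * T a b = ∑ α, ∑ β, (h p)⁻¹ α β * t α β := by
  have tr : ∀ S T : Matrix (Fin 4) (Fin 4) ℝ, ∑ a, ∑ b, S a b * T a b = (S * Tᵀ).trace := by
    intro S T
    simp [Matrix.trace, Matrix.mul_apply]
  rw [tr, tr, H.metric_inv hp, hT]
  simp only [Matrix.transpose_mul, Matrix.transpose_transpose]
  calc (B p * (h p)⁻¹ * (B p)ᵀ * ((C p)ᵀ * (tᵀ * C p))).trace
      = (B p * ((h p)⁻¹ * ((B p)ᵀ * (C p)ᵀ) * tᵀ * C p)).trace := by simp only [mul_assoc]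
    _ = ((h p)⁻¹ * tᵀ * (C p * B p)).trace := by
        rw [H.transpose_frame_mul hp, mul_one, Matrix.trace_mul_comm, mul_assoc]
    _ = _ := by rw [H.coframe_mul_frame p hp, mul_one]

theorem mul_metric_inv_mul (H : IsFrameConnection M g B C h N) (hp : p ∈ M)
    (s t : Matrix (Fin 4) (Fin 4) ℝ) :
    (C p)ᵀ * s * C p * (g p)⁻¹ * ((C p)ᵀ * t * C p) = (C p)ᵀ * (s * (h p)⁻¹ * t) * C p := by
  rw [H.metric_inv hp]
  calc _ = (C p)ᵀ * s * (C p * B p) * (h p)⁻¹ * ((B p)ᵀ * (C p)ᵀ) * t * C p := by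
        simp only [mul_assoc]
    _ = _ := by rw [H.coframe_mul_frame p hp, H.transpose_frame_mul hp]; simp only [mul_assoc, mul_one]

end IsFrameConnection

namespace LeBrunData

variable {L : LeBrunData}

namespace IsConformallyKahler

variable {M : Set Pt} {g : Field2} {p : Pt}

/-- In the trace of the block form of Ric, the contributions of `ricZZ` from the z,ψ directions
cancel against those from the x,y directions, leaving only the Toda operator. -/
theorem scalarCurv_eq (H : L.IsConformallyKahler M) (hM : IsOpen M)
    (hg : ∀ p ∈ M, g p = L.metric p) (hp : p ∈ M) :
    scalarCurv g p = -((L.W p)⁻¹ * (L.U p)⁻¹ * L.toda p) := by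
  have hW := (W_pos (L := L) p).ne'
  have hU := (U_pos (L := L) p).ne'
  have K := H.isFrameConnection hM hg
  rw [scalarCurv, K.contract_eq hp (K.ricci_eq hM hp), H.frameRicci_eq hM hp, frameMetric_inv]
  simp [Fin.sum_univ_four, ricXX]
  field_simp
  ring

/-- The Einstein equation in the frame. -/
theorem frameRicci_eq_stress (H : L.IsConformallyKahler M) (hM : IsOpen M)
    (hT : ∀ q ∈ M, L.toda q = 0) (hp : p ∈ M) :
    frameRicci L.frame L.conn p =
      (2 : ℝ) • (L.maxwellFrame p * (L.frameMetric p)⁻¹ * (L.maxwellFrame p)ᵀ)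
      - (1 / 2 * ∑ α, ∑ β, (L.frameMetric p)⁻¹ α β *
        (L.maxwellFrame p * (L.frameMetric p)⁻¹ * (L.maxwellFrame p)ᵀ) α β) • L.frameMetric p := by
  have hW := (W_pos (L := L) p).ne'
  have hU := (U_pos (L := L) p).ne'
  have hz := H.z_ne_zero p hp
  -- The Toda equation makes the Ricci tensor trace-free.
  have hX : L.ricXX p = -(L.U p * L.ricZZ p) := by rw [ricXX, hT p hp]; ring
  -- The sums and differences of z⁻² and W⁻¹ `maxA` reflect the splitting F⁻ + F⁺: their squares
  -- contribute a pure-trace part, and the cross terms, with the factor ¼ of F⁺, reproduce Ric.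
  have hs : L.maxwellFrame p * (L.frameMetric p)⁻¹ * (L.maxwellFrame p)ᵀ =
      let P := (L.W p)⁻¹ * ((L.z p)⁻¹ ^ 2 + (L.W p)⁻¹ * L.maxA p) ^ 2
        + (L.W p)⁻¹ ^ 3 * (L.U p)⁻¹ * L.maxB p ^ 2
      let Q := L.W p * L.U p * ((L.z p)⁻¹ ^ 2 - (L.W p)⁻¹ * L.maxA p) ^ 2
        + (L.W p)⁻¹ * L.maxB p ^ 2
      let S := -(2 * (L.z p)⁻¹ ^ 2 * (L.W p)⁻¹ * L.maxB p)
      let P' := L.W p * ((L.z p)⁻¹ ^ 2 + (L.W p)⁻¹ * L.maxA p) ^ 2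
        + (L.W p)⁻¹ * (L.U p)⁻¹ * L.maxB p ^ 2
      let Q' := L.W p * L.U p * ((L.z p)⁻¹ ^ 2 - (L.W p)⁻¹ * L.maxA p) ^ 2
        + (L.W p)⁻¹ * L.maxB p ^ 2
      !![P, S, 0, 0; S, Q, 0, 0; 0, 0, Q', -(L.W p * S); 0, 0, -(L.W p * S), P'] := by
    rw [frameMetric_inv]
    ext i j
    simp only [Matrix.mul_apply, Fin.sum_univ_four, Matrix.transpose_apply]
    fin_cases i <;> fin_cases j <;> simp [maxwellFrame_apply] <;> field_simp <;> ring
  rw [hs, H.frameRicci_eq hM hp, frameMetric_inv]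
  simp only [hX]
  ext i j
  fin_cases i <;> fin_cases j <;>
    simp [Fin.sum_univ_four, frameMetric, maxA, maxB] <;> field_simp <;> ring

/-- All the equations are tensorial, so the frame identities transfer to coordinates by conjugation
with the coframe. Since R = 0, the Einstein equation reduces to Ric = stress. -/
theorem isEinsteinMaxwell (H : L.IsConformallyKahler M) (hM : IsOpen M)
    (hg : ∀ p ∈ M, g p = L.metric p) (hT : ∀ q ∈ M, L.toda q = 0) {F : Field2}
    (hF : ∀ p ∈ M, F p = (L.coframe p)ᵀ * L.maxwellFrame p * L.coframe p) :
    IsEinsteinMaxwell M g F 0 := by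
  have K := H.isFrameConnection hM hg
  have ht : SmoothField2 M L.maxwellFrame := fun a b => (H.basic_maxwellFrame hM a b).smooth
  have hskew : ∀ p ∈ M, ∀ a b, F p a b = -F p b a := by
    intro p hp a b
    have e : (F p)ᵀ = -F p := by
      have : (L.maxwellFrame p)ᵀ = -L.maxwellFrame p := by
        ext i j
        fin_cases i <;> fin_cases j <;> simp [maxwellFrame]
      rw [hF p hp]
      simp [Matrix.transpose_mul, this, mul_assoc]
    have := congrFun (congrFun e b) a
    simpa using this
  refine ⟨⟨?_, hskew⟩, fun p hp a b => ?_, fun p hp b => ?_, fun p hp a b c => ?_⟩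
  · exact SmoothField2.congr ((K.smooth_C.transpose.mul ht).mul K.smooth_C) hF
  · have hsq : F p * (g p)⁻¹ * (F p)ᵀ = (L.coframe p)ᵀ *
        (L.maxwellFrame p * (L.frameMetric p)⁻¹ * (L.maxwellFrame p)ᵀ) * L.coframe p := by
      rw [hF p hp, ← K.mul_metric_inv_mul hp]
      simp [Matrix.transpose_mul, mul_assoc]
    have hc : ∑ c, ∑ d, (g p)⁻¹ c d * formSq g F p c d = ∑ α, ∑ β, (L.frameMetric p)⁻¹ α β *
        (L.maxwellFrame p * (L.frameMetric p)⁻¹ * (L.maxwellFrame p)ᵀ) α β := by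
      simp only [formSq_eq_mul]
      exact K.contract_eq hp hsq
    have hR : ricci g p = (2 : ℝ) • (F p * (g p)⁻¹ * (F p)ᵀ)
        - (1 / 2 * ∑ c, ∑ d, (g p)⁻¹ c d * formSq g F p c d) • g p := by
      rw [K.ricci_eq hM hp, H.frameRicci_eq_stress hM hT hp, hsq, hc, K.metric_eq p hp]
      simp only [Matrix.mul_sub, Matrix.sub_mul, Matrix.mul_smul, Matrix.smul_mul]
    have hab := congrFun (congrFun hR a) b
    simp only [Matrix.sub_apply, Matrix.smul_apply, smul_eq_mul] at hab
    rw [H.scalarCurv_eq hM hg hp, hT p hp, hab, formSq_eq_mul]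
    ring
  · rw [K.divergence_eq hM hp ht hF]
    simp only [(H.frameCov_maxwellFrame hM hT hp).2, mul_zero, Finset.sum_const_zero]
  · rw [K.extDeriv2_eq hM hp ht hF (hskew p hp)]
    simp only [(H.frameCov_maxwellFrame hM hT hp).1, mul_zero, Finset.sum_const_zero]

theorem maxwellField_eq (H : L.IsConformallyKahler M) (hM : IsOpen M)
    (hg : ∀ p ∈ M, g p = L.metric p) (hp : p ∈ M) (hT : L.toda p = 0) {J : Field2} {Ω : Pt → ℝ}
    (hJ : J p = ((L.coframe p)ᵀ * L.fundFrame p * L.coframe p * (g p)⁻¹)ᵀ)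
    (hΩ : Ω p = (L.z p)⁻¹) :
    maxwellField g J Ω p = (L.coframe p)ᵀ * L.maxwellFrame p * L.coframe p := by
  have K := H.isFrameConnection hM hg
  have hW := (W_pos (L := L) p).ne'
  have hU := (U_pos (L := L) p).ne'
  have hz := H.z_ne_zero p hp
  have e1 : fundForm g J p = (L.coframe p)ᵀ * L.fundFrame p * L.coframe p := by
    rw [fundForm_eq_mul, hJ, Matrix.transpose_mul, Matrix.transpose_transpose, K.metric_symm hp,
      mul_assoc, K.metric_inv_mul hp, mul_one]
  have e2 : ricciForm g J p = (L.coframe p)ᵀ * (L.fundFrame p * (L.frameMetric p)⁻¹ *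
      (frameRicci L.frame L.conn p)ᵀ) * L.coframe p := by
    rw [ricciForm_eq_mul, hJ, Matrix.transpose_mul, Matrix.transpose_transpose,
      ← K.mul_metric_inv_mul hp, K.ricci_eq hM hp]
    simp [Matrix.transpose_mul, mul_assoc]
  have hX : L.ricXX p = -(L.U p * L.ricZZ p) := by rw [ricXX, hT]; ring
  -- The term R κ / 4 is absent because R vanishes; the factor z² of F⁺ is the inverse of the
  -- squared conformal factor.
  have hf : ((L.z p)⁻¹ ^ 2) • L.fundFrame p + (1 / 4 * ((L.z p)⁻¹ ^ 2)⁻¹) •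
      (L.fundFrame p * (L.frameMetric p)⁻¹ * (frameRicci L.frame L.conn p)ᵀ)
      = L.maxwellFrame p := by
    rw [H.frameRicci_eq hM hp, frameMetric_inv, hX]
    ext i j
    simp only [Matrix.add_apply, Matrix.smul_apply, Matrix.mul_apply, Fin.sum_univ_four,
      Matrix.transpose_apply]
    fin_cases i <;> fin_cases j <;> simp [maxwellFrame_apply, fundFrame, maxA, maxB] <;>
      (try field_simp) <;> ring
  rw [maxwellField, hΩ, e1, e2, H.scalarCurv_eq hM hg hp, hT, ← hf]
  simp [Matrix.mul_add, Matrix.add_mul]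

end IsConformallyKahler

end LeBrunData

/-! ### The equations for A from the conformally Kähler condition -/

namespace LeBrunData

variable (L : LeBrunData)

/-- The fundamental form `(dψ + A dy) ∧ dz + W eᵘ dx ∧ dy`. -/
def fund : Field2 := fun p => (L.coframe p)ᵀ * L.fundFrame p * L.coframe p

/-- The complex structure in the frame: `∂_ψ ↦ W⁻¹ ∂_z`, `∂ₓ ↦ ∂_y - A ∂_ψ`. -/
def complexFrame : Field2 := fun p =>
  !![0, 0, 0, -L.W p; 0, 0, 1, 0; 0, -1, 0, 0; (L.W p)⁻¹, 0, 0, 0]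

/-- The complex structure in coordinates. -/
def complexStr : Field2 := fun p => L.frame p * L.complexFrame p * L.coframe p

/-- The entries of the complex structure in coordinates. -/
def complexCoord : Field2 := fun p =>
  !![0, 0, -(L.t⁻¹ * (L.W p * L.ζ₂ p + L.A p * L.ξ₂ p)),
        -(L.t⁻¹ * (L.W p * L.ζ₃ p + L.A p * L.ξ₃ p));
      0, 0, L.r⁻¹ * L.ξ₂ p, L.r⁻¹ * L.ξ₃ p;
      -(L.t * (L.W p)⁻¹ * ((L.jac p)⁻¹ * L.ξ₃ p)),
        -(L.r * ((L.jac p)⁻¹ * L.ζ₃ p) + L.r * L.A p * (L.W p)⁻¹ * ((L.jac p)⁻¹ * L.ξ₃ p)), 0, 0;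
      L.t * (L.W p)⁻¹ * ((L.jac p)⁻¹ * L.ξ₂ p),
        L.r * ((L.jac p)⁻¹ * L.ζ₂ p) + L.r * L.A p * (L.W p)⁻¹ * ((L.jac p)⁻¹ * L.ξ₂ p), 0, 0]

variable {L}

theorem frameMetric_inv_mul (p : Pt) : (L.frameMetric p)⁻¹ * L.frameMetric p = 1 := by
  have hW := (W_pos (L := L) p).ne'
  have hU := (U_pos (L := L) p).ne'
  rw [frameMetric_inv]
  ext i j
  fin_cases i <;> fin_cases j <;>
    simp [frameMetric, Matrix.mul_apply, Fin.sum_univ_four, hW] <;> field_simp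

namespace IsRegular

variable {M : Set Pt} {p : Pt}

/-- Proved from regularity alone: `IsFrameConnection` is not yet available, since it presupposes the
equations for A that this part derives. -/
theorem metric_inv (R : L.IsRegular M) (hp : p ∈ M) :
    (L.metric p)⁻¹ = L.frame p * (L.frameMetric p)⁻¹ * (L.frame p)ᵀ := by
  have hCB := R.coframe_mul_frame hp
  have hCB' : (L.frame p)ᵀ * (L.coframe p)ᵀ = 1 := by
    rw [← Matrix.transpose_mul, hCB, Matrix.transpose_one]
  apply Matrix.inv_eq_left_inv
  calc L.frame p * (L.frameMetric p)⁻¹ * (L.frame p)ᵀ * L.metric p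
      = L.frame p * (L.frameMetric p)⁻¹ * ((L.frame p)ᵀ * (L.coframe p)ᵀ) * L.frameMetric p
          * L.coframe p := by
        rw [metric]; simp only [mul_assoc]
    _ = L.frame p * ((L.frameMetric p)⁻¹ * L.frameMetric p) * L.coframe p := by
        rw [hCB']; simp only [mul_assoc, one_mul]
    _ = 1 := by rw [frameMetric_inv_mul, mul_one, mul_eq_one_comm.1 hCB]

theorem complexStr_eq (R : L.IsRegular M) (hp : p ∈ M) :
    (L.fund p * (L.metric p)⁻¹)ᵀ = L.complexStr p := by
  have hW := (W_pos (L := L) p).ne'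
  have hU := (U_pos (L := L) p).ne'
  have hCB := R.coframe_mul_frame hp
  have hCB' : L.coframe p * L.frame p = 1 := hCB
  have e : L.fund p * (L.metric p)⁻¹ = (L.coframe p)ᵀ *
      (L.fundFrame p * (L.frameMetric p)⁻¹) * (L.frame p)ᵀ := by
    rw [R.metric_inv hp, fund]
    calc _ = (L.coframe p)ᵀ * L.fundFrame p * (L.coframe p * L.frame p) * (L.frameMetric p)⁻¹
          * (L.frame p)ᵀ := by simp only [mul_assoc]
      _ = _ := by rw [hCB]; simp only [mul_assoc, mul_one]
  have e2 : (L.fundFrame p * (L.frameMetric p)⁻¹)ᵀ = L.complexFrame p := by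
    rw [frameMetric_inv]
    ext i j
    fin_cases i <;> fin_cases j <;>
      simp [fundFrame, complexFrame] <;> field_simp
  rw [e, Matrix.transpose_mul, Matrix.transpose_mul, Matrix.transpose_transpose,
    Matrix.transpose_transpose, e2, complexStr, mul_assoc]

theorem fundForm_eq (R : L.IsRegular M) {g J : Field2} (hg : g p = L.metric p) (hp : p ∈ M)
    (hJ : J p = (L.fund p * (g p)⁻¹)ᵀ) : fundForm g J p = L.fund p := by
  have hs : (g p)ᵀ = g p := by
    have : (L.frameMetric p)ᵀ = L.frameMetric p := by
      ext i j
      fin_cases i <;> fin_cases j <;> simp [frameMetric]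
    rw [hg, metric]
    simp [Matrix.transpose_mul, this, mul_assoc]
  have hi : (g p)⁻¹ * g p = 1 := by
    have hCB := R.coframe_mul_frame hp
    have hCB' : (L.frame p)ᵀ * (L.coframe p)ᵀ = 1 := by
      rw [← Matrix.transpose_mul, hCB, Matrix.transpose_one]
    rw [hg, R.metric_inv hp]
    calc L.frame p * (L.frameMetric p)⁻¹ * (L.frame p)ᵀ * L.metric p
        = L.frame p * (L.frameMetric p)⁻¹ * ((L.frame p)ᵀ * (L.coframe p)ᵀ) * L.frameMetric p
            * L.coframe p := by
          rw [metric]; simp only [mul_assoc]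
      _ = L.frame p * ((L.frameMetric p)⁻¹ * L.frameMetric p) * L.coframe p := by
          rw [hCB']; simp only [mul_assoc, one_mul]
      _ = 1 := by rw [frameMetric_inv_mul, mul_one, mul_eq_one_comm.1 hCB]
  rw [fundForm_eq_mul, hJ, Matrix.transpose_mul, Matrix.transpose_transpose, hs, mul_assoc, hi,
    mul_one]

/-- The Nijenhuis tensor is defined by coordinate derivatives, so explicit coordinate entries are
needed; the vanishing 2 × 2 blocks shorten the computation. -/
theorem complexStr_eq_coord (p : Pt) : L.complexStr p = L.complexCoord p := by
  ext i j
  simp only [complexStr, Matrix.mul_apply, Fin.sum_univ_four]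
  fin_cases i <;> fin_cases j <;> simp [frame, complexFrame, coframe, complexCoord] <;> ring

/-- Integrability of the complex structure yields the first equation for `A`. -/
theorem dZ_A_of_nijenhuis (R : L.IsRegular M) (hM : IsOpen M) {J : Field2}
    (hJ : ∀ p ∈ M, J p = L.complexStr p) (hp : p ∈ M)
    (hN : ∀ k i j, nijenhuis J k i j p = 0) : 𝒟z[L] L.A p = L.W p * 𝒟ₓ[L] L.v p := by
  have ht := R.t_ne_zero
  have hj := R.jac_ne_zero p hp
  have hW := (W_pos (L := L) p).ne'
  have hJe : ∀ q ∈ M, ∀ a b, J q a b = L.complexCoord q a b := fun q hq a b => by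
    rw [hJ q hq, complexStr_eq_coord]
  have bW := R.basic_W hM
  have bA := R.basic_A
  have b2 := (bW.mul hM R.basic_ζ₂).add hM (bA.mul hM R.basic_ξ₂)
  have b3 := (bW.mul hM R.basic_ζ₃).add hM (bA.mul hM R.basic_ξ₃)
  have c : ∀ (r : ℝ) {f : Pt → ℝ} (_ : IsBasic M f) (i : Fin 4),
      pd i (fun q => r * f q) p = r * pd i f p := fun r f hf i => by
    rw [pd_mul hM hp contDiffOn_const hf.smooth, pd_const, zero_mul, zero_add]
  have d02 : ∀ i, pd i (fun q => J q 0 2) p =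
      -(L.t⁻¹ * (pd i L.W p * L.ζ₂ p + L.W p * pd i L.ζ₂ p + (pd i L.A p * L.ξ₂ p
        + L.A p * pd i L.ξ₂ p))) := fun i => by
    rw [pd_congr hM hp (fun q hq => hJe q hq 0 2)]
    change pd i (fun q => -(L.t⁻¹ * (L.W q * L.ζ₂ q + L.A q * L.ξ₂ q))) p = _
    rw [pd_neg, c _ b2, pd_add hM hp (bW.mul hM R.basic_ζ₂).smooth (bA.mul hM R.basic_ξ₂).smooth,
      pd_mul hM hp bW.smooth R.basic_ζ₂.smooth, pd_mul hM hp bA.smooth R.basic_ξ₂.smooth]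
  have d03 : ∀ i, pd i (fun q => J q 0 3) p =
      -(L.t⁻¹ * (pd i L.W p * L.ζ₃ p + L.W p * pd i L.ζ₃ p + (pd i L.A p * L.ξ₃ p
        + L.A p * pd i L.ξ₃ p))) := fun i => by
    rw [pd_congr hM hp (fun q hq => hJe q hq 0 3)]
    change pd i (fun q => -(L.t⁻¹ * (L.W q * L.ζ₃ q + L.A q * L.ξ₃ q))) p = _
    rw [pd_neg, c _ b3, pd_add hM hp (bW.mul hM R.basic_ζ₃).smooth (bA.mul hM R.basic_ξ₃).smooth,
      pd_mul hM hp bW.smooth R.basic_ζ₃.smooth, pd_mul hM hp bA.smooth R.basic_ξ₃.smooth]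
  have d12 : ∀ i, pd i (fun q => J q 1 2) p = L.r⁻¹ * pd i L.ξ₂ p := fun i => by
    rw [pd_congr hM hp (fun q hq => hJe q hq 1 2), ← c _ R.basic_ξ₂]
    rfl
  have d13 : ∀ i, pd i (fun q => J q 1 3) p = L.r⁻¹ * pd i L.ξ₃ p := fun i => by
    rw [pd_congr hM hp (fun q hq => hJe q hq 1 3), ← c _ R.basic_ξ₃]
    rfl
  have z22 : ∀ i, pd i (fun q => J q 2 2) p = 0 := fun i => by
    rw [pd_congr hM hp (fun q hq => hJe q hq 2 2)]
    exact pd_const i 0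
  have z23 : ∀ i, pd i (fun q => J q 2 3) p = 0 := fun i => by
    rw [pd_congr hM hp (fun q hq => hJe q hq 2 3)]
    exact pd_const i 0
  have z32 : ∀ i, pd i (fun q => J q 3 2) p = 0 := fun i => by
    rw [pd_congr hM hp (fun q hq => hJe q hq 3 2)]
    exact pd_const i 0
  have z33 : ∀ i, pd i (fun q => J q 3 3) p = 0 := fun i => by
    rw [pd_congr hM hp (fun q hq => hJe q hq 3 3)]
    exact pd_const i 0
  -- For these components the derivatives of rows 2 and 3 drop out because the x₁,x₂ block of J
  -- vanishes. Only derivatives of rows 0 and 1 survive, and those of row 1 cancel since dx is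
  -- closed.
  have n2 := hN 2 2 3
  have n3 := hN 3 2 3
  simp only [nijenhuis, Fin.sum_univ_four, d02, d03, d12, d13, z22, z23, z32, z33,
    R.closed_dx p hp, R.closed_dz hM hp, mul_zero, sub_self, zero_sub,
    hJe p hp, complexCoord, Matrix.of_apply, Matrix.cons_val', Matrix.cons_val, Matrix.cons_val_zero,
    Matrix.cons_val_one] at n2 n3
  have hx : pd 2 L.W p * L.ζ₃ p - pd 3 L.W p * L.ζ₂ p = L.jac p * (L.W p * 𝒟ₓ[L] L.v p) := by
    rw [← R.frameD_W hM hp, dX_eq]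
    field_simp
  have hz : pd 3 L.A p * L.ξ₂ p - pd 2 L.A p * L.ξ₃ p = L.jac p * 𝒟z[L] L.A p := by
    rw [dZ_eq]
    field_simp
  have hE : ∀ y : ℝ, y * (L.jac p * (L.W p * 𝒟ₓ[L] L.v p) - L.jac p * 𝒟z[L] L.A p) = 0 →
      y = 0 ∨ L.W p * 𝒟ₓ[L] L.v p - 𝒟z[L] L.A p = 0 := by
    intro y hy
    rw [← mul_sub] at hy
    simpa [hj] using hy
  -- With E = W v_x - A_z, the two Nijenhuis components say ξ₃ E = 0 and ξ₂ E = 0. A nonzero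
  -- Jacobian forbids ξ₂ = ξ₃ = 0, hence E = 0.
  have f2 : L.ξ₃ p * (L.jac p * (L.W p * 𝒟ₓ[L] L.v p) - L.jac p * 𝒟z[L] L.A p) = 0 := by
    rw [← hx, ← hz]
    field_simp at n2
    linear_combination -n2
  have f3 : L.ξ₂ p * (L.jac p * (L.W p * 𝒟ₓ[L] L.v p) - L.jac p * 𝒟z[L] L.A p) = 0 := by
    rw [← hx, ← hz]
    field_simp at n3
    linear_combination n3
  rcases hE _ f2 with h | h
  · rcases hE _ f3 with h' | h'
    · exact absurd (by rw [jac, h, h']; ring) hj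
    · linarith
  · linarith

/-- Closedness of `z⁻² κ` yields the second equation for `A`. -/
theorem dX_A_of_closed (R : L.IsRegular M) (hM : IsOpen M) {φ : Field2}
    (hφ : ∀ p ∈ M, φ p = ((L.z p)⁻¹ ^ 2) • L.fund p) (hp : p ∈ M)
    (hc : extDeriv2 φ 1 2 3 p = 0) : 𝒟ₓ[L] L.A p = -(2 * L.U p * L.W p * L.m p) := by
  have hr := R.r_ne_zero
  have hj := R.jac_ne_zero p hp
  have hzi := R.basic_z_inv hM
  have hz2 := hzi.pow hM 2
  have hWU := (R.basic_W hM).mul hM (R.basic_U hM)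
  have bf := hz2.mul hM R.basic_A
  have bh := hz2.mul hM hWU
  have hz := R.z_ne_zero p hp
  have e : ∀ q ∈ M, φ q 1 2 = L.r * ((L.z q)⁻¹ ^ 2 * L.A q * L.ζ₂ q
      - (L.z q)⁻¹ ^ 2 * (L.W q * L.U q) * L.ξ₂ q) ∧
      φ q 3 1 = -(L.r * ((L.z q)⁻¹ ^ 2 * L.A q * L.ζ₃ q
      - (L.z q)⁻¹ ^ 2 * (L.W q * L.U q) * L.ξ₃ q)) ∧ φ q 2 3 = 0 := by
    intro q hq
    rw [hφ q hq]
    simp only [fund, Matrix.smul_apply, Matrix.mul_apply, Fin.sum_univ_four,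
      Matrix.transpose_apply]
    refine ⟨?_, ?_, ?_⟩ <;> simp [coframe, fundFrame] <;> ring
  have c : ∀ (r : ℝ) {f : Pt → ℝ} (_ : IsBasic M f) (i : Fin 4),
      pd i (fun q => r * f q) p = r * pd i f p := fun r f hf i => by
    rw [pd_mul hM hp contDiffOn_const hf.smooth, pd_const, zero_mul, zero_add]
  have b2 := bf.mul hM R.basic_ζ₂
  have b3 := bf.mul hM R.basic_ζ₃
  have b2' := bh.mul hM R.basic_ξ₂
  have b3' := bh.mul hM R.basic_ξ₃
  rw [extDeriv2, pd_congr hM hp fun q hq => (e q hq).1, pd_congr hM hp fun q hq => (e q hq).2.1,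
    pd_congr hM hp fun q hq => (e q hq).2.2, pd_const, pd_neg, c _ (b3.sub hM b3'),
    c _ (b2.sub hM b2'), pd_sub hM hp b2.smooth b2'.smooth, pd_sub hM hp b3.smooth b3'.smooth,
    pd_mul hM hp bf.smooth R.basic_ζ₂.smooth, pd_mul hM hp bf.smooth R.basic_ζ₃.smooth,
    pd_mul hM hp bh.smooth R.basic_ξ₂.smooth, pd_mul hM hp bh.smooth R.basic_ξ₃.smooth,
    R.closed_dx p hp, R.closed_dz hM hp] at hc
  -- The φ,x₁,x₂ component of d(z⁻²κ) = 0 is the conservation law ∂ₓ(z⁻²A) + ∂_z(z⁻²We^u) = 0, up to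
  -- nonzero factors.
  have hx : 𝒟ₓ[L] (fun q => (L.z q)⁻¹ ^ 2 * L.A q) p
      + 𝒟z[L] (fun q => (L.z q)⁻¹ ^ 2 * (L.W q * L.U q)) p = 0 := by
    rw [dX_eq, dZ_eq, ← mul_add]
    refine mul_eq_zero_of_right _ ?_
    apply mul_left_cancel₀ hr
    linear_combination -hc
  rw [frameD_mul hM hp hz2 R.basic_A, frameD_mul hM hp hz2 hWU, frameD_sq hM hp hzi,
    frameD_sq hM hp hzi, R.dX_z_inv hM hp, R.dZ_z_inv hM hp,
    frameD_mul hM hp (R.basic_W hM) (R.basic_U hM), R.frameD_W hM hp, R.frameD_U hM hp] at hx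
  rw [m]
  field_simp at hx ⊢
  linear_combination hx

theorem isConformallyKahler (R : L.IsRegular M) (hM : IsOpen M) {g J : Field2} {Ω : Pt → ℝ}
    (hg : ∀ p ∈ M, g p = L.metric p) (hJ : ∀ p ∈ M, J p = (L.fund p * (g p)⁻¹)ᵀ)
    (hΩ : ∀ p ∈ M, Ω p = (L.z p)⁻¹) (hK : _root_.IsConformallyKahler M g J Ω) :
    L.IsConformallyKahler M where
  toIsRegular := R
  dZ_A p hp := R.dZ_A_of_nijenhuis hM (fun q hq => by rw [hJ q hq, hg q hq, R.complexStr_eq hq]) hp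
    (hK.integrable p hp)
  dX_A p hp := R.dX_A_of_closed hM
    (fun q hq => by rw [hΩ q hq, R.fundForm_eq (hg q hq) hq (hJ q hq)]) hp (hK.closed p hp 1 2 3)

end IsRegular

end LeBrunData

/-! ### Explicit derivatives of functions of x₁ and x₂ -/

/-- A basic function together with its partial derivatives. -/
structure HasPd (M : Set Pt) (f f₂ f₃ : Pt → ℝ) : Prop where
  basic : IsBasic M f
  pd_two : ∀ p ∈ M, pd 2 f p = f₂ p
  pd_three : ∀ p ∈ M, pd 3 f p = f₃ p

namespace HasPd

variable {M : Set Pt} {f f₂ f₃ g g₂ g₃ : Pt → ℝ}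

theorem const (r : ℝ) : HasPd M (fun _ => r) (fun _ => 0) (fun _ => 0) :=
  ⟨IsBasic.const r, fun _ _ => pd_const _ _, fun _ _ => pd_const _ _⟩

theorem add (hM : IsOpen M) (hf : HasPd M f f₂ f₃) (hg : HasPd M g g₂ g₃) :
    HasPd M (fun q => f q + g q) (fun q => f₂ q + g₂ q) (fun q => f₃ q + g₃ q) where
  basic := hf.basic.add hM hg.basic
  pd_two p hp := by
    rw [pd_add hM hp hf.basic.smooth hg.basic.smooth, hf.pd_two p hp, hg.pd_two p hp]
  pd_three p hp := by
    rw [pd_add hM hp hf.basic.smooth hg.basic.smooth, hf.pd_three p hp, hg.pd_three p hp]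

theorem neg (hf : HasPd M f f₂ f₃) :
    HasPd M (fun q => -f q) (fun q => -f₂ q) (fun q => -f₃ q) where
  basic := hf.basic.neg
  pd_two p hp := by rw [pd_neg, hf.pd_two p hp]
  pd_three p hp := by rw [pd_neg, hf.pd_three p hp]

theorem sub (hM : IsOpen M) (hf : HasPd M f f₂ f₃) (hg : HasPd M g g₂ g₃) :
    HasPd M (fun q => f q - g q) (fun q => f₂ q - g₂ q) (fun q => f₃ q - g₃ q) where
  basic := hf.basic.sub hM hg.basic
  pd_two p hp := by
    rw [pd_sub hM hp hf.basic.smooth hg.basic.smooth, hf.pd_two p hp, hg.pd_two p hp]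
  pd_three p hp := by
    rw [pd_sub hM hp hf.basic.smooth hg.basic.smooth, hf.pd_three p hp, hg.pd_three p hp]

theorem mul (hM : IsOpen M) (hf : HasPd M f f₂ f₃) (hg : HasPd M g g₂ g₃) :
    HasPd M (fun q => f q * g q) (fun q => f₂ q * g q + f q * g₂ q)
      (fun q => f₃ q * g q + f q * g₃ q) where
  basic := hf.basic.mul hM hg.basic
  pd_two p hp := by
    rw [pd_mul hM hp hf.basic.smooth hg.basic.smooth, hf.pd_two p hp, hg.pd_two p hp]
  pd_three p hp := by
    rw [pd_mul hM hp hf.basic.smooth hg.basic.smooth, hf.pd_three p hp, hg.pd_three p hp]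

theorem inv (hM : IsOpen M) (hf : HasPd M f f₂ f₃) (h : ∀ q ∈ M, f q ≠ 0) :
    HasPd M (fun q => (f q)⁻¹) (fun q => -((f q)⁻¹ ^ 2 * f₂ q))
      (fun q => -((f q)⁻¹ ^ 2 * f₃ q)) where
  basic := hf.basic.inv hM h
  pd_two p hp := by rw [hf.basic.pd_inv hM h hp, hf.pd_two p hp]
  pd_three p hp := by rw [hf.basic.pd_inv hM h hp, hf.pd_three p hp]

theorem log (hM : IsOpen M) (hf : HasPd M f f₂ f₃) (h : ∀ q ∈ M, f q ≠ 0) :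
    HasPd M (fun q => Real.log (f q)) (fun q => (f q)⁻¹ * f₂ q)
      (fun q => (f q)⁻¹ * f₃ q) where
  basic := hf.basic.log hM h
  pd_two p hp := by rw [hf.basic.pd_log hM h hp, hf.pd_two p hp]
  pd_three p hp := by rw [hf.basic.pd_log hM h hp, hf.pd_three p hp]

theorem congr (hM : IsOpen M) (hf : HasPd M f f₂ f₃) (h : ∀ q ∈ M, g q = f q)
    (h₂ : ∀ q ∈ M, g₂ q = f₂ q) (h₃ : ∀ q ∈ M, g₃ q = f₃ q) : HasPd M g g₂ g₃ where
  basic := hf.basic.congr hM h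
  pd_two p hp := by rw [pd_congr hM hp h, hf.pd_two p hp, h₂ p hp]
  pd_three p hp := by rw [pd_congr hM hp h, hf.pd_three p hp, h₃ p hp]

end HasPd

theorem pd_coord (i j : Fin 4) (p : Pt) : pd i (fun q => q j) p = if j = i then 1 else 0 := by
  have : fderiv ℝ (fun q : Pt => q j) p = ContinuousLinearMap.proj j :=
    (ContinuousLinearMap.proj (R := ℝ) (φ := fun _ : Fin 4 => ℝ) j).fderiv
  simp [pd, this, Pi.single_apply]

theorem contDiff_coord (j : Fin 4) : ContDiff ℝ ∞ fun q : Pt => q j := contDiff_apply ℝ ℝ j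

theorem hasPd_coord_two (M : Set Pt) : HasPd M (fun q => q 2) (fun _ => 1) (fun _ => 0) :=
  ⟨⟨(contDiff_coord 2).contDiffOn, fun _ _ => by simp [pd_coord], fun _ _ => by simp [pd_coord]⟩,
    fun _ _ => by simp [pd_coord], fun _ _ => by simp [pd_coord]⟩

theorem hasPd_coord_three (M : Set Pt) : HasPd M (fun q => q 3) (fun _ => 0) (fun _ => 1) :=
  ⟨⟨(contDiff_coord 3).contDiffOn, fun _ _ => by simp [pd_coord], fun _ _ => by simp [pd_coord]⟩,
    fun _ _ => by simp [pd_coord], fun _ _ => by simp [pd_coord]⟩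

theorem isOpen_image_coord {M : Set Pt} (hM : IsOpen M) (j : Fin 4) :
    IsOpen ((fun p : Pt => p j) '' M) := isOpenMap_eval j M hM

theorem contDiffAt_of_image {M : Set Pt} (hM : IsOpen M) {j : Fin 4} {φ : ℝ → ℝ}
    (hφ : ContDiffOn ℝ ∞ φ ((fun p : Pt => p j) '' M)) {q : Pt} (hq : q ∈ M) :
    ContDiffAt ℝ ∞ φ (q j) :=
  hφ.contDiffAt ((isOpen_image_coord hM j).mem_nhds ⟨q, hq, rfl⟩)

theorem ContDiffOn.deriv_image {M : Set Pt} (hM : IsOpen M) {j : Fin 4} {φ : ℝ → ℝ}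
    (hφ : ContDiffOn ℝ ∞ φ ((fun p : Pt => p j) '' M)) :
    ContDiffOn ℝ ∞ (deriv φ) ((fun p : Pt => p j) '' M) :=
  hφ.deriv_of_isOpen (isOpen_image_coord hM j) (by simp)

theorem hasPd_comp_two {M : Set Pt} (hM : IsOpen M) {φ : ℝ → ℝ}
    (hφ : ContDiffOn ℝ ∞ φ ((fun p : Pt => p 2) '' M)) :
    HasPd M (fun q => φ (q 2)) (fun q => deriv φ (q 2)) (fun _ => 0) := by
  have h := (hasPd_coord_two M).basic.comp hM fun q hq => contDiffAt_of_image hM hφ hq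
  exact ⟨h.1, fun p hp => by simp [h.2 p hp, pd_coord], fun p hp => by simp [h.2 p hp, pd_coord]⟩

theorem hasPd_comp_three {M : Set Pt} (hM : IsOpen M) {φ : ℝ → ℝ}
    (hφ : ContDiffOn ℝ ∞ φ ((fun p : Pt => p 3) '' M)) :
    HasPd M (fun q => φ (q 3)) (fun _ => 0) (fun q => deriv φ (q 3)) := by
  have h := (hasPd_coord_three M).basic.comp hM fun q hq => contDiffAt_of_image hM hφ hq
  exact ⟨h.1, fun p hp => by simp [h.2 p hp, pd_coord], fun p hp => by simp [h.2 p hp, pd_coord]⟩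

/-- The composite is constant along the lines in the first two coordinate directions, so its line
derivatives there vanish. -/
theorem isBasic_of_contDiffOn {M : Set Pt} (hM : IsOpen M) {φ : ℝ → ℝ → ℝ}
    (hφ : ContDiffOn ℝ ∞ (fun q : ℝ × ℝ => φ q.1 q.2) ((fun p : Pt => (p 2, p 3)) '' M)) :
    IsBasic M fun q => φ (q 2) (q 3) := by
  have hs : ContDiffOn ℝ ∞ (fun q : Pt => φ (q 2) (q 3)) M :=
    hφ.comp ((contDiff_coord 2).prodMk (contDiff_coord 3)).contDiffOn (Set.mapsTo_image _ _)
  have hz : ∀ i : Fin 4, i ≠ 2 → i ≠ 3 → ∀ p ∈ M, pd i (fun q => φ (q 2) (q 3)) p = 0 := by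
    intro i h2 h3 p hp
    have hd := (differentiableAt_of_mem hM hp hs).hasFDerivAt.hasLineDerivAt (Pi.single i 1)
    have hc : (fun t : ℝ => φ ((p + t • (Pi.single i 1 : Pt)) 2) ((p + t • (Pi.single i 1 : Pt)) 3))
        = fun _ => φ (p 2) (p 3) := by
      funext t
      simp [h2.symm, h3.symm]
    rw [HasLineDerivAt, hc] at hd
    exact hd.unique (hasDerivAt_const _ _)
  exact ⟨hs, hz 0 (by decide) (by decide), hz 1 (by decide) (by decide)⟩

/-! ### Positivity and LeBrun form of the ansatz -/

namespace ChenTeo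

variable {D : ChenTeo} {M : Set Pt} {p : Pt}

theorem metric_zero_zero (D : ChenTeo) (p : Pt) :
    D.metric p 0 0 = 1 / ((p 2 - p 3) * D.H (p 2) (p 3) * D.F p) * (D.F p * D.F p) := by
  simp [metric, θ]

theorem metric_two_two (D : ChenTeo) (p : Pt) :
    D.metric p 2 2 = D.k * D.H (p 2) (p 3) / (p 2 - p 3) ^ 3 * (1 / D.X₁ (p 2)) := by
  simp [metric, θ]

theorem metric_three_three (D : ChenTeo) (p : Pt) :
    D.metric p 3 3 = D.k * D.H (p 2) (p 3) / (p 2 - p 3) ^ 3 * -(1 / D.X₂ (p 3)) := by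
  simp [metric, θ]

/-- Division by zero returns zero, so a degenerate denominator would make a diagonal entry of g
vanish, against positive definiteness. The same reason gives the next four nonvanishing statements.
-/
theorem sub_ne_zero (hg : IsRiemannian M D.metric) (hp : p ∈ M) : p 2 - p 3 ≠ 0 := by
  intro h
  have := (hg.2 p hp).diag_pos (i := 0)
  simp [metric_zero_zero, h] at this

theorem H_ne_zero (hg : IsRiemannian M D.metric) (hp : p ∈ M) : D.H (p 2) (p 3) ≠ 0 := by
  intro h
  have := (hg.2 p hp).diag_pos (i := 0)
  simp [metric_zero_zero, h] at this

theorem F_ne_zero (hg : IsRiemannian M D.metric) (hp : p ∈ M) : D.F p ≠ 0 := by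
  intro h
  have := (hg.2 p hp).diag_pos (i := 0)
  simp [metric_zero_zero, h] at this

theorem X₁_ne_zero (hg : IsRiemannian M D.metric) (hp : p ∈ M) : D.X₁ (p 2) ≠ 0 := by
  intro h
  have := (hg.2 p hp).diag_pos (i := 2)
  simp [metric_two_two, h] at this

theorem X₂_ne_zero (hg : IsRiemannian M D.metric) (hp : p ∈ M) : D.X₂ (p 3) ≠ 0 := by
  intro h
  have := (hg.2 p hp).diag_pos (i := 3)
  simp [metric_three_three, h] at this

theorem X₁_mul_X₂_neg (hg : IsRiemannian M D.metric) (hp : p ∈ M) :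
    D.X₁ (p 2) * D.X₂ (p 3) < 0 := by
  have h2 := (hg.2 p hp).diag_pos (i := 2)
  have h3 := (hg.2 p hp).diag_pos (i := 3)
  have h := mul_pos h2 h3
  have e1 := X₁_ne_zero hg hp
  have e2 := X₂_ne_zero hg hp
  rw [metric_two_two, metric_three_three] at h
  -- The product of the dx₁² and dx₂² coefficients is a square times -X₁X₂.
  have e : D.k * D.H (p 2) (p 3) / (p 2 - p 3) ^ 3 * (1 / D.X₁ (p 2)) *
      (D.k * D.H (p 2) (p 3) / (p 2 - p 3) ^ 3 * -(1 / D.X₂ (p 3))) =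
      (D.k * D.H (p 2) (p 3) / (p 2 - p 3) ^ 3 / (D.X₁ (p 2) * D.X₂ (p 3))) ^ 2
        * -(D.X₁ (p 2) * D.X₂ (p 3)) := by
    field_simp
  rw [e] at h
  have := pos_of_mul_pos_right h (sq_nonneg _)
  linarith

theorem div_pos_of_riemannian (hg : IsRiemannian M D.metric) (hp : p ∈ M) :
    0 < (p 2 - p 3) * D.H (p 2) (p 3) / D.F p := by
  have h := (hg.2 p hp).diag_pos (i := 0)
  have e1 := sub_ne_zero hg hp
  have e2 := H_ne_zero hg hp
  have e3 := F_ne_zero hg hp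
  rw [metric_zero_zero] at h
  have e : 1 / ((p 2 - p 3) * D.H (p 2) (p 3) * D.F p) * (D.F p * D.F p) =
      ((p 2 - p 3) * D.H (p 2) (p 3) / D.F p)⁻¹ := by
    field_simp
  rw [e] at h
  exact inv_pos.1 h

/-- F X₁ = (x₂X₁)² - x₁² X₁X₂ is a sum of nonnegative terms, and neither factor vanishes. -/
theorem F_mul_X₁_pos (hg : IsRiemannian M D.metric) (hp : p ∈ M) : 0 < D.F p * D.X₁ (p 2) := by
  have h := X₁_mul_X₂_neg hg hp
  have h0 : D.F p * D.X₁ (p 2) ≠ 0 := mul_ne_zero (F_ne_zero hg hp) (X₁_ne_zero hg hp)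
  refine lt_of_le_of_ne ?_ h0.symm
  rw [F]
  nlinarith [mul_nonneg (sq_nonneg (p 2)) (neg_nonneg.2 h.le), sq_nonneg (p 3 * D.X₁ (p 2))]

theorem k_pos (hg : IsRiemannian M D.metric) (hp : p ∈ M) : 0 < D.k := by
  have h := (hg.2 p hp).diag_pos (i := 2)
  have h1 := div_pos_of_riemannian hg hp
  have h2 := F_mul_X₁_pos hg hp
  have e1 := sub_ne_zero hg hp
  have e2 := H_ne_zero hg hp
  have e3 := F_ne_zero hg hp
  have e4 := X₁_ne_zero hg hp
  rw [metric_two_two] at h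
  -- The dx₁² coefficient is a positive factor times k, the sign of H being controlled by the dτ²
  -- coefficient.
  have e : D.k * D.H (p 2) (p 3) / (p 2 - p 3) ^ 3 * (1 / D.X₁ (p 2)) =
      ((p 2 - p 3) * D.H (p 2) (p 3) / D.F p * (D.F p * D.X₁ (p 2))
        / ((p 2 - p 3) ^ 2 * D.X₁ (p 2)) ^ 2) * D.k := by
    field_simp
  rw [e] at h
  exact pos_of_mul_pos_right h (by positivity)

theorem W_pos (hc0 : D.c ≠ 0) (hg : IsRiemannian M D.metric) (hp : p ∈ M) : 0 < D.W p :=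
  mul_pos (div_pos (k_pos hg hp) (by positivity)) (div_pos_of_riemannian hg hp)

theorem expU_pos (hg : IsRiemannian M D.metric) (hp : p ∈ M) : 0 < D.expU p := by
  have h := X₁_mul_X₂_neg hg hp
  have e1 := sub_ne_zero hg hp
  exact div_pos (by linarith) (by positivity)

/-- The metric of the ansatz in LeBrun form. -/
def lebrun (D : ChenTeo) : LeBrunData where
  t := √D.k / D.c
  r := D.c / √D.k
  ξ₂ p := D.c * (p 2 / D.X₁ (p 2))
  ξ₃ p := -(D.c * (p 3 / D.X₂ (p 3)))
  ζ₂ p := D.c * p 3 / (p 2 - p 3) ^ 2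
  ζ₃ p := -(D.c * p 2 / (p 2 - p 3) ^ 2)
  A p := D.k / D.c ^ 2 * (D.G (p 2) (p 3) / D.F p)
  v p := Real.log (D.W p)
  u p := Real.log (D.expU p)
  z := D.z

theorem lebrun_const (D : ChenTeo) :
    D.lebrun.t = √D.k / D.c ∧ D.lebrun.r = D.c / √D.k := ⟨rfl, rfl⟩

theorem lebrun_apply (D : ChenTeo) (p : Pt) :
    D.lebrun.ξ₂ p = D.c * (p 2 / D.X₁ (p 2)) ∧ D.lebrun.ξ₃ p = -(D.c * (p 3 / D.X₂ (p 3))) ∧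
    D.lebrun.ζ₂ p = D.c * p 3 / (p 2 - p 3) ^ 2 ∧ D.lebrun.ζ₃ p = -(D.c * p 2 / (p 2 - p 3) ^ 2) ∧
    D.lebrun.A p = D.k / D.c ^ 2 * (D.G (p 2) (p 3) / D.F p) :=
  ⟨rfl, rfl, rfl, rfl, rfl⟩

theorem lebrun_W (hc0 : D.c ≠ 0) (hg : IsRiemannian M D.metric) (hp : p ∈ M) :
    D.lebrun.W p = D.W p := Real.exp_log (W_pos hc0 hg hp)

theorem lebrun_U (hg : IsRiemannian M D.metric) (hp : p ∈ M) : D.lebrun.U p = D.expU p :=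
  Real.exp_log (expU_pos hg hp)

theorem lebrun_jac (hg : IsRiemannian M D.metric) (hp : p ∈ M) : D.lebrun.jac p =
    D.c ^ 2 * D.F p / ((p 2 - p 3) ^ 2 * (D.X₁ (p 2) * D.X₂ (p 3))) := by
  have e1 := sub_ne_zero hg hp
  have e4 := X₁_ne_zero hg hp
  have e5 := X₂_ne_zero hg hp
  simp only [LeBrunData.jac, lebrun, F]
  field_simp
  ring

/-- The cross terms in dx₁ dx₂ of e^u dx² and dz² are opposite, and the diagonal terms combine to
c²F/(x₁ - x₂)⁴ times dx₁²/X₁ - dx₂²/X₂. -/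
theorem metric_eq_lebrun (hc0 : D.c ≠ 0) (hg : IsRiemannian M D.metric) (hp : p ∈ M) :
    D.metric p = D.lebrun.metric p := by
  have e1 := sub_ne_zero hg hp
  have e2 := H_ne_zero hg hp
  have e3 := F_ne_zero hg hp
  have e4 := X₁_ne_zero hg hp
  have e5 := X₂_ne_zero hg hp
  have ek := k_pos hg hp
  have es : √D.k ^ 2 = D.k := Real.sq_sqrt ek.le
  have es0 : √D.k ≠ 0 := (Real.sqrt_pos.2 ek).ne'
  have e6 := ek.ne'
  have hF : D.F p = p 3 ^ 2 * D.X₁ (p 2) - p 2 ^ 2 * D.X₂ (p 3) := rfl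
  have hW := lebrun_W hc0 hg hp
  have hU := lebrun_U hg hp
  ext i j
  simp only [LeBrunData.metric, Matrix.mul_apply, Fin.sum_univ_four, Matrix.transpose_apply]
  fin_cases i <;> fin_cases j <;>
    simp [metric, θ, LeBrunData.coframe, LeBrunData.frameMetric, hW, hU, lebrun_const, lebrun_apply, W, expU] <;>
    (try field_simp) <;> (try simp only [es]) <;> (try field_simp) <;> (try rw [hF]) <;> ring

theorem κ_eq_lebrun (hc0 : D.c ≠ 0) (hg : IsRiemannian M D.metric) (hp : p ∈ M) :
    D.κ p = D.lebrun.fund p := by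
  have hW := lebrun_W hc0 hg hp
  have hU := lebrun_U hg hp
  ext i j
  simp only [LeBrunData.fund, Matrix.mul_apply, Fin.sum_univ_four, Matrix.transpose_apply]
  fin_cases i <;> fin_cases j <;>
    simp [κ, wedge, dψ, dy, dx, dz, A, LeBrunData.coframe,
      LeBrunData.fundFrame, hW, hU, lebrun_const, lebrun_apply] <;> ring

theorem J_eq_lebrun (hc0 : D.c ≠ 0) (hg : IsRiemannian M D.metric) (hp : p ∈ M) :
    D.J p = (D.lebrun.fund p * (D.metric p)⁻¹)ᵀ := by
  rw [← κ_eq_lebrun hc0 hg hp]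
  ext i j
  simp [J, Matrix.mul_apply]

theorem lebrun_isRegular (hM : IsOpen M) (hc0 : D.c ≠ 0) (hD : D.SmoothOn M)
    (hg : IsRiemannian M D.metric) (hz : ∀ p ∈ M, D.z p ≠ 0) (hne : M.Nonempty) :
    D.lebrun.IsRegular M := by
  -- The sign of the constant k is read off at a point, so M must be nonempty for √k ≠ 0.
  obtain ⟨p₀, hp₀⟩ := hne
  have hk := (Real.sqrt_pos.2 (k_pos hg hp₀)).ne'
  have x1 := hasPd_coord_two M
  have x2 := hasPd_coord_three M
  have hs := x1.sub hM x2
  have hX₁ := hasPd_comp_two hM hD.2.2.1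
  have hX₂ := hasPd_comp_three hM hD.2.2.2
  have hG := isBasic_of_contDiffOn hM hD.1
  have hH := isBasic_of_contDiffOn hM hD.2.1
  have hξ₂ := (HasPd.const D.c).mul hM (x1.mul hM (hX₁.inv hM fun q hq => X₁_ne_zero hg hq))
  have hξ₃ := ((HasPd.const D.c).mul hM
    (x2.mul hM (hX₂.inv hM fun q hq => X₂_ne_zero hg hq))).neg
  have hsi := (hs.basic.pow hM 2).inv hM fun q hq => pow_ne_zero 2 (sub_ne_zero hg hq)
  have hF := ((x2.basic.pow hM 2).mul hM hX₁.basic).sub hM ((x1.basic.pow hM 2).mul hM hX₂.basic)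
  have hFi := hF.inv hM fun q hq => F_ne_zero hg hq
  have hW : IsBasic M D.W :=
    (((IsBasic.const _).mul hM ((hs.basic.mul hM hH).mul hM hFi))).congr hM fun q _ => by
      rw [W, div_eq_mul_inv ((q 2 - q 3) * D.H (q 2) (q 3))]
      rfl
  have hU : IsBasic M D.expU :=
    ((hX₁.basic.mul hM hX₂.basic).neg.mul hM ((hs.basic.pow hM 4).inv hM fun q hq =>
      pow_ne_zero 4 (sub_ne_zero hg hq))).congr hM fun q _ => by
      rw [expU, div_eq_mul_inv]
  have hzz := (((HasPd.const D.c).mul hM x2).mul hM ((x2.sub hM x1).inv hM fun q hq => by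
    have := sub_ne_zero hg hq
    contrapose! this
    linarith)).add hM (HasPd.const D.ν)
  have hz' : HasPd M D.z D.lebrun.ζ₂ D.lebrun.ζ₃ := by
    refine hzz.congr hM (fun q hq => ?_) (fun q hq => ?_) (fun q hq => ?_)
    · rw [z, div_eq_mul_inv]
    all_goals
      have e1 := sub_ne_zero hg hq
      have e2 : q 3 - q 2 ≠ 0 := by contrapose! e1; linarith
      simp only [lebrun]
      field_simp
      ring
  exact
    { t_ne_zero := div_ne_zero hk hc0
      r_ne_zero := div_ne_zero hc0 hk
      basic_ξ₂ := hξ₂.basic.congr hM fun q _ => by simp only [lebrun, div_eq_mul_inv]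
      basic_ξ₃ := hξ₃.basic.congr hM fun q _ => by simp only [lebrun, div_eq_mul_inv]
      basic_ζ₂ := (((IsBasic.const D.c).mul hM x2.basic).mul hM hsi).congr hM fun q _ => by
        simp only [lebrun, div_eq_mul_inv]
      basic_ζ₃ := (((IsBasic.const D.c).mul hM x1.basic).mul hM hsi).neg.congr hM fun q _ => by
        simp only [lebrun, div_eq_mul_inv]
      basic_A := ((IsBasic.const (D.k / D.c ^ 2)).mul hM (hG.mul hM hFi)).congr hM fun q _ => by
        simp only [lebrun, div_eq_mul_inv (D.G (q 2) (q 3))]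
        rfl
      basic_v := hW.log hM fun q hq => (W_pos hc0 hg hq).ne'
      basic_u := hU.log hM fun q hq => (expU_pos hg hq).ne'
      basic_z := hz'.basic
      jac_ne_zero := fun q hq => by
        rw [lebrun_jac hg hq]
        have e1 := sub_ne_zero hg hq
        have e3 := F_ne_zero hg hq
        have e4 := X₁_ne_zero hg hq
        have e5 := X₂_ne_zero hg hq
        positivity
      z_ne_zero := hz
      closed_dx := fun q hq => by
        have h2 := (hξ₂.congr hM (g := D.lebrun.ξ₂) (fun q _ => by
          simp only [lebrun, div_eq_mul_inv]) (fun _ _ => rfl) fun _ _ => rfl).pd_three q hq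
        have h3 := (hξ₃.congr hM (g := D.lebrun.ξ₃) (fun q _ => by
          simp only [lebrun, div_eq_mul_inv]) (fun _ _ => rfl) fun _ _ => rfl).pd_two q hq
        rw [h2, h3]
        ring
      pd_two_z := hz'.pd_two
      pd_three_z := hz'.pd_three }

end ChenTeo

/-! ### The Toda equation of the ansatz and quartic polynomials -/

namespace ChenTeo

variable {D : ChenTeo} {M : Set Pt} {p : Pt}

/-- The combination of `X₁`, `X₂` to which the Toda equation of the ansatz is equivalent. -/
def todaExpr (D : ChenTeo) (p : Pt) : ℝ :=
  (p 2 - p 3) * (p 2 - p 3) * (deriv (deriv D.X₁) (p 2) - deriv (deriv D.X₂) (p 3))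
    - 6 * ((p 2 - p 3) * (deriv D.X₁ (p 2) + deriv D.X₂ (p 3)))
    + 12 * (D.X₁ (p 2) - D.X₂ (p 3))

theorem hasPd_lebrun_u (hM : IsOpen M) (hD : D.SmoothOn M) (hg : IsRiemannian M D.metric) :
    HasPd M D.lebrun.u (fun q => deriv D.X₁ (q 2) / D.X₁ (q 2) - 4 / (q 2 - q 3))
      (fun q => deriv D.X₂ (q 3) / D.X₂ (q 3) + 4 / (q 2 - q 3)) := by
  have hs := (hasPd_coord_two M).sub hM (hasPd_coord_three M)
  have hX₁ := hasPd_comp_two hM hD.2.2.1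
  have hX₂ := hasPd_comp_three hM hD.2.2.2
  have hs2 := hs.mul hM hs
  have hs4 := (hs2.mul hM hs2).inv hM fun q hq => by
    have := sub_ne_zero hg hq
    positivity
  have hU := ((hX₁.mul hM hX₂).neg.mul hM hs4)
  have hE : ∀ q, D.expU q = -(D.X₁ (q 2) * D.X₂ (q 3)) *
      ((q 2 - q 3) * (q 2 - q 3) * ((q 2 - q 3) * (q 2 - q 3)))⁻¹ := fun q => by
    rw [expU, div_eq_mul_inv]
    ring
  refine (hU.log hM fun q hq => ?_).congr hM (fun q hq => ?_) (fun q hq => ?_) fun q hq => ?_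
  · rw [← hE]
    exact (expU_pos hg hq).ne'
  · simp only [lebrun, hE]
  all_goals
    have e1 := sub_ne_zero hg hq
    have e4 := X₁_ne_zero hg hq
    have e5 := X₂_ne_zero hg hq
    field_simp
    ring

theorem dX_eq (hc0 : D.c ≠ 0) (hg : IsRiemannian M D.metric) (hp : p ∈ M) (f : Pt → ℝ) :
    𝒟ₓ[D.lebrun] f p = -(D.X₁ (p 2) * D.X₂ (p 3) / (D.c * D.F p)
      * (p 2 * pd 2 f p + p 3 * pd 3 f p)) := by
  have e1 := sub_ne_zero hg hp
  have e3 := F_ne_zero hg hp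
  have e4 := X₁_ne_zero hg hp
  have e5 := X₂_ne_zero hg hp
  rw [LeBrunData.dX_eq, lebrun_jac hg hp]
  simp only [lebrun_apply]
  field_simp
  ring

theorem dZ_eq (hc0 : D.c ≠ 0) (hg : IsRiemannian M D.metric) (hp : p ∈ M) (f : Pt → ℝ) :
    𝒟z[D.lebrun] f p = (p 2 - p 3) ^ 2 / (D.c * D.F p)
      * (p 3 * D.X₁ (p 2) * pd 2 f p + p 2 * D.X₂ (p 3) * pd 3 f p) := by
  have e1 := sub_ne_zero hg hp
  have e3 := F_ne_zero hg hp
  have e4 := X₁_ne_zero hg hp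
  have e5 := X₂_ne_zero hg hp
  rw [LeBrunData.dZ_eq, lebrun_jac hg hp]
  simp only [lebrun_apply]
  field_simp
  ring

/-- The function u and the vector fields ∂ₓ, ∂_z depend only on X₁, X₂ and c, so G and H play no
role. The nonlinear terms in X₁ and X₂ collapse to a nonvanishing prefactor times an expression
linear in them. -/
theorem toda_eq (hM : IsOpen M) (hc0 : D.c ≠ 0) (hD : D.SmoothOn M)
    (hg : IsRiemannian M D.metric) (hp : p ∈ M) : D.lebrun.toda p =
      -(D.X₁ (p 2) * D.X₂ (p 3) / (D.c ^ 2 * D.F p * (p 2 - p 3) ^ 2) * D.todaExpr p) := by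
  have x1 := hasPd_coord_two M
  have x2 := hasPd_coord_three M
  have hs := x1.sub hM x2
  have a := hasPd_comp_two hM hD.2.2.1
  have b := hasPd_comp_three hM hD.2.2.2
  have a' := hasPd_comp_two hM (hD.2.2.1.deriv_image hM)
  have b' := hasPd_comp_three hM (hD.2.2.2.deriv_image hM)
  have hu := hasPd_lebrun_u hM hD hg
  have hF0 : ∀ q, q 3 * q 3 * D.X₁ (q 2) - q 2 * q 2 * D.X₂ (q 3) = D.F q := fun q => by
    rw [F]
    ring
  have hF := ((((x2.mul hM x2).mul hM a).sub hM ((x1.mul hM x1).mul hM b))).inv hM fun q hq => by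
    rw [hF0]
    exact F_ne_zero hg hq
  -- u_x and u_z are written as single fractions over F, up to the factors -c⁻¹ and c⁻¹; this
  -- removes X₁ and X₂ from the denominators before the second differentiation.
  have hN := ((((x1.mul hM a').mul hM b).add hM ((x2.mul hM b').mul hM a)).sub hM
    ((HasPd.const 4).mul hM (a.mul hM b))).mul hM hF
  have hP := (hs.mul hM ((hs.mul hM ((x2.mul hM a').add hM (x1.mul hM b'))).sub hM
    ((HasPd.const 4).mul hM ((x2.mul hM a).sub hM (x1.mul hM b))))).mul hM hF
  have hux := ((HasPd.const (-D.c⁻¹)).mul hM hN).congr hM (g := 𝒟ₓ[D.lebrun] D.lebrun.u)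
    (fun q hq => by
      have e1 := sub_ne_zero hg hq
      have e3 := F_ne_zero hg hq
      have e4 := X₁_ne_zero hg hq
      have e5 := X₂_ne_zero hg hq
      rw [dX_eq hc0 hg hq, hu.pd_two q hq, hu.pd_three q hq]
      simp only [hF0]
      field_simp
      ring) (fun _ _ => rfl) fun _ _ => rfl
  have huz := ((HasPd.const (D.c⁻¹)).mul hM hP).congr hM (g := 𝒟z[D.lebrun] D.lebrun.u)
    (fun q hq => by
      have e1 := sub_ne_zero hg hq
      have e3 := F_ne_zero hg hq
      have e4 := X₁_ne_zero hg hq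
      have e5 := X₂_ne_zero hg hq
      rw [dZ_eq hc0 hg hq, hu.pd_two q hq, hu.pd_three q hq]
      simp only [hF0]
      field_simp
      ring) (fun _ _ => rfl) fun _ _ => rfl
  have e1 := sub_ne_zero hg hp
  have e3 := F_ne_zero hg hp
  have e4 := X₁_ne_zero hg hp
  have e5 := X₂_ne_zero hg hp
  rw [LeBrunData.toda, lebrun_U hg hp, dX_eq hc0 hg hp, dZ_eq hc0 hg hp (𝒟z[D.lebrun] D.lebrun.u),
    hux.pd_two p hp, hux.pd_three p hp, huz.pd_two p hp, huz.pd_three p hp, dZ_eq hc0 hg hp,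
    hu.pd_two p hp, hu.pd_three p hp, expU, todaExpr]
  simp only [hF0]
  field_simp
  rw [F]
  ring

end ChenTeo

/-- On an open interval, a function whose derivative is that of `g` differs from `g` by a
constant. -/
theorem exists_eq_add_const {I : Set ℝ} (hI : IsOpen I) (hc : IsPreconnected I) {f g g' : ℝ → ℝ}
    (hf : ContDiffOn ℝ ∞ f I) (hg : ∀ x, HasDerivAt g (g' x) x) (h : ∀ x ∈ I, deriv f x = g' x) :
    ∃ r, ∀ x ∈ I, f x = g x + r := by
  have hfd : DifferentiableOn ℝ f I := hf.differentiableOn (by simp)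
  obtain ⟨r, hr⟩ := hI.exists_is_const_of_deriv_eq_zero hc
    (f := fun x => f x - g x) (hfd.sub fun x _ => (hg x).differentiableAt.differentiableWithinAt)
    (fun x hx => by
      have h1 := (hfd.differentiableAt (hI.mem_nhds hx)).hasDerivAt.sub (hg x)
      have h2 : deriv (fun x => f x - g x) x = deriv f x - g' x := h1.deriv
      simp [h2, h x hx])
  exact ⟨r, fun x hx => by linarith [hr x hx]⟩

/-- The trace of the Einstein–Maxwell equations without cosmological constant. -/
theorem IsEinsteinMaxwell.scalarCurv_eq_zero {M : Set Pt} {g F : Field2}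
    (h : IsEinsteinMaxwell M g F 0) (hg : IsRiemannian M g) {p : Pt} (hp : p ∈ M) :
    scalarCurv g p = 0 := by
  have hpd := hg.2 p hp
  -- The dimension four enters here: the stress tensor has trace 2S - ½·4·S = 0, while the Einstein
  -- tensor has trace R - 2R = -R.
  have htr : ∑ a, ∑ b, (g p)⁻¹ a b * g p a b = 4 := by
    have e : (g p)⁻¹ * g p = 1 := Matrix.nonsing_inv_mul _ hpd.det_pos.ne'.isUnit
    have hs : ∀ a b, g p a b = g p b a := fun a b => by simpa using hpd.isHermitian.apply b a
    have : ∀ a, ∑ b, (g p)⁻¹ a b * g p a b = 1 := fun a => by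
      rw [Finset.sum_congr rfl fun b _ => by rw [hs a b], ← Matrix.mul_apply, e,
        Matrix.one_apply_eq]
    simp [this]
  set S := ∑ c, ∑ d, (g p)⁻¹ c d * formSq g F p c d with hS
  have key : ∀ a b, (g p)⁻¹ a b * ricci g p a b - scalarCurv g p / 2 * ((g p)⁻¹ a b * g p a b)
      = 2 * ((g p)⁻¹ a b * formSq g F p a b) - 1 / 2 * S * ((g p)⁻¹ a b * g p a b) :=
    fun a b => by linear_combination (g p)⁻¹ a b * h.einstein p hp a b
  have hsum : ∑ a, ∑ b, ((g p)⁻¹ a b * ricci g p a b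
        - scalarCurv g p / 2 * ((g p)⁻¹ a b * g p a b))
      = ∑ a, ∑ b, (2 * ((g p)⁻¹ a b * formSq g F p a b)
        - 1 / 2 * S * ((g p)⁻¹ a b * g p a b)) :=
    Finset.sum_congr rfl fun a _ => Finset.sum_congr rfl fun b _ => key a b
  simp only [Finset.sum_sub_distrib, ← Finset.mul_sum] at hsum
  rw [htr, ← hS, ← scalarCurv] at hsum
  linarith

/-- The quartic polynomial with the given coefficients. -/
def quartic (a₀ a₁ a₂ a₃ a₄ x : ℝ) : ℝ := a₀ + a₁ * x + a₂ * x ^ 2 + a₃ * x ^ 3 + a₄ * x ^ 4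

theorem hasDerivAt_quartic (a₀ a₁ a₂ a₃ a₄ x : ℝ) :
    HasDerivAt (quartic a₀ a₁ a₂ a₃ a₄) (quartic a₁ (2 * a₂) (3 * a₃) (4 * a₄) 0 x) x := by
  have h := (((((hasDerivAt_const x a₀).add ((hasDerivAt_id x).const_mul a₁)).add
    ((hasDerivAt_pow 2 x).const_mul a₂)).add ((hasDerivAt_pow 3 x).const_mul a₃)).add
    ((hasDerivAt_pow 4 x).const_mul a₄))
  refine h.congr_deriv ?_
  simp only [quartic]
  norm_num
  ring

theorem deriv_quartic (a₀ a₁ a₂ a₃ a₄ : ℝ) :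
    deriv (quartic a₀ a₁ a₂ a₃ a₄) = quartic a₁ (2 * a₂) (3 * a₃) (4 * a₄) 0 :=
  funext fun x => (hasDerivAt_quartic a₀ a₁ a₂ a₃ a₄ x).deriv

/-- A function whose derivative is a cubic polynomial on an open interval is a quartic there. -/
theorem exists_eq_quartic {I : Set ℝ} (hI : IsOpen I) (hc : IsPreconnected I) {f : ℝ → ℝ}
    (hf : ContDiffOn ℝ ∞ f I) {a₁ a₂ a₃ a₄ : ℝ}
    (h : ∀ x ∈ I, deriv f x = quartic a₁ a₂ a₃ a₄ 0 x) :
    ∃ a₀, ∀ x ∈ I, f x = quartic a₀ a₁ (a₂ / 2) (a₃ / 3) (a₄ / 4) x := by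
  obtain ⟨r, hr⟩ := exists_eq_add_const hI hc hf
    (hasDerivAt_quartic 0 a₁ (a₂ / 2) (a₃ / 3) (a₄ / 4)) fun x hx => by
      rw [h x hx]
      congr 1 <;> ring
  exact ⟨r, fun x hx => by rw [hr x hx]; simp only [quartic]; ring⟩

theorem deriv_eqOn_of_eqOn {I : Set ℝ} (hI : IsOpen I) {f g : ℝ → ℝ} (h : Set.EqOn f g I) :
    Set.EqOn (deriv f) (deriv g) I := fun _ hx =>
  (h.eventuallyEq_of_mem (hI.mem_nhds hx)).deriv_eq

namespace ChenTeo

variable {D : ChenTeo} {M : Set Pt}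

/-- `X₁` and `X₂` are given by the same quartic polynomial. -/
def IsQuartic (D : ChenTeo) (M : Set Pt) : Prop :=
  ∃ a₀ a₁ a₂ a₃ a₄ : ℝ, ∀ p ∈ M,
    D.X₁ (p 2) = quartic a₀ a₁ a₂ a₃ a₄ (p 2) ∧ D.X₂ (p 3) = quartic a₀ a₁ a₂ a₃ a₄ (p 3)

/-- The coordinate projections of M are open, so equality with the quartic passes to derivatives;
the rest is a polynomial identity. -/
theorem IsQuartic.todaExpr_eq_zero (h : D.IsQuartic M) (hM : IsOpen M) {p : Pt} (hp : p ∈ M) :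
    D.todaExpr p = 0 := by
  obtain ⟨a₀, a₁, a₂, a₃, a₄, h⟩ := h
  have h1 : Set.EqOn D.X₁ (quartic a₀ a₁ a₂ a₃ a₄) ((fun p : Pt => p 2) '' M) := by
    rintro _ ⟨q, hq, rfl⟩
    exact (h q hq).1
  have h2 : Set.EqOn D.X₂ (quartic a₀ a₁ a₂ a₃ a₄) ((fun p : Pt => p 3) '' M) := by
    rintro _ ⟨q, hq, rfl⟩
    exact (h q hq).2
  have d1 := deriv_eqOn_of_eqOn (isOpen_image_coord hM 2) h1
  have d2 := deriv_eqOn_of_eqOn (isOpen_image_coord hM 3) h2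
  have dd1 := deriv_eqOn_of_eqOn (isOpen_image_coord hM 2) d1
  have dd2 := deriv_eqOn_of_eqOn (isOpen_image_coord hM 3) d2
  have m1 : p 2 ∈ (fun p : Pt => p 2) '' M := ⟨p, hp, rfl⟩
  have m2 : p 3 ∈ (fun p : Pt => p 3) '' M := ⟨p, hp, rfl⟩
  rw [todaExpr, h1 m1, h2 m2, d1 m1, d2 m2, dd1 m1, dd2 m2]
  simp only [deriv_quartic, quartic]
  ring

/-- Connectedness of M makes the range of x₁ an interval, on which X₁⁽⁵⁾ = 0 integrates to one
quartic. The ranges of x₁ and x₂ may be disjoint, so the coefficients of X₂ must come from the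
relation itself, not from continuation. -/
theorem isQuartic_of_todaExpr (hM : IsOpen M) (hMc : IsConnected M) (hD : D.SmoothOn M)
    (hs0 : ∀ p ∈ M, p 2 - p 3 ≠ 0) (h : ∀ p ∈ M, D.todaExpr p = 0) : D.IsQuartic M := by
  have hI := isOpen_image_coord hM 2
  have hIc : IsPreconnected ((fun p : Pt => p 2) '' M) :=
    hMc.isPreconnected.image _ (continuous_apply 2).continuousOn
  have hs := (hasPd_coord_two M).sub hM (hasPd_coord_three M)
  have s0 := hD.2.2.1
  have s1 := s0.deriv_image hM
  have s2 := s1.deriv_image hM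
  have s3 := s2.deriv_image hM
  have s4 := s3.deriv_image hM
  have t0 := hD.2.2.2
  have t1 := t0.deriv_image hM
  have t2 := t1.deriv_image hM
  have A0 := hasPd_comp_two hM s0
  have A1 := hasPd_comp_two hM s1
  have A2 := hasPd_comp_two hM s2
  have A3 := hasPd_comp_two hM s3
  have A4 := hasPd_comp_two hM s4
  have B0 := hasPd_comp_three hM t0
  have B1 := hasPd_comp_three hM t1
  have B2 := hasPd_comp_three hM t2
  -- M is open, so a function vanishing on M has vanishing x₁-derivative there.
  have ofZero : ∀ {f f₂ f₃ : Pt → ℝ}, HasPd M f f₂ f₃ → (∀ p ∈ M, f p = 0) → ∀ p ∈ M, f₂ p = 0 :=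
    fun {f f₂ f₃} hf hz p hp => by
      rw [← hf.pd_two p hp, pd_congr hM hp hz, pd_const]
  have E0 := (((hs.mul hM hs).mul hM (A2.sub hM B2)).sub hM
    ((HasPd.const 6).mul hM (hs.mul hM (A1.add hM B1)))).add hM
    ((HasPd.const 12).mul hM (A0.sub hM B0))
  have E1 := ((((hs.mul hM hs).mul hM A3).sub hM ((HasPd.const 4).mul hM (hs.mul hM A2))).sub hM
    ((HasPd.const 2).mul hM (hs.mul hM B2))).add hM ((HasPd.const 6).mul hM (A1.sub hM B1))
  have E2 := (((hs.mul hM hs).mul hM A4).sub hM ((HasPd.const 2).mul hM (hs.mul hM A3))).add hM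
    ((HasPd.const 2).mul hM (A2.sub hM B2))
  have z1 := fun p hp => (ofZero E0 h) p hp
  have z1' := fun p (hp : p ∈ M) => (by linear_combination z1 p hp :
    (p 2 - p 3) * (p 2 - p 3) * deriv (deriv (deriv D.X₁)) (p 2)
      - 4 * ((p 2 - p 3) * deriv (deriv D.X₁) (p 2))
      - 2 * ((p 2 - p 3) * deriv (deriv D.X₂) (p 3))
      + 6 * (deriv D.X₁ (p 2) - deriv D.X₂ (p 3)) = 0)
  have z2 := ofZero E1 z1'
  have z2' := fun p (hp : p ∈ M) => (by linear_combination z2 p hp :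
    (p 2 - p 3) * (p 2 - p 3) * deriv (deriv (deriv (deriv D.X₁))) (p 2)
      - 2 * ((p 2 - p 3) * deriv (deriv (deriv D.X₁)) (p 2))
      + 2 * (deriv (deriv D.X₁) (p 2) - deriv (deriv D.X₂) (p 3)) = 0)
  have z3 := ofZero E2 z2'
  have h5 : ∀ x ∈ (fun p : Pt => p 2) '' M,
      deriv (deriv (deriv (deriv (deriv D.X₁)))) x = quartic 0 0 0 0 0 x := by
    rintro _ ⟨p, hp, rfl⟩
    have hs0 := hs0 p hp
    have e : ((p 2 - p 3) * (p 2 - p 3)) * deriv (deriv (deriv (deriv (deriv D.X₁)))) (p 2) = 0 := by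
      linear_combination z3 p hp
    simpa [quartic, hs0] using e
  -- Five integrations, each adding one constant; rewriting 0/n as 0 keeps the top coefficient
  -- literally zero, as the next integration requires.
  obtain ⟨c₄, h4⟩ := exists_eq_quartic hI hIc s4 h5
  simp only [zero_div] at h4
  obtain ⟨c₃, h3⟩ := exists_eq_quartic hI hIc s3 h4
  simp only [zero_div] at h3
  obtain ⟨c₂, h2⟩ := exists_eq_quartic hI hIc s2 h3
  simp only [zero_div] at h2
  obtain ⟨c₁, h1⟩ := exists_eq_quartic hI hIc s1 h2
  simp only [zero_div] at h1
  obtain ⟨c₀, h0⟩ := exists_eq_quartic hI hIc s0 h1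
  refine ⟨c₀, c₁, _, _, _, fun p hp => ⟨h0 _ ⟨p, hp, rfl⟩, ?_⟩⟩
  have m1 : p 2 ∈ (fun p : Pt => p 2) '' M := ⟨p, hp, rfl⟩
  have k0 := h p hp
  have k1 := z1' p hp
  have k2 := z2' p hp
  rw [todaExpr] at k0
  rw [h0 _ m1, h1 _ m1, h2 _ m1] at k0
  rw [h1 _ m1, h2 _ m1, h3 _ m1] at k1
  rw [h2 _ m1, h3 _ m1, h4 _ m1] at k2
  simp only [quartic] at *
  -- The weights eliminate X₂' and X₂'' and normalize the coefficient of X₂ to 1. The X₁ terms that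
  -- remain are the Taylor expansion about x₁ of the quartic at x₂.
  linear_combination (-1 / 12) * k0 + (p 2 - p 3) / 12 * k1 - (p 2 - p 3) ^ 2 / 24 * k2

end ChenTeo

end

/-! ### The equivalence -/

theorem mainTheorem7 (M : Set Pt) (hM : IsOpen M) (hMc : IsConnected M)
    (D : ChenTeo) (hc0 : D.c ≠ 0) (hc : D.c = -(1 + D.ν)) (hD : D.SmoothOn M)
    (hg : IsRiemannian M D.metric)
    (hK : IsConformallyKahler M D.metric D.J D.Ω) :
    (IsEinsteinMaxwell M D.metric (maxwellField D.metric D.J D.Ω) 0 ↔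
      ∃ a₀ a₁ a₂ a₃ a₄ : ℝ, ∀ p ∈ M,
        D.X₁ (p 2) = a₀ + a₁ * p 2 + a₂ * p 2 ^ 2 + a₃ * p 2 ^ 3 + a₄ * p 2 ^ 4 ∧
        D.X₂ (p 3) = a₀ + a₁ * p 3 + a₂ * p 3 ^ 2 + a₃ * p 3 ^ 3 + a₄ * p 3 ^ 4) ∧
    ((∃ F : Field2, IsEinsteinMaxwell M D.metric F 0) ↔
      ∃ a₀ a₁ a₂ a₃ a₄ : ℝ, ∀ p ∈ M,
        D.X₁ (p 2) = a₀ + a₁ * p 2 + a₂ * p 2 ^ 2 + a₃ * p 2 ^ 3 + a₄ * p 2 ^ 4 ∧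
        D.X₂ (p 3) = a₀ + a₁ * p 3 + a₂ * p 3 ^ 2 + a₃ * p 3 ^ 3 + a₄ * p 3 ^ 4) := by
  have hz : ∀ p ∈ M, D.z p ≠ 0 := fun p hp h => hK.factor_ne_zero p hp (by simp [ChenTeo.Ω, h])
  have hL : ∀ p ∈ M, D.metric p = D.lebrun.metric p :=
    fun p hp => ChenTeo.metric_eq_lebrun hc0 hg hp
  have H : D.lebrun.IsConformallyKahler M :=
    (ChenTeo.lebrun_isRegular hM hc0 hD hg hz hMc.nonempty).isConformallyKahler hM hL
      (fun p hp => ChenTeo.J_eq_lebrun hc0 hg hp) (fun p _ => rfl) hK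
  -- The two-form is arbitrary, since only the trace of the Einstein equation is used; this covers
  -- both the existential statement and the specific Maxwell field.
  have forward : ∀ F : Field2, IsEinsteinMaxwell M D.metric F 0 → D.IsQuartic M := by
    intro F hF
    refine ChenTeo.isQuartic_of_todaExpr hM hMc hD (fun p hp => ChenTeo.sub_ne_zero hg hp)
      fun p hp => ?_
    have hR := hF.scalarCurv_eq_zero hg hp
    rw [H.scalarCurv_eq hM hL hp, ChenTeo.toda_eq hM hc0 hD hg hp] at hR
    -- Every prefactor between R and the linear expression is nonzero, by positivity of g and c ≠ 0.
    simpa [(LeBrunData.W_pos p).ne', (LeBrunData.U_pos p).ne', hc0, ChenTeo.sub_ne_zero hg hp,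
      ChenTeo.F_ne_zero hg hp, ChenTeo.X₁_ne_zero hg hp, ChenTeo.X₂_ne_zero hg hp] using hR
  have backward : D.IsQuartic M →
      IsEinsteinMaxwell M D.metric (maxwellField D.metric D.J D.Ω) 0 := by
    intro hq
    have hT : ∀ p ∈ M, D.lebrun.toda p = 0 := fun p hp => by
      rw [ChenTeo.toda_eq hM hc0 hD hg hp, hq.todaExpr_eq_zero hM hp, mul_zero, neg_zero]
    exact H.isEinsteinMaxwell hM hL hT fun p hp =>
      H.maxwellField_eq hM hL hp (hT p hp) (ChenTeo.J_eq_lebrun hc0 hg hp) rfl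
  exact ⟨⟨forward _, backward⟩, fun ⟨F, hF⟩ => forward F hF, fun h => ⟨_, backward h⟩⟩
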